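/- Let $d\ge 1$, let $M$ be an integer $d\times d$ matrix all of whose eigenvalues have modulus $>1$, $m=|\det M|$, let $M^*$ be its transpose, and let $H$ be a finite group of unimodular integer $d\times d$ matrices such that $M^{-1}EM\in H$ for all $E\in H$. For $s\in\mathbb Z^d$ put $\langle s\rangle=s+M\mathbb Z^d$; $H$ acts on these cosets by $E\langle s\rangle=\langle Es\rangle$. Number the orbits by $p=0,\dots,L$, let $\langle s_{p,0}\rangle$ be a representative of the orbit number $p$, with $s_{0,0}=0$, let $E_p^{(i)}$, $i=0,\dots,N_p$, with $E_p^{(0)}=I_d$, be representatives of the left cosets in $H$ of the stabilizer $H_{\langle s_{p,0}\rangle}$, and put $s_{p,i}=E_p^{(i)}s_{p,0}$. The vectors $s_{p,i}$ form a set of digits of $M$ (one representative of each coset). Each trigonometric polynomial $t$ is uniquely $t(\xi)=\frac1{\sqrt m}\sum_{p,i}e^{2\pi i(s_{p,i},\xi)}\tau_{p,i}(M^*\xi)$ with trigonometric polynomials $\tau_{p,i}$, its polyphase components. For a set $S\subset H$ and $c\in\mathbb R^d$, $t$ is called $S$-symmetric about $c$ if $c-Ec\in\mathbb Z^d$ and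 $t(\xi)=e^{2\pi i(c-Ec,\xi)}t(E^*\xi)$ for all $E\in S$. Let $n\in\mathbb N$, $n\ge1$, let $D(M^*)\ni 0$ be a set of digits of $M^*$, and let $m_0$ be a trigonometric polynomial that is $H$-symmetric about the origin, is interpolatory, i.e. $\sum_{s\in D(M^*)}m_0(\xi+M^{*-1}s)\equiv1$, and has sum rule of order $n$, i.e. $D^\beta\big(m_0(M^{*-1}\xi)\big)\big|_{\xi=s}=0$ for all $s\in D(M^*)\setminus\{0\}$ and all multi-indices $\beta$ with $[\beta]<n$. Let $\mu_{p,i}$ be its polyphase components (so $\mu_{0,0}\equiv\frac1{\sqrt m}$), let $P$ be the row $(\mu_{p,i})_{p\ge1}$, and let $\widetilde m_0$ be the trigonometric polynomial with the polyphase components $\sqrt m\,\big(1-\sum_{p\ge1,\,i}|\mu_{p,i}|^2\big)$ for the digit $s_{0,0}$ and $\mu_{p,i}$ for $s_{p,i}$, $p\ge1$. Let $$\mathcal N=\begin{pmatrix}\frac1{\sqrt m}&P\\-P^*&\sqrt m\,(I_{m-1}-P^*P)\end{pmatrix},\qquad \widetilde{\mathcal N}=\begin{pmatrix}\sqrt m\,(1-PP^*)&P\\-P^*&\frac1{\sqrt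 m}I_{m-1}\end{pmatrix},$$ and for $p\ge1$ let $m_{(p,i)}$, $\widetilde m_{(p,i)}$ be the trigonometric polynomials (wavelet masks) whose polyphase components form the row $(p,i)$ of $\mathcal N$, $\widetilde{\mathcal N}$ respectively. Then, for all $p\ge1$ and all $i$: 1. $m_{(p,i)}$ and $\widetilde m_{(p,i)}$ have vanishing moments of order $n$: $D^\beta m_{(p,i)}(0)=D^\beta\widetilde m_{(p,i)}(0)=0$ for $[\beta]<n$. 2. $m_{(p,i)}$ and $\widetilde m_{(p,i)}$ are $H_{\langle s_{p,i}\rangle}$-symmetric about $s_{p,i}$. 3. $m_{(p,i)}(\xi)=m_{(p,0)}(E_p^{(i)*}\xi)$ and $\widetilde m_{(p,i)}(\xi)=\widetilde m_{(p,0)}(E_p^{(i)*}\xi)$. 4. Let $\phi,\widetilde\phi$ be the refinable functions given by $\widehat\phi(\xi)=\prod_{j\ge1}m_0(M^{*-j}\xi)$, $\widehat{\widetilde\phi}(\xi)=\prod_{j\ge1}\widetilde m_0(M^{*-j}\xi)$. If $\phi,\widetilde\phi\in L_2(\mathbb R^d)$, then the functions $\psi^{(p,i)},\widetilde\psi^{(p,i)}$,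 $p\ge1$, defined by $\widehat{\psi^{(p,i)}}(\xi)=m_{(p,i)}(M^{*-1}\xi)\widehat\phi(M^{*-1}\xi)$ and $\widehat{\widetilde\psi^{(p,i)}}(\xi)=\widetilde m_{(p,i)}(M^{*-1}\xi)\widehat{\widetilde\phi}(M^{*-1}\xi)$ are in $L_2(\mathbb R^d)$, and the systems $\{m^{j/2}\psi^{(p,i)}(M^j\cdot+k)\}$ and $\{m^{j/2}\widetilde\psi^{(p,i)}(M^j\cdot+k)\}$, $j\in\mathbb Z$, $k\in\mathbb Z^d$, are a pair of dual frames of $L_2(\mathbb R^d)$. -/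

import Mathlib

open MeasureTheory Matrix
open scoped FourierTransform ENNReal

noncomputable section

namespace HSymWavelet

/-! ### Notation on `ℝ^d`, trigonometric polynomials, derivatives -/

/-- The Euclidean space `ℝ^d`. -/
abbrev Rn (d : ℕ) : Type := EuclideanSpace ℝ (Fin d)

/-- The space `L_2(ℝ^d)`. -/
abbrev L2 (d : ℕ) : Type := Lp ℂ 2 (volume : Measure (Rn d))

/-- An integer vector as an element of `ℝ^d`. -/
def intVec {d : ℕ} (k : Fin d → ℤ) : Rn d := WithLp.toLp 2 (fun j => (k j : ℝ))

/-- An integer matrix as a real matrix. -/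
def realMat {d : ℕ} (A : Matrix (Fin d) (Fin d) ℤ) : Matrix (Fin d) (Fin d) ℝ :=
  A.map (Int.cast : ℤ → ℝ)

/-- The action `x ↦ A x` of a real matrix on `ℝ^d`. -/
def act {d : ℕ} (A : Matrix (Fin d) (Fin d) ℝ) (x : Rn d) : Rn d := Matrix.toEuclideanLin A x

/-- The action `ξ ↦ A^* ξ` of the transpose of an integer matrix. -/
def transAct {d : ℕ} (A : Matrix (Fin d) (Fin d) ℤ) (ξ : Rn d) : Rn d := act (realMat A)ᵀ ξ

/-- The action `ξ ↦ (A^*)⁻¹ ξ`. -/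
def transInvAct {d : ℕ} (A : Matrix (Fin d) (Fin d) ℤ) (ξ : Rn d) : Rn d := act ((realMat A)ᵀ)⁻¹ ξ

/-- The exponential `e^{2π i (a, ξ)}`. -/
def chr {d : ℕ} (a ξ : Rn d) : ℂ :=
  Complex.exp (2 * Real.pi * Complex.I * ((∑ j, a j * ξ j : ℝ) : ℂ))

/-- Trigonometric polynomials `∑ h_k e^{2π i (k, ξ)}` (finite sums over `k ∈ ℤ^d`). -/
def IsTrigPoly {d : ℕ} (t : Rn d → ℂ) : Prop :=
  ∃ h : (Fin d → ℤ) →₀ ℂ, ∀ ξ, t ξ = h.sum fun k a => a * chr (intVec k) ξ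

/-- The partial derivative in the `j`-th coordinate. -/
def pderiv {d : ℕ} (j : Fin d) (f : Rn d → ℂ) : Rn d → ℂ :=
  fun x => lineDeriv ℝ f x (EuclideanSpace.single j 1)

/-- The multi-index derivative `D^β`. -/
def mderiv {d : ℕ} (β : Fin d → ℕ) (f : Rn d → ℂ) : Rn d → ℂ :=
  (List.finRange d).foldr (fun j g => (pderiv j)^[β j] g) f

/-! ### Dilation matrices, digits, symmetry groups -/

/-- Dilation matrices: all eigenvalues are bigger than `1` in modulus. -/
def IsDilation {d : ℕ} (M : Matrix (Fin d) (Fin d) ℤ) : Prop :=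
  ∀ z ∈ spectrum ℂ (M.map (Int.cast : ℤ → ℂ)), 1 < ‖z‖

/-- `m = |det M|`. -/
def mdet {d : ℕ} (M : Matrix (Fin d) (Fin d) ℤ) : ℕ := M.det.natAbs

/-- `√m`, as a complex number. -/
def sqrtm {d : ℕ} (M : Matrix (Fin d) (Fin d) ℤ) : ℂ := ((Real.sqrt (mdet M) : ℝ) : ℂ)

/-- Congruence of integer vectors modulo `M`. -/
def CongrMod {d : ℕ} (M : Matrix (Fin d) (Fin d) ℤ) (α β : Fin d → ℤ) : Prop :=
  ∃ γ : Fin d → ℤ, α - β = M *ᵥ γ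

/-- A set of digits of `M`: exactly one representative of each coset of `ℤ^d` modulo `M`,
the zero coset being represented by `0`. -/
def IsDigitSet {d : ℕ} (M : Matrix (Fin d) (Fin d) ℤ) (D : Finset (Fin d → ℤ)) : Prop :=
  0 ∈ D ∧ ∀ α : Fin d → ℤ, ∃! s, s ∈ D ∧ CongrMod M α s

/-- `H` is a symmetry group with respect to `M`: a finite group of unimodular integer matrices
with `M⁻¹ E M ∈ H` for all `E ∈ H`. -/
def IsSymmetryGroup {d : ℕ} (M : Matrix (Fin d) (Fin d) ℤ) (H : Subgroup (GL (Fin d) ℤ)) : Prop :=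
  (H : Set (GL (Fin d) ℤ)).Finite ∧
    ∀ E ∈ H, ∃ E' ∈ H, (E : Matrix (Fin d) (Fin d) ℤ) * M = M * (E' : Matrix (Fin d) (Fin d) ℤ)

/-- The stabilizer in `H` of the coset `⟨s⟩ = s + M ℤ^d` under the action `E⟨s⟩ = ⟨E s⟩`. -/
def cosetStab {d : ℕ} (M : Matrix (Fin d) (Fin d) ℤ) (H : Subgroup (GL (Fin d) ℤ))
    (s : Fin d → ℤ) : Set (GL (Fin d) ℤ) :=
  {K | K ∈ H ∧ CongrMod M ((K : Matrix (Fin d) (Fin d) ℤ) *ᵥ s) s}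

/-- An enumeration of the digits of `M` adapted to `H`. The orbits of `H` on the set of cosets
`ℤ^d / M ℤ^d` are numbered by `p = 0, …, P`; `⟨s p 0⟩` represents the orbit number `p`, with
`s 0 0 = 0`; the matrices `E p i`, `i = 0, …, N p`, form a complete set of representatives of the
left cosets of the stabilizer of `⟨s p 0⟩` in `H`, with `E p 0 = I`; and `s p i = E p i (s p 0)`. -/
structure IsSymDigits {d : ℕ} (M : Matrix (Fin d) (Fin d) ℤ) (H : Subgroup (GL (Fin d) ℤ))
    {P : ℕ} {N : Fin (P + 1) → ℕ} (E : ∀ p, Fin (N p + 1) → GL (Fin d) ℤ)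
    (s : ∀ p, Fin (N p + 1) → (Fin d → ℤ)) : Prop where
  zero : s 0 0 = 0
  orbits : ∀ α : Fin d → ℤ, ∃! p, ∃ K ∈ H,
    CongrMod M α ((K : Matrix (Fin d) (Fin d) ℤ) *ᵥ s p 0)
  mem : ∀ p i, E p i ∈ H
  one : ∀ p, E p 0 = 1
  transversal : ∀ p, ∀ K ∈ H, ∃! i, ∃ F ∈ cosetStab M H (s p 0), K = E p i * F
  digit : ∀ p i, s p i = (E p i : Matrix (Fin d) (Fin d) ℤ) *ᵥ s p 0

/-- The indices `(p, i)` with `p ≠ 0`; the first component `p : Fin P` stands for `p + 1`. -/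
abbrev WIdx {P : ℕ} (N : Fin (P + 1) → ℕ) : Type := Σ p : Fin P, Fin (N p.succ + 1)

/-- All digits: the zero digit `s 0 0` first, then the digits `s p i` with `p ≠ 0`. -/
def digits {d P : ℕ} {N : Fin (P + 1) → ℕ} (s : ∀ p, Fin (N p + 1) → (Fin d → ℤ)) :
    Unit ⊕ WIdx N → (Fin d → ℤ) :=
  Sum.elim (fun _ => s 0 0) (fun w => s w.1.succ w.2)

/-! ### Properties of masks -/

/-- `t` is a trigonometric polynomial that is symmetric about `c` with respect to the set `S` of
unimodular matrices: `c - E c ∈ ℤ^d` and `t(ξ) = e^{2π i (c - E c, ξ)} t(E^* ξ)` for `E ∈ S`. -/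
def IsSymmAbout {d : ℕ} (S : Set (GL (Fin d) ℤ)) (c : Rn d) (t : Rn d → ℂ) : Prop :=
  IsTrigPoly t ∧ ∀ E ∈ S,
    (∃ k : Fin d → ℤ, c - act (realMat (E : Matrix (Fin d) (Fin d) ℤ)) c = intVec k) ∧
    ∀ ξ, t ξ = chr (c - act (realMat (E : Matrix (Fin d) (Fin d) ℤ)) c) ξ *
      t (transAct (E : Matrix (Fin d) (Fin d) ℤ) ξ)

/-- Interpolatory trigonometric polynomials; `D` is a set of digits of `M^*`. -/
def IsInterpolatory {d : ℕ} (M : Matrix (Fin d) (Fin d) ℤ) (D : Finset (Fin d → ℤ))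
    (t : Rn d → ℂ) : Prop :=
  ∀ ξ, ∑ s ∈ D, t (ξ + transInvAct M (intVec s)) = 1

/-- Sum rule of order `n` with respect to `M`; `D` is a set of digits of `M^*`. -/
def HasSumRule {d : ℕ} (M : Matrix (Fin d) (Fin d) ℤ) (D : Finset (Fin d → ℤ)) (n : ℕ)
    (t : Rn d → ℂ) : Prop :=
  ∀ s ∈ D, s ≠ 0 → ∀ β : Fin d → ℕ, ∑ j, β j < n →
    mderiv β (fun ξ => t (transInvAct M ξ)) (intVec s) = 0

/-- Vanishing moments of order `n`. -/
def HasVM {d : ℕ} (n : ℕ) (t : Rn d → ℂ) : Prop :=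
  ∀ β : Fin d → ℕ, ∑ j, β j < n → mderiv β t 0 = 0

/-! ### Polyphase representation and the matrix extension -/

/-- The function `(1/√m) ∑_k e^{2π i (s_k, ξ)} τ_k(M^* ξ)` with given components `τ_k`. -/
def assemble {d : ℕ} {I : Type} [Fintype I] (M : Matrix (Fin d) (Fin d) ℤ)
    (dig : I → (Fin d → ℤ)) (τ : I → Rn d → ℂ) : Rn d → ℂ :=
  fun ξ => 1 / sqrtm M * ∑ k, chr (intVec (dig k)) ξ * τ k (transAct M ξ)

/-- The `τ_k` are the polyphase components of `t`, corresponding to the digits `dig k`. -/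
def IsPolyphase {d : ℕ} {I : Type} [Fintype I] (M : Matrix (Fin d) (Fin d) ℤ)
    (dig : I → (Fin d → ℤ)) (t : Rn d → ℂ) (τ : I → Rn d → ℂ) : Prop :=
  (∀ k, IsTrigPoly (τ k)) ∧ ∀ ξ, t ξ = assemble M dig τ ξ

/-- The row `P` of the polyphase components belonging to the nonzero digits. -/
def rowP {d : ℕ} {W : Type} (μ : Unit ⊕ W → Rn d → ℂ) (ξ : Rn d) : Matrix Unit W ℂ :=
  Matrix.of fun _ w => μ (Sum.inr w) ξ

/-- The extended polyphase matrix `𝒩`. -/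
def matN {d : ℕ} {W : Type} [Fintype W] [DecidableEq W] (M : Matrix (Fin d) (Fin d) ℤ)
    (μ : Unit ⊕ W → Rn d → ℂ) (ξ : Rn d) : Matrix (Unit ⊕ W) (Unit ⊕ W) ℂ :=
  Matrix.fromBlocks ((1 / sqrtm M) • (1 : Matrix Unit Unit ℂ)) (rowP μ ξ)
    (-(rowP μ ξ)ᴴ) (sqrtm M • (1 - (rowP μ ξ)ᴴ * rowP μ ξ))

/-- The dual extended polyphase matrix. -/
def matNt {d : ℕ} {W : Type} [Fintype W] [DecidableEq W] (M : Matrix (Fin d) (Fin d) ℤ)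
    (μ : Unit ⊕ W → Rn d → ℂ) (ξ : Rn d) : Matrix (Unit ⊕ W) (Unit ⊕ W) ℂ :=
  Matrix.fromBlocks (sqrtm M • (1 - rowP μ ξ * (rowP μ ξ)ᴴ)) (rowP μ ξ)
    (-(rowP μ ξ)ᴴ) ((1 / sqrtm M) • (1 : Matrix W W ℂ))

/-- The wavelet mask whose polyphase components form the row `w` of `𝒩`. -/
def waveMask {d : ℕ} {W : Type} [Fintype W] [DecidableEq W] (M : Matrix (Fin d) (Fin d) ℤ)
    (dig : Unit ⊕ W → (Fin d → ℤ)) (μ : Unit ⊕ W → Rn d → ℂ) (w : W) : Rn d → ℂ :=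
  assemble M dig fun k ξ => matN M μ ξ (Sum.inr w) k

/-- The dual wavelet mask whose polyphase components form the row `w` of the dual matrix. -/
def waveMaskDual {d : ℕ} {W : Type} [Fintype W] [DecidableEq W] (M : Matrix (Fin d) (Fin d) ℤ)
    (dig : Unit ⊕ W → (Fin d → ℤ)) (μ : Unit ⊕ W → Rn d → ℂ) (w : W) : Rn d → ℂ :=
  assemble M dig fun k ξ => matNt M μ ξ (Sum.inr w) k

/-- The dual refinable mask, with polyphase components
`(√m (1 - ∑_{k ≠ 0} |μ_k|²), μ_1, …, μ_{m-1})`. -/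
def dualMask {d : ℕ} {W : Type} [Fintype W] (M : Matrix (Fin d) (Fin d) ℤ)
    (dig : Unit ⊕ W → (Fin d → ℤ)) (μ : Unit ⊕ W → Rn d → ℂ) : Rn d → ℂ :=
  assemble M dig
    (Sum.elim (fun _ ξ => sqrtm M * (1 - ((∑ w : W, ‖μ (Sum.inr w) ξ‖ ^ 2 : ℝ) : ℂ)))
      (fun w => μ (Sum.inr w)))

/-! ### Refinable functions, wavelet systems, frames -/

/-- The Fourier transform `∏_{j ≥ 1} m_0((M^*)^{-j} ξ)` of the refinable function of `m_0`. -/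
def refinableFT {d : ℕ} (M : Matrix (Fin d) (Fin d) ℤ) (m0 : Rn d → ℂ) : Rn d → ℂ :=
  fun ξ => ∏' j : ℕ, m0 ((transInvAct M)^[j + 1] ξ)

/-- `f ∈ L_2(ℝ^d)` is the refinable function of the mask `m_0`. -/
def IsRefinableL2 {d : ℕ} (M : Matrix (Fin d) (Fin d) ℤ) (m0 : Rn d → ℂ) (f : L2 d) : Prop :=
  (𝓕 f : L2 d) =ᵐ[volume] refinableFT M m0

/-- `ψ ∈ L_2(ℝ^d)` is the wavelet function with wavelet mask `t` built from `f`: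
the Fourier transform of `ψ` at `ξ` is `t((M^*)⁻¹ ξ)` times that of `f` at `(M^*)⁻¹ ξ`, where `f`
has the refinable mask `m_0`. -/
def IsWaveletL2 {d : ℕ} (M : Matrix (Fin d) (Fin d) ℤ) (m0 t : Rn d → ℂ) (ψ : L2 d) : Prop :=
  (𝓕 ψ : L2 d) =ᵐ[volume] fun ξ => t (transInvAct M ξ) * refinableFT M m0 (transInvAct M ξ)

/-- The function `f_{jk} = m^{j/2} f(M^j · + k)`. -/
def dilShift {d : ℕ} (M : Matrix (Fin d) (Fin d) ℤ) (j : ℤ) (k : Fin d → ℤ) (f : Rn d → ℂ) :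
    Rn d → ℂ :=
  fun x => (((mdet M : ℝ) ^ ((j : ℝ) / 2) : ℝ) : ℂ) * f (act ((realMat M) ^ j) x + intVec k)

theorem IsDilation.det_ne_zero {d : ℕ} {M : Matrix (Fin d) (Fin d) ℤ} (hM : IsDilation M) :
    (realMat M).det ≠ 0 := by
  have h0 : (0 : ℂ) ∉ spectrum ℂ (M.map (Int.cast : ℤ → ℂ)) := by
    intro h
    have := hM 0 h
    simp at this
    linarith
  rw [spectrum.zero_notMem_iff, Matrix.isUnit_iff_isUnit_det, isUnit_iff_ne_zero] at h0
  have e1 : (M.map (Int.cast : ℤ → ℂ)).det = (M.det : ℂ) := by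
    have := (Int.castRingHom ℂ).map_det M
    simpa using this.symm
  have e2 : (realMat M).det = (M.det : ℝ) := by
    have := (Int.castRingHom ℝ).map_det M
    simpa [realMat] using this.symm
  rw [e1] at h0
  rw [e2]
  exact_mod_cast h0

theorem memLp_dilShift {d : ℕ} {M : Matrix (Fin d) (Fin d) ℤ} (hM : IsDilation M) (j : ℤ)
    (k : Fin d → ℤ) (f : L2 d) :
    MemLp (dilShift M j k f) 2 (volume : Measure (Rn d)) := by
  have hdet : ((realMat M) ^ j).det ≠ 0 := by
    have h1 : IsUnit (realMat M).det := isUnit_iff_ne_zero.mpr hM.det_ne_zero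
    exact ((h1.det_zpow j)).ne_zero
  have hlin : LinearMap.det (Matrix.toEuclideanLin ((realMat M) ^ j)) ≠ 0 := by
    simpa using hdet
  have hmeas : Measurable fun x : Rn d => act ((realMat M) ^ j) x + intVec k :=
    ((Matrix.toEuclideanLin ((realMat M) ^ j)).continuous_of_finiteDimensional.measurable).add_const _
  have hmap : Measure.map (fun x : Rn d => act ((realMat M) ^ j) x + intVec k) volume
      = ENNReal.ofReal |(LinearMap.det (Matrix.toEuclideanLin ((realMat M) ^ j)))⁻¹| •
        (volume : Measure (Rn d)) := by
    have h1 := Measure.map_linearMap_addHaar_eq_smul_addHaar (volume : Measure (Rn d)) hlin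
    have h2 : Measure.map (fun x : Rn d => x + intVec k) volume = (volume : Measure (Rn d)) :=
      MeasureTheory.map_add_right_eq_self _ _
    have h3 : (fun x : Rn d => act ((realMat M) ^ j) x + intVec k)
        = (fun x : Rn d => x + intVec k) ∘ (Matrix.toEuclideanLin ((realMat M) ^ j)) := rfl
    rw [h3, ← Measure.map_map (measurable_add_const _)
      (Matrix.toEuclideanLin ((realMat M) ^ j)).continuous_of_finiteDimensional.measurable, h1,
      Measure.map_smul, h2]
  have hf : MemLp (f : Rn d → ℂ) 2
      (Measure.map (fun x : Rn d => act ((realMat M) ^ j) x + intVec k) volume) := by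
    rw [hmap]
    exact (Lp.memLp f).smul_measure ENNReal.ofReal_ne_top
  exact (hf.comp_of_map hmeas.aemeasurable).const_mul _

/-- `f_{jk}` as an element of `L_2(ℝ^d)`. -/
def dilShiftL2 {d : ℕ} {M : Matrix (Fin d) (Fin d) ℤ} (hM : IsDilation M) (j : ℤ)
    (k : Fin d → ℤ) (f : L2 d) : L2 d :=
  (memLp_dilShift hM j k f).toLp _

/-- The wavelet system `{ψ^{(ν)}_{jk}}` generated by the functions `ψ^{(ν)}`. -/
def waveletSystem {d : ℕ} {M : Matrix (Fin d) (Fin d) ℤ} (hM : IsDilation M) {W : Type}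
    (ψ : W → L2 d) : W × ℤ × (Fin d → ℤ) → L2 d :=
  fun a => dilShiftL2 hM a.2.1 a.2.2 (ψ a.1)

/-- Frames in a Hilbert space. -/
def IsFrame {ι 𝓗 : Type*} [NormedAddCommGroup 𝓗] [InnerProductSpace ℂ 𝓗] (g : ι → 𝓗) : Prop :=
  ∃ A B : ℝ, 0 < A ∧ 0 < B ∧ ∀ f : 𝓗, Summable (fun a => ‖inner ℂ (g a) f‖ ^ 2) ∧
    A * ‖f‖ ^ 2 ≤ ∑' a, ‖inner ℂ (g a) f‖ ^ 2 ∧ ∑' a, ‖inner ℂ (g a) f‖ ^ 2 ≤ B * ‖f‖ ^ 2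

/-- `g` and `g'` are a pair of dual frames: both are frames, and every `f` is the (unconditionally
convergent) sum of `⟨f, g'_a⟩ g_a` and also of `⟨f, g_a⟩ g'_a`. -/
def IsDualFramePair {ι 𝓗 : Type*} [NormedAddCommGroup 𝓗] [InnerProductSpace ℂ 𝓗]
    (g g' : ι → 𝓗) : Prop :=
  IsFrame g ∧ IsFrame g' ∧
    (∀ f : 𝓗, HasSum (fun a => inner ℂ (g' a) f • g a) f) ∧
    ∀ f : 𝓗, HasSum (fun a => inner ℂ (g a) f • g' a) f

end HSymWavelet

end

open HSymWavelet

/-! Everything about the masks is read off the coset components `component`, c_k(ξ) = m^{-1/2}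
e^{2πi(s_k,ξ)} μ_k(M^*ξ), whose sum is m0. Fourier inversion on ℤ^d/M^*ℤ^d (`mdet_mul_component`)
writes m c_k as a combination of the shifts m0(ξ + M^{*-1}s) with character values as coefficients.
Hence interpolation fixes c_0 = 1/m, the sum rule makes 1 - m c_k vanish to order n at the origin,
and H permutes the c_k in the way it permutes the cosets. The rows of the two extended matrices
collapse to m_w = e^{2πi(s_w,ξ)} (1 - m conj(c_w) m0) and m̃_w = m^{-1} e^{2πi(s_w,ξ)} (1 - m
conj(c_w)) (`waveMask_eq`, `waveMaskDual_eq`), which gives the vanishing moments and both symmetry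
statements.

For the frames, the identity Ñ^* N = 1 says that the wavelet sums of level j are the difference of
the scaling-function sums of levels j + 1 and j (`sum_levelSum_assembleCoeff`). The scaling sums
tend to ⟨f, g⟩ at fine scales, by Parseval's identity on the unit cube and φ^ → 1 at 0, and to 0 at
coarse scales. Telescoping yields the weak reconstruction formula. Two Bessel families with weak
reconstruction are dual frames (`isDualFramePair_of_isBessel`).

The Bessel property is obtained without any smoothness or decay assumption beyond φ ∈ L_2. The
refinable function has compact support, by a weak Paley–Wiener argument on the partial products
(`exists_ae_eq_zero_of_norm_gt`), so Gram sequences of integer translates are finite. In an inner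
product between wavelets of levels j and j + n, the fine wavelet filter, which has mean zero, can be
moved to the other side, where it acts on φ as a difference operator of step M^{-n}. The refinement
equation turns the Gram sequences of these differences into an orbit of one linear map on a
finite-dimensional space. The orbit tends to 0 by continuity of translations, hence it decays
geometrically (`exists_geometric_bound_of_tendsto_zero`). Distinct levels are therefore almost
orthogonal and Schur's test applies. The same decay gives the coarse scale limit. -/

noncomputable section

namespace HSymWavelet

section

/-! ### Bessel families and dual frames in a Hilbert space -/

section Bessel

variable {𝓗 : Type*} [NormedAddCommGroup 𝓗] [InnerProductSpace ℂ 𝓗]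

/-- Synthesis form of the Bessel property with bound `B`. -/
def IsBessel {ι : Type*} (g : ι → 𝓗) (B : ℝ) : Prop :=
  ∀ (s : Finset ι) (c : ι → ℂ), ‖∑ a ∈ s, c a • g a‖ ^ 2 ≤ B * ∑ a ∈ s, ‖c a‖ ^ 2

theorem IsBessel.mono {ι : Type*} {g : ι → 𝓗} {B C : ℝ} (h : IsBessel g B) (hBC : B ≤ C) :
    IsBessel g C := fun s c => (h s c).trans
  (mul_le_mul_of_nonneg_right hBC (Finset.sum_nonneg fun _ _ => by positivity))

theorem IsBessel.comp_injective {ι κ : Type*} {g : ι → 𝓗} {B : ℝ} (h : IsBessel g B)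
    {e : κ → ι} (he : Function.Injective e) : IsBessel (g ∘ e) B := by
  classical
  intro s c
  have h1 := h (s.map ⟨e, he⟩) (Function.extend e c 0)
  simpa [Finset.sum_map, he.extend_apply] using h1

theorem IsBessel.map {𝓚 : Type*} [NormedAddCommGroup 𝓚] [InnerProductSpace ℂ 𝓚]
    {ι : Type*} {g : ι → 𝓗} {B : ℝ} (h : IsBessel g B) (U : 𝓗 →ₗᵢ[ℂ] 𝓚) :
    IsBessel (fun a => U (g a)) B := by
  intro s c
  have := h s c
  rw [← U.norm_map] at this
  simpa using this

/-- Duality: with c_a = ⟨g_a, f⟩ the sum S on the left is the inner product of ∑ c_a g_a with f, so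
Cauchy–Schwarz and the synthesis bound give S² ≤ B S ‖f‖², and one factor S cancels. -/
theorem IsBessel.sum_le {ι : Type*} {g : ι → 𝓗} {B : ℝ} (h : IsBessel g B) (hB : 0 ≤ B)
    (s : Finset ι) (f : 𝓗) : ∑ a ∈ s, ‖inner ℂ (g a) f‖ ^ 2 ≤ B * ‖f‖ ^ 2 := by
  set S := ∑ a ∈ s, ‖inner ℂ (g a) f‖ ^ 2 with hS
  have hS0 : 0 ≤ S := Finset.sum_nonneg fun _ _ => by positivity
  have h1 := h s fun a => inner ℂ (g a) f
  have h2 : inner ℂ (∑ a ∈ s, (inner ℂ (g a) f) • g a) f = (S : ℂ) := by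
    rw [sum_inner, hS]
    push_cast
    refine Finset.sum_congr rfl fun a _ => ?_
    rw [inner_smul_left, Complex.conj_mul']
  have h3 : S ≤ ‖∑ a ∈ s, (inner ℂ (g a) f) • g a‖ * ‖f‖ := by
    have := norm_inner_le_norm (𝕜 := ℂ) (∑ a ∈ s, (inner ℂ (g a) f) • g a) f
    rw [h2, Complex.norm_real, Real.norm_of_nonneg hS0] at this
    exact this
  have h4 : S ^ 2 ≤ B * S * ‖f‖ ^ 2 := by
    calc S ^ 2 ≤ (‖∑ a ∈ s, (inner ℂ (g a) f) • g a‖ * ‖f‖) ^ 2 := by gcongr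
      _ = ‖∑ a ∈ s, (inner ℂ (g a) f) • g a‖ ^ 2 * ‖f‖ ^ 2 := by ring
      _ ≤ _ := by gcongr
  rcases hS0.eq_or_lt with h5 | h5
  · rw [← h5]; positivity
  · nlinarith

theorem IsBessel.summable {ι : Type*} {g : ι → 𝓗} {B : ℝ} (h : IsBessel g B) (hB : 0 ≤ B)
    (f : 𝓗) : Summable fun a => ‖inner ℂ (g a) f‖ ^ 2 :=
  summable_of_sum_le (fun _ => by positivity) fun s => h.sum_le hB s f

theorem IsBessel.tsum_le {ι : Type*} {g : ι → 𝓗} {B : ℝ} (h : IsBessel g B) (hB : 0 ≤ B)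
    (f : 𝓗) : ∑' a, ‖inner ℂ (g a) f‖ ^ 2 ≤ B * ‖f‖ ^ 2 :=
  (h.summable hB f).tsum_le_of_sum_le fun s => h.sum_le hB s f

theorem summable_mul_of_sq {ι : Type*} {x y : ι → ℂ} (hx : Summable fun a => ‖x a‖ ^ 2)
    (hy : Summable fun a => ‖y a‖ ^ 2) : Summable fun a => x a * y a := by
  refine Summable.of_norm_bounded (hx.add hy) fun a => ?_
  rw [norm_mul]
  nlinarith [sq_nonneg (‖x a‖ - ‖y a‖), sq_nonneg ‖x a‖, sq_nonneg ‖y a‖]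

theorem summable_inner_mul {ι : Type*} {g g' : ι → 𝓗} {B B' : ℝ} (h : IsBessel g B)
    (h' : IsBessel g' B') (hB : 0 ≤ B) (hB' : 0 ≤ B') (f f' : 𝓗) :
    Summable fun a => inner ℂ f (g a) * inner ℂ (g' a) f' := by
  refine summable_mul_of_sq ?_ (h'.summable hB' f')
  simpa only [norm_inner_symm] using h.summable hB f

theorem norm_tsum_inner_mul_le {ι : Type*} {g g' : ι → 𝓗} {B B' : ℝ} (h : IsBessel g B)
    (h' : IsBessel g' B') (hB : 0 ≤ B) (hB' : 0 ≤ B') (f f' : 𝓗) :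
    ‖∑' a, inner ℂ f (g a) * inner ℂ (g' a) f'‖ ≤ √B * ‖f‖ * (√B' * ‖f'‖) := by
  refine le_of_tendsto (summable_inner_mul h h' hB hB' f f').hasSum.norm
    (Filter.Eventually.of_forall fun s => ?_)
  calc ‖∑ a ∈ s, inner ℂ f (g a) * inner ℂ (g' a) f'‖
      ≤ ∑ a ∈ s, ‖inner ℂ (g a) f‖ * ‖inner ℂ (g' a) f'‖ := by
        refine (norm_sum_le _ _).trans (Finset.sum_le_sum fun a _ => ?_)
        rw [norm_mul, norm_inner_symm]
    _ ≤ √(∑ a ∈ s, ‖inner ℂ (g a) f‖ ^ 2) * √(∑ a ∈ s, ‖inner ℂ (g' a) f'‖ ^ 2) :=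
        Real.sum_mul_le_sqrt_mul_sqrt _ _ _
    _ ≤ √(B * ‖f‖ ^ 2) * √(B' * ‖f'‖ ^ 2) := by
        gcongr
        · exact h.sum_le hB s f
        · exact h'.sum_le hB' s f'
    _ = _ := by
        rw [Real.sqrt_mul hB, Real.sqrt_mul hB', Real.sqrt_sq (norm_nonneg _),
          Real.sqrt_sq (norm_nonneg _)]

theorem IsBessel.summable_smul [CompleteSpace 𝓗] {ι : Type*} {g : ι → 𝓗} {B : ℝ}
    (h : IsBessel g B) (hB : 0 ≤ B) {c : ι → ℂ} (hc : Summable fun a => ‖c a‖ ^ 2) :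
    Summable fun a => c a • g a := by
  rw [summable_iff_vanishing_norm]
  intro ε hε
  -- The denominator is `B + 1` rather than `B` so that `B = 0` is allowed.
  obtain ⟨s, hs⟩ := summable_iff_vanishing_norm.mp hc (ε ^ 2 / (B + 1)) (by positivity)
  refine ⟨s, fun t ht => ?_⟩
  have h1 := hs t ht
  rw [Real.norm_of_nonneg (Finset.sum_nonneg fun _ _ => by positivity), lt_div_iff₀ (by positivity)]
    at h1
  have h2 := h t c
  have h3 : (0 : ℝ) ≤ ∑ a ∈ t, ‖c a‖ ^ 2 := Finset.sum_nonneg fun _ _ => by positivity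
  exact lt_of_pow_lt_pow_left₀ 2 hε.le (by nlinarith)

/-- Two Bessel families with the weak reconstruction property are a pair of dual frames. -/
theorem isDualFramePair_of_isBessel [CompleteSpace 𝓗] {ι : Type*} {g g' : ι → 𝓗} {B B' : ℝ}
    (hB : 0 < B) (hB' : 0 < B') (h : IsBessel g B) (h' : IsBessel g' B')
    (hrec : ∀ f f' : 𝓗, HasSum (fun a => inner ℂ f (g a) * inner ℂ (g' a) f') (inner ℂ f f')) :
    IsDualFramePair g g' := by
  have key : ∀ {u u' : ι → 𝓗} {C C' : ℝ}, 0 < C → 0 < C' → IsBessel u C → IsBessel u' C' →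
      (∀ f f' : 𝓗, HasSum (fun a => inner ℂ f (u a) * inner ℂ (u' a) f') (inner ℂ f f')) →
      (∀ f, HasSum (fun a => inner ℂ (u' a) f • u a) f) ∧ IsFrame u' := by
    intro u u' C C' hC hC' hu hu' hr
    have hs : ∀ f, HasSum (fun a => inner ℂ (u' a) f • u a) f := by
      intro f
      have h1 := hu.summable_smul hC.le (hu'.summable hC'.le f)
      have h2 : ∑' a, inner ℂ (u' a) f • u a = f := by
        refine ext_inner_left ℂ fun v => ?_
        have h3 := h1.hasSum.mapL (innerSL ℂ v)
        have h4 : (fun a => innerSL ℂ v (inner ℂ (u' a) f • u a)) =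
            fun a => inner ℂ v (u a) * inner ℂ (u' a) f := by
          funext a
          rw [innerSL_apply_apply, inner_smul_right, mul_comm]
        rw [h4] at h3
        exact h3.unique (hr v f)
      simpa [h2] using h1.hasSum
    -- The lower frame bound of `u'` comes from the upper bound of `u`: the expansion of `f` in `u`
    -- has coefficients ⟨u'_a, f⟩, so ‖f‖² is at most `C` times their square sum.
    refine ⟨hs, 1 / C, C', by positivity, hC', fun f => ⟨hu'.summable hC'.le f, ?_,
      hu'.tsum_le hC'.le f⟩⟩
    rw [one_div, inv_mul_le_iff₀ hC]
    refine le_of_tendsto ((hs f).norm.pow 2) (Filter.Eventually.of_forall fun s => ?_)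
    refine (hu s _).trans ?_
    gcongr
    exact (hu'.summable hC'.le f).sum_le_tsum s fun _ _ => by positivity
  have hrec' : ∀ f f' : 𝓗,
      HasSum (fun a => inner ℂ f (g' a) * inner ℂ (g a) f') (inner ℂ f f') := by
    intro f f'
    have := (hrec f' f).star
    simpa only [RCLike.star_def, map_mul, inner_conj_symm, mul_comm] using this
  obtain ⟨h1, h2⟩ := key hB hB' h h' hrec
  obtain ⟨h3, h4⟩ := key hB' hB h' h hrec'
  exact ⟨h4, h2, h1, h3⟩

/-- Schur's test for a difference kernel. -/
theorem sum_sum_sub_mul_le {G : Type*} [AddCommGroup G] {α : G → ℝ} (hα : ∀ u, 0 ≤ α u) {B : ℝ}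
    (hB : ∀ T : Finset G, ∑ u ∈ T, α u ≤ B) (s : Finset G) (x : G → ℝ) :
    ∑ k ∈ s, ∑ l ∈ s, α (l - k) * (x k * x l) ≤ B * ∑ k ∈ s, x k ^ 2 := by
  classical
  have h1 : ∀ k, ∑ l ∈ s, α (l - k) ≤ B := fun k => by
    have := hB (s.map ⟨fun l => l - k, sub_left_injective⟩)
    simpa using this
  have h2 : ∀ l, ∑ k ∈ s, α (l - k) ≤ B := fun l => by
    have := hB (s.map ⟨fun k => l - k, sub_right_injective⟩)
    simpa using this
  calc ∑ k ∈ s, ∑ l ∈ s, α (l - k) * (x k * x l)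
      ≤ ∑ k ∈ s, ∑ l ∈ s, (α (l - k) * (x k ^ 2 / 2) + α (l - k) * (x l ^ 2 / 2)) := by
        refine Finset.sum_le_sum fun k _ => Finset.sum_le_sum fun l _ => ?_
        rw [← mul_add]
        exact mul_le_mul_of_nonneg_left (by nlinarith [sq_nonneg (x k - x l)]) (hα _)
    _ = ∑ k ∈ s, (∑ l ∈ s, α (l - k)) * (x k ^ 2 / 2) +
        ∑ l ∈ s, (∑ k ∈ s, α (l - k)) * (x l ^ 2 / 2) := by
        simp only [Finset.sum_add_distrib, Finset.sum_mul]
        congr 1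
        exact Finset.sum_comm
    _ ≤ ∑ k ∈ s, B * (x k ^ 2 / 2) + ∑ l ∈ s, B * (x l ^ 2 / 2) := by
        gcongr with k _ l _
        · exact h1 k
        · exact h2 l
    _ = _ := by
        rw [← Finset.sum_add_distrib, Finset.mul_sum]
        exact Finset.sum_congr rfl fun k _ => by ring

theorem norm_sq_sum_le {ι : Type*} (s : Finset ι) (y : ι → 𝓗) :
    ‖∑ k ∈ s, y k‖ ^ 2 ≤ ∑ k ∈ s, ∑ l ∈ s, ‖inner ℂ (y k) (y l)‖ := by
  have h1 : ‖∑ k ∈ s, y k‖ ^ 2 = ‖inner ℂ (∑ k ∈ s, y k) (∑ k ∈ s, y k)‖ := by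
    rw [inner_self_eq_norm_sq_to_K]
    simp
  rw [h1, sum_inner]
  refine (norm_sum_le _ _).trans (Finset.sum_le_sum fun k _ => ?_)
  rw [inner_sum]
  exact norm_sum_le _ _

/-- A shift-type family whose Gram sequence has finite support is a Bessel family. -/
theorem isBessel_of_gram {G : Type*} [AddCommGroup G] {v : G → 𝓗} {γ : G → ℂ}
    (hγ : ∀ k l, inner ℂ (v k) (v l) = γ (l - k)) (K : Finset G) (hK : ∀ u ∉ K, γ u = 0) :
    IsBessel v (∑ u ∈ K, ‖γ u‖) := by
  classical
  intro s c
  refine (norm_sq_sum_le s _).trans (le_trans (le_of_eq ?_) (sum_sum_sub_mul_le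
    (α := fun u => ‖γ u‖) (fun u => norm_nonneg _) (fun T => ?_) s fun k => ‖c k‖))
  · refine Finset.sum_congr rfl fun k _ => Finset.sum_congr rfl fun l _ => ?_
    rw [inner_smul_left, inner_smul_right, hγ]
    simp
    ring
  · rw [← Finset.sum_filter_add_sum_filter_not T (fun u => u ∈ K)]
    have h0 : ∑ u ∈ T with u ∉ K, ‖γ u‖ = 0 :=
      Finset.sum_eq_zero fun u hu => by simp [hK u (Finset.mem_filter.mp hu).2]
    rw [h0, add_zero]
    exact Finset.sum_le_sum_of_subset_of_nonneg
      (fun u hu => (Finset.mem_filter.mp hu).2) fun _ _ _ => norm_nonneg _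

/-- Almost orthogonal levels: a family on `ℤ × κ` is Bessel if the mutual Gram operators of its
levels have summable norms. -/
theorem isBessel_of_almost_orthogonal {κ : Type*} {g : ℤ × κ → 𝓗} {a : ℕ → ℝ}
    (ha : Summable a) (ha0 : ∀ n, 0 ≤ a n)
    (h : ∀ (j : ℤ) (n : ℕ) (s : Finset κ) (c e : κ → ℂ),
      ‖inner ℂ (∑ k ∈ s, c k • g (j, k)) (∑ k ∈ s, e k • g (j + n, k))‖ ≤
        a n * (√(∑ k ∈ s, ‖c k‖ ^ 2) * √(∑ k ∈ s, ‖e k‖ ^ 2))) :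
    ∃ B, 0 < B ∧ IsBessel g B := by
  classical
  -- The factor 2 appears because `Int.natAbs` is injective on the nonnegative and on the negative
  -- integers separately.
  have hα : ∀ T : Finset ℤ, ∑ u ∈ T, a u.natAbs ≤ 2 * ∑' n, a n := by
    intro T
    rw [← Finset.sum_filter_add_sum_filter_not T (fun u => 0 ≤ u), two_mul]
    have h1 : ∀ T' : Finset ℤ, Set.InjOn Int.natAbs (T' : Set ℤ) →
        ∑ u ∈ T', a u.natAbs ≤ ∑' n, a n := fun T' hT' => by
      rw [← Finset.sum_image (f := a) hT']
      exact ha.sum_le_tsum _ fun _ _ => ha0 _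
    refine add_le_add (h1 _ ?_) (h1 _ ?_)
    · intro x hx y hy hxy
      simp at hx hy
      have hxy' : x.natAbs = y.natAbs := hxy
      omega
    · intro x hx y hy hxy
      simp at hx hy
      have hxy' : x.natAbs = y.natAbs := hxy
      omega
  have hB0 : 0 ≤ 2 * ∑' n, a n := mul_nonneg zero_le_two (tsum_nonneg ha0)
  refine ⟨2 * ∑' n, a n + 1, by positivity, ?_⟩
  refine IsBessel.mono (B := 2 * ∑' n, a n) ?_ (by linarith)
  intro S c₀
  -- The finite index set is enlarged to a rectangle of levels times positions, with zero
  -- coefficients off `S`, so that the sum splits by level.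
  set J := S.image Prod.fst
  set K := S.image Prod.snd
  set c : ℤ × κ → ℂ := fun p => if p ∈ S then c₀ p else 0 with hc
  have hsub : S ⊆ J ×ˢ K := fun p hp => Finset.mem_product.mpr
    ⟨Finset.mem_image_of_mem _ hp, Finset.mem_image_of_mem _ hp⟩
  have e1 : ∑ p ∈ S, c₀ p • g p = ∑ j ∈ J, ∑ k ∈ K, c (j, k) • g (j, k) := by
    rw [← Finset.sum_product', ← Finset.sum_subset hsub]
    · exact Finset.sum_congr rfl fun p hp => by simp [hc, hp]
    · intro p _ hp
      simp [hc, hp]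
  have e2 : ∑ p ∈ S, ‖c₀ p‖ ^ 2 = ∑ j ∈ J, (√(∑ k ∈ K, ‖c (j, k)‖ ^ 2)) ^ 2 := by
    have : ∀ j, (√(∑ k ∈ K, ‖c (j, k)‖ ^ 2)) ^ 2 = ∑ k ∈ K, ‖c (j, k)‖ ^ 2 := fun j =>
      Real.sq_sqrt (Finset.sum_nonneg fun _ _ => by positivity)
    simp_rw [this]
    rw [← Finset.sum_product' (f := fun j k => ‖c (j, k)‖ ^ 2), ← Finset.sum_subset hsub]
    · exact Finset.sum_congr rfl fun p hp => by simp [hc, hp]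
    · intro p _ hp
      simp [hc, hp]
  rw [e1, e2]
  refine (norm_sq_sum_le J _).trans (le_trans ?_ (sum_sum_sub_mul_le
    (α := fun u : ℤ => a u.natAbs) (fun u => ha0 _) hα J
    fun j => √(∑ k ∈ K, ‖c (j, k)‖ ^ 2)))
  refine Finset.sum_le_sum fun j _ => Finset.sum_le_sum fun j' _ => ?_
  rcases le_total j j' with hj | hj
  · have := h j (j' - j).natAbs K (fun k => c (j, k)) (fun k => c (j', k))
    rwa [show j + ((j' - j).natAbs : ℤ) = j' by omega] at this
  · have := h j' (j' - j).natAbs K (fun k => c (j', k)) (fun k => c (j, k))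
    rw [show j' + ((j' - j).natAbs : ℤ) = j by omega, norm_inner_symm] at this
    rwa [mul_comm (√_)] at this

/-- Cauchy–Schwarz over `W` costs the factor `Fintype.card W`, and ∑ B_w serves as a common bound
for the members. -/
theorem isBessel_of_fintype {W ι : Type*} [Fintype W] {g : W × ι → 𝓗}
    (h : ∀ w, ∃ B, 0 < B ∧ IsBessel (fun a => g (w, a)) B) : ∃ B, 0 < B ∧ IsBessel g B := by
  classical
  choose B hB hg using h
  refine ⟨Fintype.card W * ∑ w, B w + 1, by
    have := Finset.sum_nonneg fun (w : W) (_ : w ∈ Finset.univ) => (hB w).le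
    positivity, ?_⟩
  refine IsBessel.mono (B := Fintype.card W * ∑ w, B w) ?_ (by linarith)
  intro S c₀
  set K := S.image Prod.snd
  set c : W × ι → ℂ := fun p => if p ∈ S then c₀ p else 0 with hc
  have hsub : S ⊆ Finset.univ ×ˢ K := fun p hp => Finset.mem_product.mpr
    ⟨Finset.mem_univ _, Finset.mem_image_of_mem _ hp⟩
  have e1 : ∑ p ∈ S, c₀ p • g p = ∑ w, ∑ k ∈ K, c (w, k) • g (w, k) := by
    rw [← Finset.sum_product', ← Finset.sum_subset hsub]
    · exact Finset.sum_congr rfl fun p hp => by simp [hc, hp]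
    · intro p _ hp
      simp [hc, hp]
  have e2 : ∑ p ∈ S, ‖c₀ p‖ ^ 2 = ∑ w, ∑ k ∈ K, ‖c (w, k)‖ ^ 2 := by
    rw [← Finset.sum_product' (f := fun j k => ‖c (j, k)‖ ^ 2), ← Finset.sum_subset hsub]
    · exact Finset.sum_congr rfl fun p hp => by simp [hc, hp]
    · intro p _ hp
      simp [hc, hp]
  rw [e1, e2]
  calc ‖∑ w, ∑ k ∈ K, c (w, k) • g (w, k)‖ ^ 2
      ≤ (∑ w, ‖∑ k ∈ K, c (w, k) • g (w, k)‖) ^ 2 := by gcongr; exact norm_sum_le _ _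
    _ ≤ Fintype.card W * ∑ w, ‖∑ k ∈ K, c (w, k) • g (w, k)‖ ^ 2 :=
        sq_sum_le_card_mul_sum_sq
    _ ≤ Fintype.card W * ∑ w, (∑ w', B w') * ∑ k ∈ K, ‖c (w, k)‖ ^ 2 := by
        gcongr with w _
        refine (hg w K fun k => c (w, k)).trans ?_
        gcongr
        exact Finset.single_le_sum (f := B) (fun w _ => (hB w).le) (Finset.mem_univ w)
    _ = _ := by rw [← Finset.mul_sum, mul_assoc]

end Bessel

/-! ### Orbits of a linear map in finite dimension -/

/-- With ρ^N = 1/2, a halving every `N` steps is exactly a decay by ρ per step. The constant only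
has to dominate v_i / ρ^i for i < N. -/
theorem exists_geometric_bound {v : ℕ → ℝ} (hv : ∀ n, 0 ≤ v n) {N : ℕ} (hN : 0 < N)
    (h : ∀ n, v (n + N) ≤ 1 / 2 * v n) :
    ∃ C ρ : ℝ, 0 ≤ C ∧ 0 < ρ ∧ ρ < 1 ∧ ∀ n, v n ≤ C * ρ ^ n := by
  set ρ : ℝ := (1 / 2 : ℝ) ^ (1 / (N : ℝ)) with hρ
  have hρ0 : 0 < ρ := by positivity
  have hρN : ρ ^ N = 1 / 2 := by
    rw [hρ, ← Real.rpow_natCast, ← Real.rpow_mul (by norm_num), one_div_mul_cancel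
      (by positivity), Real.rpow_one]
  have hρ1 : ρ < 1 := Real.rpow_lt_one (by norm_num) (by norm_num) (by positivity)
  refine ⟨∑ i ∈ Finset.range N, v i / ρ ^ i, ρ,
    Finset.sum_nonneg fun i _ => div_nonneg (hv i) (by positivity), hρ0, hρ1, fun n => ?_⟩
  induction n using Nat.strong_induction_on with
  | _ n ih =>
    rcases lt_or_ge n N with hn | hn
    · rw [← div_le_iff₀ (by positivity)]
      exact Finset.single_le_sum (f := fun i => v i / ρ ^ i)
        (fun i _ => div_nonneg (hv i) (by positivity)) (Finset.mem_range.mpr hn)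
    · obtain ⟨r, rfl⟩ := Nat.exists_eq_add_of_le' hn
      have h1 := ih r (by omega)
      rw [pow_add, hρN]
      linarith [h r]

/-- `T` itself need not be a contraction. On the span of the orbit the powers T^N tend to 0
pointwise, hence in operator norm because the span has finite dimension, so some T^N halves every
vector of the orbit. -/
theorem exists_geometric_bound_of_tendsto_zero {V : Type*} [NormedAddCommGroup V]
    [NormedSpace ℂ V] [FiniteDimensional ℂ V] (T : V →ₗ[ℂ] V) {x : ℕ → V}
    (hx : ∀ n, x (n + 1) = T (x n)) (hx0 : Filter.Tendsto x Filter.atTop (nhds 0)) :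
    ∃ C ρ : ℝ, 0 ≤ C ∧ 0 < ρ ∧ ρ < 1 ∧ ∀ n, ‖x n‖ ≤ C * ρ ^ n := by
  have hxn : ∀ N n, x (n + N) = (T ^ N) (x n) := by
    intro N
    induction N with
    | zero => simp
    | succ N ih => intro n; rw [← add_assoc, hx, ih, pow_succ']; rfl
  set W := Submodule.span ℂ (Set.range x) with hW
  have hT : ∀ w ∈ W, Filter.Tendsto (fun N => (T ^ N) w) Filter.atTop (nhds 0) := by
    intro w hw
    induction hw using Submodule.span_induction with
    | mem w hw =>
      obtain ⟨n, rfl⟩ := hw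
      simp_rw [← hxn]
      exact (hx0.comp (Filter.tendsto_add_atTop_nat n)).congr fun N => by
        simp [Function.comp, add_comm]
    | zero => simp
    | add u v _ _ hu hv => simpa using hu.add hv
    | smul a u _ hu => simpa using hu.const_smul a
  set b := Module.finBasis ℂ W with hb
  obtain ⟨C, hC, hCb⟩ := b.exists_opNorm_le (F := V)
  -- A map bounded by ε on the basis `b` has norm at most C ε, so ε = 1/(2C) produces the norm 1/2.
  have h1 : ∀ᶠ N in Filter.atTop, ∀ i, ‖(T ^ N) (b i : V)‖ ≤ 1 / (2 * C) := by
    rw [Filter.eventually_all]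
    intro i
    have := (hT (b i) (b i).2).norm
    rw [norm_zero] at this
    exact (this.eventually (gt_mem_nhds (by positivity : (0 : ℝ) < 1 / (2 * C)))).mono
      fun N h => h.le
  obtain ⟨N, hN, hN0⟩ := (h1.and (Filter.eventually_gt_atTop 0)).exists
  refine exists_geometric_bound (fun n => norm_nonneg _) hN0 fun n => ?_
  set u : W →L[ℂ] V := LinearMap.toContinuousLinearMap ((T ^ N) ∘ₗ W.subtype) with hu
  have h2 : ‖u‖ ≤ C * (1 / (2 * C)) := hCb (by positivity) hN
  have h3 := u.le_opNorm ⟨x n, Submodule.subset_span ⟨n, rfl⟩⟩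
  have h4 : u ⟨x n, Submodule.subset_span ⟨n, rfl⟩⟩ = x (n + N) := by rw [hxn]; rfl
  rw [h4] at h3
  refine h3.trans ?_
  rw [show C * (1 / (2 * C)) = 1 / 2 by field_simp] at h2
  exact mul_le_mul_of_nonneg_right h2 (norm_nonneg _)

end

section

/-! ### Linear actions and characters -/

variable {d : ℕ}

theorem act_apply (A : Matrix (Fin d) (Fin d) ℝ) (x : Rn d) (i : Fin d) :
    act A x i = ∑ j, A i j * x j := rfl

theorem act_mul (A B : Matrix (Fin d) (Fin d) ℝ) (x : Rn d) :
    act (A * B) x = act A (act B x) := by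
  ext i
  change ((A * B) *ᵥ x.ofLp) i = (A *ᵥ (B *ᵥ x.ofLp)) i
  rw [Matrix.mulVec_mulVec]

theorem act_one (x : Rn d) : act 1 x = x := by
  ext i
  change ((1 : Matrix (Fin d) (Fin d) ℝ) *ᵥ x.ofLp) i = x i
  rw [Matrix.one_mulVec]

theorem act_add (A : Matrix (Fin d) (Fin d) ℝ) (x y : Rn d) : act A (x + y) = act A x + act A y :=
  map_add _ _ _

theorem act_neg (A : Matrix (Fin d) (Fin d) ℝ) (x : Rn d) : act A (-x) = -act A x :=
  map_neg _ _

theorem act_zero (A : Matrix (Fin d) (Fin d) ℝ) : act A 0 = 0 := map_zero _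

theorem continuous_act (A : Matrix (Fin d) (Fin d) ℝ) : Continuous (act A) :=
  (Matrix.toEuclideanLin A).continuous_of_finiteDimensional

theorem act_inv_act {A : Matrix (Fin d) (Fin d) ℝ} (hA : A.det ≠ 0) (x : Rn d) :
    act A⁻¹ (act A x) = x := by
  rw [← act_mul, Matrix.nonsing_inv_mul _ (isUnit_iff_ne_zero.mpr hA), act_one]

theorem act_act_inv {A : Matrix (Fin d) (Fin d) ℝ} (hA : A.det ≠ 0) (x : Rn d) :
    act A (act A⁻¹ x) = x := by
  rw [← act_mul, Matrix.mul_nonsing_inv _ (isUnit_iff_ne_zero.mpr hA), act_one]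

theorem intVec_add (k l : Fin d → ℤ) : intVec (k + l) = intVec k + intVec l := by
  ext i; simp [intVec]

theorem intVec_sub (k l : Fin d → ℤ) : intVec (k - l) = intVec k - intVec l := by
  ext i; simp [intVec]

theorem intVec_neg (k : Fin d → ℤ) : intVec (-k) = -intVec k := by
  ext i; simp [intVec]

theorem intVec_zero : intVec (0 : Fin d → ℤ) = 0 := by
  ext i; simp [intVec]

theorem intVec_injective : Function.Injective (intVec (d := d)) := by
  intro k l h
  funext i
  have : intVec k i = intVec l i := by rw [h]
  simpa [intVec] using this

theorem act_realMat_intVec (A : Matrix (Fin d) (Fin d) ℤ) (k : Fin d → ℤ) :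
    act (realMat A) (intVec k) = intVec (A *ᵥ k) := by
  ext i
  simp [act_apply, intVec, realMat, Matrix.mulVec, dotProduct]

theorem realMat_mul (A B : Matrix (Fin d) (Fin d) ℤ) : realMat (A * B) = realMat A * realMat B :=
  (Int.castRingHom ℝ).mapMatrix.map_mul A B

theorem chr_add_left (a b ξ : Rn d) : chr (a + b) ξ = chr a ξ * chr b ξ := by
  rw [chr, chr, chr, ← Complex.exp_add]
  congr 1
  simp [add_mul, Finset.sum_add_distrib]
  ring

theorem chr_add_right (a ξ η : Rn d) : chr a (ξ + η) = chr a ξ * chr a η := by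
  rw [chr, chr, chr, ← Complex.exp_add]
  congr 1
  simp [mul_add, Finset.sum_add_distrib]

theorem chr_zero_left (ξ : Rn d) : chr 0 ξ = 1 := by simp [chr]

theorem chr_zero_right (a : Rn d) : chr a 0 = 1 := by simp [chr]

theorem norm_chr (a ξ : Rn d) : ‖chr a ξ‖ = 1 := by
  rw [chr, show (2 * Real.pi * Complex.I * ((∑ j, a j * ξ j : ℝ) : ℂ)) =
    ((2 * Real.pi * ∑ j, a j * ξ j : ℝ) : ℂ) * Complex.I by push_cast; ring]
  exact Complex.norm_exp_ofReal_mul_I _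

theorem chr_ne_zero (a ξ : Rn d) : chr a ξ ≠ 0 := Complex.exp_ne_zero _

theorem chr_neg_left_mul (a ξ : Rn d) : chr (-a) ξ * chr a ξ = 1 := by
  rw [← chr_add_left, neg_add_cancel, chr_zero_left]

theorem chr_neg_left (a ξ : Rn d) : chr (-a) ξ = starRingEnd ℂ (chr a ξ) := by
  have h := chr_neg_left_mul a ξ
  have h2 : starRingEnd ℂ (chr a ξ) * chr a ξ = 1 := by
    rw [Complex.conj_mul', norm_chr]; simp
  exact mul_right_cancel₀ (chr_ne_zero a ξ) (h.trans h2.symm)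

theorem chr_sub_left (a b ξ : Rn d) : chr (a - b) ξ = chr a ξ * chr (-b) ξ := by
  rw [sub_eq_add_neg, chr_add_left]

theorem chr_act (A : Matrix (Fin d) (Fin d) ℝ) (x ξ : Rn d) :
    chr (act A x) ξ = chr x (act Aᵀ ξ) := by
  rw [chr, chr]
  congr 3
  simp only [act_apply, Finset.sum_mul, Finset.mul_sum, Matrix.transpose_apply]
  rw [Finset.sum_comm]
  exact Finset.sum_congr rfl fun i _ => Finset.sum_congr rfl fun j _ => by ring

theorem chr_transAct (A : Matrix (Fin d) (Fin d) ℤ) (k : Fin d → ℤ) (ξ : Rn d) :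
    chr (intVec k) (transAct A ξ) = chr (intVec (A *ᵥ k)) ξ := by
  rw [transAct, ← chr_act, act_realMat_intVec]

theorem chr_intVec_intVec (k l : Fin d → ℤ) : chr (intVec k) (intVec l) = 1 := by
  rw [chr, show (2 * Real.pi * Complex.I * ((∑ j, intVec k j * intVec l j : ℝ) : ℂ)) =
    ((∑ j, k j * l j : ℤ) : ℂ) * (2 * Real.pi * Complex.I) by
      simp only [intVec]; push_cast; ring]
  exact Complex.exp_int_mul_two_pi_mul_I _

theorem chr_eq_exp_inner (a ξ : Rn d) :
    chr a ξ = Complex.exp (2 * Real.pi * Complex.I * ((inner ℝ a ξ : ℝ) : ℂ)) := by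
  rw [chr, PiLp.inner_apply]
  simp [mul_comm]

theorem contDiff_chr (a : Rn d) {n : WithTop ℕ∞} : ContDiff ℝ n (chr a) := by
  have : chr a = fun ξ => Complex.exp (2 * Real.pi * Complex.I * ((inner ℝ a ξ : ℝ) : ℂ)) :=
    funext fun ξ => chr_eq_exp_inner a ξ
  rw [this]
  refine Complex.contDiff_exp.comp (contDiff_const.mul ?_)
  exact Complex.ofRealCLM.contDiff.comp (contDiff_const.inner ℝ contDiff_id)

theorem continuous_chr (a : Rn d) : Continuous (chr a) := (contDiff_chr a (n := 0)).continuous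

/-- A character determines its integer frequency. -/
theorem chr_intVec_injective :
    Function.Injective (fun k : Fin d → ℤ => (chr (intVec k) : Rn d → ℂ)) := by
  intro k l hkl
  by_contra hne
  obtain ⟨j, hj⟩ := Function.ne_iff.mp hne
  have hu : ((k j - l j : ℤ) : ℝ) ≠ 0 := by
    exact_mod_cast sub_ne_zero.mpr hj
  -- At this point the quotient of the two characters equals e^{πi} = -1.
  have h1 := congrFun hkl (EuclideanSpace.single j (1 / (2 * ((k j - l j : ℤ) : ℝ))))
  simp only at h1
  have h2 : chr (intVec (k - l)) (EuclideanSpace.single j (1 / (2 * ((k j - l j : ℤ) : ℝ)))) = 1 := by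
    rw [intVec_sub, chr_sub_left, h1, mul_comm, chr_neg_left_mul]
  rw [chr, show ((∑ i, intVec (k - l) i *
    (EuclideanSpace.single j (1 / (2 * ((k j - l j : ℤ) : ℝ))) : Rn d) i : ℝ) : ℂ) = 1 / 2 by
      rw [Finset.sum_eq_single j]
      · have : ((intVec (k - l) j : ℝ)) = ((k j - l j : ℤ) : ℝ) := by simp [intVec]
        rw [this, PiLp.single_apply, if_pos rfl]
        rw [show ((k j - l j : ℤ) : ℝ) * (1 / (2 * ((k j - l j : ℤ) : ℝ))) = 1 / 2 by field_simp]
        simp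
      · intro b _ hb
        simp [hb]
      · simp] at h2
  rw [show 2 * (Real.pi : ℂ) * Complex.I * (1 / 2) = Real.pi * Complex.I by ring,
    Complex.exp_pi_mul_I] at h2
  norm_num at h2

/-- Dedekind's independence of characters, for the multiplicative copy of ℝ^d. It allows identities
between trigonometric polynomials to be read as identities between coefficients. -/
theorem linearIndependent_chr :
    LinearIndependent ℂ (fun k : Fin d → ℤ => (chr (intVec k) : Rn d → ℂ)) := by
  let F : (Fin d → ℤ) → (Multiplicative (Rn d) →* ℂ) := fun k =>
    { toFun := fun ξ => chr (intVec k) ξ.toAdd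
      map_one' := chr_zero_right _
      map_mul' := fun ξ η => chr_add_right _ _ _ }
  have hF : Function.Injective F := fun k l h =>
    chr_intVec_injective (funext fun ξ => DFunLike.congr_fun h (Multiplicative.ofAdd ξ))
  exact (linearIndependent_monoidHom (Multiplicative (Rn d)) ℂ).comp F hF

/-! ### Trigonometric polynomials -/

/-- The description as a span makes every closure property below an instance of span induction. -/
theorem isTrigPoly_iff {t : Rn d → ℂ} :
    IsTrigPoly t ↔ t ∈ Submodule.span ℂ (Set.range fun k : Fin d → ℤ => chr (intVec k)) := by
  rw [Finsupp.mem_span_range_iff_exists_finsupp, IsTrigPoly]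
  refine exists_congr fun h => ⟨fun ht => funext fun ξ => ?_, fun ht ξ => ?_⟩
  · rw [ht, Finsupp.sum, Finsupp.sum, Finset.sum_apply]
    rfl
  · rw [← ht, Finsupp.sum, Finsupp.sum, Finset.sum_apply]
    rfl

theorem isTrigPoly_chr (k : Fin d → ℤ) : IsTrigPoly (chr (intVec k)) :=
  isTrigPoly_iff.mpr (Submodule.subset_span ⟨k, rfl⟩)

theorem IsTrigPoly.add {t u : Rn d → ℂ} (ht : IsTrigPoly t) (hu : IsTrigPoly u) :
    IsTrigPoly fun ξ => t ξ + u ξ :=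
  isTrigPoly_iff.mpr (add_mem (isTrigPoly_iff.mp ht) (isTrigPoly_iff.mp hu))

theorem IsTrigPoly.const_mul {t : Rn d → ℂ} (ht : IsTrigPoly t) (a : ℂ) :
    IsTrigPoly fun ξ => a * t ξ :=
  isTrigPoly_iff.mpr (Submodule.smul_mem _ a (isTrigPoly_iff.mp ht))

theorem isTrigPoly_const (a : ℂ) : IsTrigPoly fun _ : Rn d => a := by
  have := (isTrigPoly_chr (0 : Fin d → ℤ)).const_mul a
  simpa [intVec_zero, chr_zero_left] using this

theorem IsTrigPoly.sub {t u : Rn d → ℂ} (ht : IsTrigPoly t) (hu : IsTrigPoly u) :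
    IsTrigPoly fun ξ => t ξ - u ξ :=
  isTrigPoly_iff.mpr (sub_mem (isTrigPoly_iff.mp ht) (isTrigPoly_iff.mp hu))

theorem IsTrigPoly.neg {t : Rn d → ℂ} (ht : IsTrigPoly t) : IsTrigPoly fun ξ => -t ξ :=
  isTrigPoly_iff.mpr (neg_mem (isTrigPoly_iff.mp ht))

theorem isTrigPoly_sum {ι : Type*} (s : Finset ι) {t : ι → Rn d → ℂ}
    (ht : ∀ i ∈ s, IsTrigPoly (t i)) : IsTrigPoly fun ξ => ∑ i ∈ s, t i ξ := by
  have := Submodule.sum_mem _ fun i hi => isTrigPoly_iff.mp (ht i hi)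
  rw [isTrigPoly_iff]
  convert this using 1
  funext ξ
  simp

/-- Induction principle for trigonometric polynomials. -/
theorem IsTrigPoly.induction {p : (Rn d → ℂ) → Prop} (hchr : ∀ k, p (chr (intVec k)))
    (hzero : p 0) (hadd : ∀ t u, p t → p u → p (t + u)) (hsmul : ∀ (a : ℂ) t, p t → p (a • t))
    {t : Rn d → ℂ} (ht : IsTrigPoly t) : p t := by
  refine Submodule.span_induction (p := fun t _ => p t) ?_ hzero (fun t u _ _ => hadd t u)
    (fun a t _ => hsmul a t) (isTrigPoly_iff.mp ht)
  rintro _ ⟨k, rfl⟩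
  exact hchr k

theorem IsTrigPoly.mul {t u : Rn d → ℂ} (ht : IsTrigPoly t) (hu : IsTrigPoly u) :
    IsTrigPoly fun ξ => t ξ * u ξ := by
  refine IsTrigPoly.induction (p := fun t => IsTrigPoly fun ξ => t ξ * u ξ) (fun k => ?_) ?_ ?_ ?_ ht
  · refine IsTrigPoly.induction (p := fun u => IsTrigPoly fun ξ => chr (intVec k) ξ * u ξ)
      (fun l => ?_) ?_ ?_ ?_ hu
    · simp_rw [← chr_add_left, ← intVec_add]
      exact isTrigPoly_chr _
    · simpa using isTrigPoly_const 0
    · intro t u ht hu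
      simpa [mul_add] using ht.add hu
    · intro a t ht
      simpa [mul_left_comm] using ht.const_mul a
  · simpa using isTrigPoly_const 0
  · intro t u ht hu
    simpa [add_mul] using ht.add hu
  · intro a t ht
    simpa [mul_assoc] using ht.const_mul a

theorem IsTrigPoly.conj {t : Rn d → ℂ} (ht : IsTrigPoly t) :
    IsTrigPoly fun ξ => starRingEnd ℂ (t ξ) := by
  refine IsTrigPoly.induction (p := fun t => IsTrigPoly fun ξ => starRingEnd ℂ (t ξ))
    (fun k => ?_) ?_ ?_ ?_ ht
  · simp_rw [← chr_neg_left, ← intVec_neg]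
    exact isTrigPoly_chr _
  · simpa using isTrigPoly_const 0
  · intro t u ht hu
    simpa using ht.add hu
  · intro a t ht
    simpa using ht.const_mul _

theorem IsTrigPoly.comp_transAct {t : Rn d → ℂ} (ht : IsTrigPoly t)
    (A : Matrix (Fin d) (Fin d) ℤ) : IsTrigPoly fun ξ => t (transAct A ξ) := by
  refine IsTrigPoly.induction (p := fun t => IsTrigPoly fun ξ => t (transAct A ξ))
    (fun k => ?_) ?_ ?_ ?_ ht
  · simp_rw [chr_transAct]
    exact isTrigPoly_chr _
  · simpa using isTrigPoly_const 0
  · intro t u ht hu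
    simpa using ht.add hu
  · intro a t ht
    simpa using ht.const_mul a

theorem IsTrigPoly.contDiff {t : Rn d → ℂ} (ht : IsTrigPoly t) {n : WithTop ℕ∞} :
    ContDiff ℝ n t := by
  refine IsTrigPoly.induction (p := fun t => ContDiff ℝ n t) (fun k => contDiff_chr _)
    contDiff_const (fun t u ht hu => ht.add hu) (fun a t ht => contDiff_const.smul ht) ht

theorem IsTrigPoly.continuous {t : Rn d → ℂ} (ht : IsTrigPoly t) : Continuous t :=
  (ht.contDiff (n := 0)).continuous

theorem IsTrigPoly.bounded {t : Rn d → ℂ} (ht : IsTrigPoly t) : ∃ C, 0 < C ∧ ∀ ξ, ‖t ξ‖ ≤ C := by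
  refine IsTrigPoly.induction (p := fun t => ∃ C, 0 < C ∧ ∀ ξ, ‖t ξ‖ ≤ C)
    (fun k => ⟨1, one_pos, fun ξ => (norm_chr _ _).le⟩) ⟨1, one_pos, by simp⟩ ?_ ?_ ht
  · rintro t u ⟨C, hC, h⟩ ⟨C', hC', h'⟩
    exact ⟨C + C', by positivity, fun ξ => (norm_add_le _ _).trans (add_le_add (h ξ) (h' ξ))⟩
  · rintro a t ⟨C, hC, h⟩
    refine ⟨(‖a‖ + 1) * C, by positivity, fun ξ => ?_⟩
    rw [Pi.smul_apply, norm_smul]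
    exact mul_le_mul (by linarith) (h ξ) (norm_nonneg _) (by positivity)

theorem norm_chr_sub_one_le (a ξ : Rn d) : ‖chr a ξ - 1‖ ≤ 2 * Real.pi * ‖a‖ * ‖ξ‖ := by
  rw [chr_eq_exp_inner, show 2 * (Real.pi : ℂ) * Complex.I * ((inner ℝ a ξ : ℝ) : ℂ) =
    Complex.I * ((2 * Real.pi * inner ℝ a ξ : ℝ) : ℂ) by push_cast; ring]
  refine (Real.norm_exp_I_mul_ofReal_sub_one_le).trans ?_
  rw [Real.norm_eq_abs, abs_mul, abs_of_pos Real.two_pi_pos, mul_assoc _ ‖a‖]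
  exact mul_le_mul_of_nonneg_left (abs_real_inner_le_norm a ξ) Real.two_pi_pos.le

/-- Trigonometric polynomials are Lipschitz at the origin. -/
theorem IsTrigPoly.norm_sub_le {t : Rn d → ℂ} (ht : IsTrigPoly t) :
    ∃ C, 0 < C ∧ ∀ ξ, ‖t ξ - t 0‖ ≤ C * ‖ξ‖ := by
  refine IsTrigPoly.induction (p := fun t => ∃ C, 0 < C ∧ ∀ ξ, ‖t ξ - t 0‖ ≤ C * ‖ξ‖)
    (fun k => ⟨2 * Real.pi * ‖intVec k‖ + 1, by positivity, fun ξ => ?_⟩)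
    ⟨1, one_pos, by simp⟩ ?_ ?_ ht
  · rw [chr_zero_right]
    refine (norm_chr_sub_one_le _ _).trans ?_
    gcongr
    linarith
  · rintro t u ⟨C, hC, h⟩ ⟨C', hC', h'⟩
    refine ⟨C + C', by positivity, fun ξ => ?_⟩
    rw [Pi.add_apply, Pi.add_apply, add_sub_add_comm, add_mul]
    exact (norm_add_le _ _).trans (add_le_add (h ξ) (h' ξ))
  · rintro a t ⟨C, hC, h⟩
    refine ⟨(‖a‖ + 1) * C, by positivity, fun ξ => ?_⟩
    rw [Pi.smul_apply, Pi.smul_apply, ← smul_sub, norm_smul, mul_assoc]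
    exact mul_le_mul (by linarith) (h ξ) (norm_nonneg _) (by positivity)

end

section

/-! ### Vanishing of derivatives up to a given order -/

variable {d : ℕ}

/-- `f` vanishes at `x` together with all iterated partial derivatives of order less than `n`,
in any order of differentiation. -/
def FlatAt (n : ℕ) (f : Rn d → ℂ) (x : Rn d) : Prop :=
  ∀ w : List (Fin d), w.length < n → w.foldr pderiv f x = 0

theorem flatAt_zero (f : Rn d → ℂ) (x : Rn d) : FlatAt 0 f x := fun _ h => absurd h (by simp)

/-- The last letter of a word is differentiated innermost, which gives a recursion on the order.
Allowing words in any order keeps the inductions below free of the symmetry of mixed derivatives. -/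
theorem flatAt_succ {n : ℕ} {f : Rn d → ℂ} {x : Rn d} :
    FlatAt (n + 1) f x ↔ f x = 0 ∧ ∀ j, FlatAt n (pderiv j f) x := by
  refine ⟨fun h => ⟨h [] (by simp), fun j w hw => ?_⟩, fun h w hw => ?_⟩
  · simpa using h (w ++ [j]) (by simpa using hw)
  · rcases List.eq_nil_or_concat w with rfl | ⟨v, j, rfl⟩
    · exact h.1
    · simpa using h.2 j v (by simpa using hw)

theorem FlatAt.mono {n m : ℕ} {f : Rn d → ℂ} {x : Rn d} (h : FlatAt n f x) (hm : m ≤ n) :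
    FlatAt m f x := fun w hw => h w (hw.trans_le hm)

theorem flatAt_zero_fun (n : ℕ) (x : Rn d) : FlatAt n (fun _ => (0 : ℂ)) x := by
  induction n with
  | zero => exact flatAt_zero _ _
  | succ n ih =>
    refine flatAt_succ.mpr ⟨rfl, fun j => ?_⟩
    have : pderiv j (fun _ : Rn d => (0 : ℂ)) = fun _ => 0 := by
      funext y
      simp [pderiv, lineDeriv]
    rwa [this]

/-- Smooth complex-valued functions. -/
abbrev Smooth (f : Rn d → ℂ) : Prop := ContDiff ℝ ((⊤ : ℕ∞) : WithTop ℕ∞) f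

theorem Smooth.differentiable {f : Rn d → ℂ} (hf : Smooth f) : Differentiable ℝ f :=
  ContDiff.differentiable hf (by simp)

theorem Smooth.pderiv_eq {f : Rn d → ℂ} (hf : Smooth f) (j : Fin d) :
    pderiv j f = fun x => fderiv ℝ f x (EuclideanSpace.single j 1) :=
  funext fun x => (hf.differentiable x).lineDeriv_eq_fderiv

theorem Smooth.pderiv {f : Rn d → ℂ} (hf : Smooth f) (j : Fin d) : Smooth (pderiv j f) := by
  rw [hf.pderiv_eq]
  exact (hf.fderiv_right (m := ((⊤ : ℕ∞) : WithTop ℕ∞)) (by simp)).clm_apply contDiff_const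

theorem pderiv_add {f g : Rn d → ℂ} (hf : Smooth f) (hg : Smooth g) (j : Fin d) :
    pderiv j (fun x => f x + g x) = fun x => pderiv j f x + pderiv j g x := by
  rw [Smooth.pderiv_eq (ContDiff.add hf hg), hf.pderiv_eq, hg.pderiv_eq]
  funext x
  rw [fderiv_fun_add (hf.differentiable x) (hg.differentiable x)]
  rfl

theorem pderiv_mul {f g : Rn d → ℂ} (hf : Smooth f) (hg : Smooth g) (j : Fin d) :
    pderiv j (fun x => f x * g x) = fun x => f x * pderiv j g x + g x * pderiv j f x := by
  rw [Smooth.pderiv_eq (ContDiff.mul hf hg), hf.pderiv_eq, hg.pderiv_eq]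
  funext x
  rw [fderiv_fun_mul (hf.differentiable x) (hg.differentiable x)]
  rfl

theorem FlatAt.add {n : ℕ} {f g : Rn d → ℂ} {x : Rn d} (hf : Smooth f) (hg : Smooth g)
    (h : FlatAt n f x) (h' : FlatAt n g x) : FlatAt n (fun y => f y + g y) x := by
  induction n generalizing f g with
  | zero => exact flatAt_zero _ _
  | succ n ih =>
    rw [flatAt_succ] at h h' ⊢
    refine ⟨by simp [h.1, h'.1], fun j => ?_⟩
    rw [pderiv_add hf hg]
    exact ih (hf.pderiv j) (hg.pderiv j) (h.2 j) (h'.2 j)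

/-- The factor `g` stays general in the induction because the product rule differentiates it too. In
that term flatness of `f` to the lower order is enough. -/
theorem FlatAt.mul_left {n : ℕ} {f g : Rn d → ℂ} {x : Rn d} (hf : Smooth f) (hg : Smooth g)
    (h : FlatAt n f x) : FlatAt n (fun y => g y * f y) x := by
  induction n generalizing f g with
  | zero => exact flatAt_zero _ _
  | succ n ih =>
    have h' := flatAt_succ.mp h
    refine flatAt_succ.mpr ⟨by simp [h'.1], fun j => ?_⟩
    rw [pderiv_mul hg hf]
    exact (ih (hf.pderiv j) hg (h'.2 j)).add (ContDiff.mul hg (hf.pderiv j))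
      (ContDiff.mul hf (hg.pderiv j))
      ((funext fun y => mul_comm _ _ : (fun y => f y * HSymWavelet.pderiv j g y) = _) ▸
        ih hf (hg.pderiv j) (h.mono n.le_succ))

theorem flatAt_sum {n : ℕ} {ι : Type*} (s : Finset ι) {f : ι → Rn d → ℂ} {x : Rn d}
    (hf : ∀ i, Smooth (f i)) (h : ∀ i ∈ s, FlatAt n (f i) x) :
    FlatAt n (fun y => ∑ i ∈ s, f i y) x := by
  classical
  induction s using Finset.induction_on with
  | empty => simpa using flatAt_zero_fun n x
  | insert i s hi ih =>
    simp_rw [Finset.sum_insert hi]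
    exact (h i (Finset.mem_insert_self _ _)).add (hf i) (ContDiff.sum fun i _ => hf i)
      (ih fun i hi => h i (Finset.mem_insert_of_mem hi))

theorem contDiff_act (A : Matrix (Fin d) (Fin d) ℝ) {n : WithTop ℕ∞} : ContDiff ℝ n (act A) :=
  (LinearMap.toContinuousLinearMap (Matrix.toEuclideanLin A)).contDiff

theorem Smooth.comp_affine {f : Rn d → ℂ} (hf : Smooth f) (A : Matrix (Fin d) (Fin d) ℝ)
    (b : Rn d) : Smooth fun y => f (act A y + b) :=
  ContDiff.comp hf ((contDiff_act A).add contDiff_const)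

theorem act_single (A : Matrix (Fin d) (Fin d) ℝ) (j : Fin d) :
    act A (EuclideanSpace.single j 1) = ∑ i, A i j • (EuclideanSpace.single i 1 : Rn d) := by
  ext i
  simp [act_apply, Pi.single_apply]

theorem pderiv_comp_affine {f : Rn d → ℂ} (hf : Smooth f) (A : Matrix (Fin d) (Fin d) ℝ)
    (b : Rn d) (j : Fin d) :
    pderiv j (fun y => f (act A y + b)) =
      fun y => ∑ i, (A i j : ℂ) * pderiv i f (act A y + b) := by
  rw [Smooth.pderiv_eq (hf.comp_affine A b)]
  funext y
  have h1 : HasFDerivAt (fun y => act A y + b)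
      (LinearMap.toContinuousLinearMap (Matrix.toEuclideanLin A)) y :=
    ((LinearMap.toContinuousLinearMap (Matrix.toEuclideanLin A)).hasFDerivAt).add_const b
  have h2 := ((hf.differentiable (act A y + b)).hasFDerivAt.comp y h1).fderiv
  rw [Function.comp_def] at h2
  rw [h2, ContinuousLinearMap.comp_apply]
  change fderiv ℝ f (act A y + b) (act A (EuclideanSpace.single j 1)) = _
  rw [act_single, map_sum]
  refine Finset.sum_congr rfl fun i _ => ?_
  rw [map_smul, hf.pderiv_eq, Complex.real_smul]

theorem FlatAt.comp_affine {n : ℕ} {f : Rn d → ℂ} (hf : Smooth f)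
    (A : Matrix (Fin d) (Fin d) ℝ) (b : Rn d) {x : Rn d} (h : FlatAt n f (act A x + b)) :
    FlatAt n (fun y => f (act A y + b)) x := by
  induction n generalizing f with
  | zero => exact flatAt_zero _ _
  | succ n ih =>
    rw [flatAt_succ] at h ⊢
    refine ⟨h.1, fun j => ?_⟩
    rw [pderiv_comp_affine hf]
    exact flatAt_sum _ (fun i => ContDiff.mul contDiff_const ((hf.pderiv i).comp_affine A b))
      fun i _ => (ih (hf.pderiv i) (h.2 i)).mul_left ((hf.pderiv i).comp_affine A b)
        contDiff_const

theorem Smooth.conj {f : Rn d → ℂ} (hf : Smooth f) : Smooth fun y => starRingEnd ℂ (f y) :=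
  ContDiff.comp Complex.conjCLE.contDiff hf

theorem FlatAt.conj {n : ℕ} {f : Rn d → ℂ} {x : Rn d} (hf : Smooth f) (h : FlatAt n f x) :
    FlatAt n (fun y => starRingEnd ℂ (f y)) x := by
  induction n generalizing f with
  | zero => exact flatAt_zero _ _
  | succ n ih =>
    rw [flatAt_succ] at h ⊢
    refine ⟨by simp [h.1], fun j => ?_⟩
    have : pderiv j (fun y => starRingEnd ℂ (f y)) = fun y => starRingEnd ℂ (pderiv j f y) := by
      rw [Smooth.pderiv_eq hf.conj, hf.pderiv_eq]
      funext y
      have h2 := (Complex.conjCLE.toContinuousLinearMap.hasFDerivAt.comp y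
        (hf.differentiable y).hasFDerivAt).fderiv
      rw [Function.comp_def] at h2
      exact DFunLike.congr_fun h2 _
    rw [this]
    exact ih (hf.pderiv j) (h.2 j)

/-- The word of partial derivatives belonging to a multi-index. -/
def indexWord (β : Fin d → ℕ) : List (Fin d) :=
  (List.finRange d).flatMap fun j => List.replicate (β j) j

theorem mderiv_eq_foldr (β : Fin d → ℕ) (f : Rn d → ℂ) :
    mderiv β f = (indexWord β).foldr pderiv f := by
  rw [mderiv, indexWord]
  induction List.finRange d with
  | nil => rfl
  | cons j l ih =>
    rw [List.foldr_cons, List.flatMap_cons, List.foldr_append, ih]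
    induction β j with
    | zero => rfl
    | succ k ih' => rw [Function.iterate_succ_apply', ih', List.replicate_succ, List.foldr_cons]

theorem count_indexWord (β : Fin d → ℕ) (j : Fin d) : (indexWord β).count j = β j := by
  rw [indexWord, List.count_flatMap, ← List.ofFn_eq_map, List.sum_ofFn]
  simp [List.count_replicate]

theorem length_indexWord (β : Fin d → ℕ) : (indexWord β).length = ∑ j, β j := by
  rw [indexWord, List.length_flatMap, ← List.ofFn_eq_map, List.sum_ofFn]
  simp

theorem FlatAt.hasVM {n : ℕ} {f : Rn d → ℂ} (h : FlatAt n f 0) : HasVM n f := fun β hβ => by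
  rw [mderiv_eq_foldr]
  exact h _ (by rwa [length_indexWord])

theorem pderiv_chr (a : Rn d) (j : Fin d) (c : ℂ) :
    pderiv j (fun ξ => c * chr a ξ) = fun ξ => (2 * Real.pi * Complex.I * a j * c) * chr a ξ := by
  funext ξ
  have h1 : (fun t : ℝ => c * chr a (ξ + t • EuclideanSpace.single j 1)) =
      fun t : ℝ => c * (chr a ξ * Complex.exp (2 * Real.pi * Complex.I * a j * t)) := by
    funext t
    rw [chr_add_right]
    congr 2
    rw [chr]
    congr 1
    rw [mul_assoc _ (a j : ℂ)]
    congr 1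
    rw [← Complex.ofReal_mul]
    congr 1
    rw [Finset.sum_eq_single j]
    · simp
    · intro b _ hb
      simp [hb]
    · simp
  rw [pderiv, lineDeriv, h1]
  have h2 : HasDerivAt (fun t : ℝ => c * (chr a ξ * Complex.exp (2 * Real.pi * Complex.I * a j * t)))
      (c * (chr a ξ * (Complex.exp (2 * Real.pi * Complex.I * a j * (0 : ℝ)) *
        (2 * Real.pi * Complex.I * a j * 1)))) 0 := by
    have h3 : HasDerivAt (fun t : ℝ => (t : ℂ)) 1 0 := Complex.ofRealCLM.hasDerivAt
    exact ((h3.const_mul (2 * Real.pi * Complex.I * a j)).cexp.const_mul (chr a ξ)).const_mul c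
  rw [h2.deriv]
  simp
  ring

/-- Iterated partial derivatives of exponential sums. -/
theorem foldr_pderiv_expSum (h : Rn d →₀ ℂ) (w : List (Fin d)) :
    w.foldr pderiv (fun ξ => h.sum fun x a => a * chr x ξ) =
      fun ξ => h.sum fun x a => ((w.map fun j => 2 * Real.pi * Complex.I * x j).prod * a) *
        chr x ξ := by
  induction w with
  | nil => simp
  | cons j w ih =>
    rw [List.foldr_cons, ih]
    have : ∀ (s : Finset (Rn d)) (c : Rn d → ℂ), pderiv j (fun ξ => ∑ x ∈ s, c x * chr x ξ) =
        fun ξ => ∑ x ∈ s, (2 * Real.pi * Complex.I * x j * c x) * chr x ξ := by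
      intro s c
      classical
      induction s using Finset.induction_on with
      | empty =>
        funext y
        simp [pderiv, lineDeriv]
      | insert i s hi ih =>
        simp_rw [Finset.sum_insert hi]
        rw [pderiv_add (ContDiff.mul contDiff_const (contDiff_chr i))
          (ContDiff.sum fun i _ => ContDiff.mul contDiff_const (contDiff_chr i)), ih, pderiv_chr]
    simp only [Finsupp.sum]
    rw [this]
    simp only [List.map_cons, List.prod_cons, mul_assoc]

/-- On an exponential sum a word of derivatives multiplies each coefficient by a product over its
letters, which does not see their order. Every word is a permutation of the sorted word of a
multi-index, so the multi-index derivatives suffice. -/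
theorem flatAt_expSum {n : ℕ} (h : Rn d →₀ ℂ) {x : Rn d}
    (hx : ∀ β : Fin d → ℕ, ∑ j, β j < n →
      mderiv β (fun ξ => h.sum fun x a => a * chr x ξ) x = 0) :
    FlatAt n (fun ξ => h.sum fun x a => a * chr x ξ) x := by
  intro w hw
  have hperm : (indexWord fun j => w.count j).Perm w :=
    List.perm_iff_count.mpr fun j => count_indexWord _ j
  have h1 := hx (fun j => w.count j) (by rwa [← length_indexWord, hperm.length_eq])
  rw [mderiv_eq_foldr, foldr_pderiv_expSum] at h1
  rw [foldr_pderiv_expSum, ← h1]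
  refine Finsupp.sum_congr fun y _ => ?_
  rw [(hperm.map _).prod_eq]

/-- The derivatives in the sum rule vanish in any order of differentiation. -/
theorem flatAt_comp_transInvAct {n : ℕ} {M : Matrix (Fin d) (Fin d) ℤ} {t : Rn d → ℂ}
    (ht : IsTrigPoly t) {x : Rn d}
    (hx : ∀ β : Fin d → ℕ, ∑ j, β j < n → mderiv β (fun ξ => t (transInvAct M ξ)) x = 0) :
    FlatAt n (fun ξ => t (transInvAct M ξ)) x := by
  obtain ⟨h, hh⟩ := ht
  -- After the substitution the frequencies are the points M^{-1}k, in general not integral. This is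
  -- why exponential sums with arbitrary real frequencies were treated.
  have e : (fun ξ => t (transInvAct M ξ)) = fun ξ => (h.mapDomain fun k =>
      act (realMat M)⁻¹ (intVec k)).sum fun x a => a * chr x ξ := by
    funext ξ
    rw [hh, Finsupp.sum_mapDomain_index (by simp) (by simp [add_mul])]
    refine Finsupp.sum_congr fun k _ => ?_
    rw [chr_act, Matrix.transpose_nonsing_inv]
    rfl
  rw [e] at hx ⊢
  exact flatAt_expSum _ hx

end

section

/-! ### Digits and characters of the finite quotient -/

variable {d : ℕ} {M : Matrix (Fin d) (Fin d) ℤ}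

theorem realMat_det (M : Matrix (Fin d) (Fin d) ℤ) : (realMat M).det = (M.det : ℝ) :=
  ((Int.castRingHom ℝ).map_det M).symm

theorem IsDilation.intDet_ne_zero (hM : IsDilation M) : M.det ≠ 0 := by
  have := hM.det_ne_zero
  rw [realMat_det] at this
  exact_mod_cast this

theorem IsDilation.mdet_pos (hM : IsDilation M) : 0 < mdet M :=
  Int.natAbs_pos.mpr hM.intDet_ne_zero

theorem IsDilation.sqrtm_ne_zero (hM : IsDilation M) : sqrtm M ≠ 0 := by
  rw [sqrtm, Complex.ofReal_ne_zero]
  exact (Real.sqrt_pos.mpr (by exact_mod_cast hM.mdet_pos)).ne'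

theorem sqrtm_mul_self (M : Matrix (Fin d) (Fin d) ℤ) : sqrtm M * sqrtm M = mdet M := by
  rw [sqrtm, ← Complex.ofReal_mul, Real.mul_self_sqrt (Nat.cast_nonneg _)]
  simp

theorem conj_sqrtm (M : Matrix (Fin d) (Fin d) ℤ) : starRingEnd ℂ (sqrtm M) = sqrtm M :=
  Complex.conj_ofReal _

theorem IsDilation.transAct_transInvAct (hM : IsDilation M) (ξ : Rn d) :
    transAct M (transInvAct M ξ) = ξ :=
  act_act_inv (by rw [Matrix.det_transpose]; exact hM.det_ne_zero) ξ

theorem IsDilation.transInvAct_transAct (hM : IsDilation M) (ξ : Rn d) :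
    transInvAct M (transAct M ξ) = ξ :=
  act_inv_act (by rw [Matrix.det_transpose]; exact hM.det_ne_zero) ξ

theorem transAct_intVec (A : Matrix (Fin d) (Fin d) ℤ) (k : Fin d → ℤ) :
    transAct A (intVec k) = intVec (Aᵀ *ᵥ k) := act_realMat_intVec Aᵀ k

theorem chr_transInvAct (M : Matrix (Fin d) (Fin d) ℤ) (a ξ : Rn d) :
    chr a (transInvAct M ξ) = chr (act (realMat M)⁻¹ a) ξ := by
  rw [chr_act, transInvAct, Matrix.transpose_nonsing_inv]

theorem CongrMod.refl (α : Fin d → ℤ) : CongrMod M α α := ⟨0, by simp⟩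

theorem CongrMod.symm {α β : Fin d → ℤ} (h : CongrMod M α β) : CongrMod M β α := by
  obtain ⟨γ, hγ⟩ := h
  exact ⟨-γ, by rw [Matrix.mulVec_neg, ← hγ, neg_sub]⟩

theorem CongrMod.trans {α β γ : Fin d → ℤ} (h : CongrMod M α β) (h' : CongrMod M β γ) :
    CongrMod M α γ := by
  obtain ⟨x, hx⟩ := h
  obtain ⟨y, hy⟩ := h'
  exact ⟨x + y, by rw [Matrix.mulVec_add, ← hx, ← hy, sub_add_sub_cancel]⟩

theorem CongrMod.of_add_right {α β γ : Fin d → ℤ} (h : CongrMod M (α + γ) (β + γ)) :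
    CongrMod M α β := by
  obtain ⟨x, hx⟩ := h
  exact ⟨x, by rw [← hx, add_sub_add_right_eq_sub]⟩

/-- The family `dig` contains exactly one representative of each coset modulo `M`. -/
def IsDigitFamily {I : Type*} (M : Matrix (Fin d) (Fin d) ℤ) (dig : I → (Fin d → ℤ)) : Prop :=
  ∀ α : Fin d → ℤ, ∃! i, CongrMod M α (dig i)

theorem IsDigitSet.isDigitFamily {D : Finset (Fin d → ℤ)} (hD : IsDigitSet M D) :
    IsDigitFamily M (fun s : D => (s : Fin d → ℤ)) := by
  intro α
  obtain ⟨s, ⟨hs, hα⟩, huniq⟩ := hD.2 α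
  exact ⟨⟨s, hs⟩, hα, fun t ht => Subtype.ext (huniq t ⟨t.2, ht⟩)⟩

theorem IsDigitFamily.eq_of_congr {I : Type*} {dig : I → (Fin d → ℤ)} (h : IsDigitFamily M dig)
    {i j : I} (hij : CongrMod M (dig i) (dig j)) : i = j :=
  (h (dig i)).unique (CongrMod.refl _) hij

/-- The digits are in bijection with ℤ^d / Mℤ^d, whose order is the absolute value of the
determinant of M viewed as a map onto its range. -/
theorem IsDigitFamily.card {I : Type*} [Fintype I] {dig : I → (Fin d → ℤ)}
    (h : IsDigitFamily M dig) (hM : M.det ≠ 0) : Fintype.card I = mdet M := by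
  set f := Matrix.mulVecLin M with hf
  have hinj : Function.Injective f := by
    intro x y hxy
    by_contra hne
    exact hM (Matrix.exists_mulVec_eq_zero_iff.mp ⟨x - y, sub_ne_zero.mpr hne, by
      rw [Matrix.mulVec_sub]; exact sub_eq_zero.mpr hxy⟩)
  have h1 := Submodule.natAbs_det_equiv (LinearMap.range f) (LinearEquiv.ofInjective f hinj)
  have h2 : (LinearMap.range f).subtype ∘ₗ
      ((LinearEquiv.ofInjective f hinj : (Fin d → ℤ) ≃ₗ[ℤ] LinearMap.range f) :
        (Fin d → ℤ) →ₗ[ℤ] LinearMap.range f) = f := by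
    ext; rfl
  have h3 : LinearMap.det f = M.det := by
    rw [hf, ← Matrix.toLin'_apply', LinearMap.det_toLin']
  rw [mdet, ← h3, ← Nat.card_eq_fintype_card]
  have h4 := (congrArg (fun g => (LinearMap.det g).natAbs) h2).symm.trans h1
  refine Eq.trans ?_ h4.symm
  refine Nat.card_congr (Equiv.ofBijective
    (fun i => (Submodule.Quotient.mk (dig i) : (Fin d → ℤ) ⧸ LinearMap.range f)) ⟨?_, ?_⟩)
  · intro i j hij
    obtain ⟨γ, hγ⟩ := (Submodule.Quotient.eq _).mp hij
    exact h.eq_of_congr ⟨γ, hγ.symm⟩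
  · intro x
    obtain ⟨α, rfl⟩ := Submodule.Quotient.mk_surjective _ x
    obtain ⟨i, ⟨γ, hγ⟩, -⟩ := h α
    exact ⟨i, ((Submodule.Quotient.eq (LinearMap.range f)).mpr
      (LinearMap.mem_range.mpr ⟨γ, hγ.symm⟩)).symm⟩

theorem chr_transInvAct_congr (hM : IsDilation M) (k : Fin d → ℤ) {s t : Fin d → ℤ}
    (hst : CongrMod Mᵀ s t) :
    chr (intVec k) (transInvAct M (intVec s)) = chr (intVec k) (transInvAct M (intVec t)) := by
  obtain ⟨γ, hγ⟩ := hst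
  have h1 : intVec s = intVec t + transAct M (intVec γ) := by
    rw [transAct_intVec, ← hγ, ← intVec_add]; simp
  rw [h1, transInvAct, act_add, ← transInvAct, ← transInvAct, hM.transInvAct_transAct,
    chr_add_right, chr_intVec_intVec, mul_one]

theorem chr_transInvAct_eq_one (hM : IsDilation M) {k : Fin d → ℤ} (hk : CongrMod M k 0)
    (s : Fin d → ℤ) : chr (intVec k) (transInvAct M (intVec s)) = 1 := by
  obtain ⟨γ, hγ⟩ := hk
  rw [sub_zero] at hγ
  rw [hγ, ← chr_transAct, hM.transAct_transInvAct, chr_intVec_intVec]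

/-- If all values were 1, the unit vectors as test points would force every coordinate of M^{-1}k to
be an integer. -/
theorem exists_chr_ne_one (hM : IsDilation M) {k : Fin d → ℤ} (hk : ¬ CongrMod M k 0) :
    ∃ s, chr (intVec k) (transInvAct M (intVec s)) ≠ 1 := by
  by_contra! h
  apply hk
  have h1 : ∀ j, ∃ n : ℤ, act (realMat M)⁻¹ (intVec k) j = n := by
    intro j
    have h2 := h (Pi.single j 1)
    rw [chr_transInvAct, chr, Finset.sum_eq_single j] at h2
    · obtain ⟨n, hn⟩ := Complex.exp_eq_one_iff.mp h2
      refine ⟨n, ?_⟩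
      rw [mul_comm] at hn
      have h3 := mul_right_cancel₀ Complex.two_pi_I_ne_zero hn
      simp only [intVec, Pi.single_eq_same, Int.cast_one, mul_one] at h3
      exact_mod_cast h3
    · intro b _ hb
      simp [intVec, hb]
    · simp
  choose γ hγ using h1
  refine ⟨γ, ?_⟩
  have h2 : act (realMat M)⁻¹ (intVec k) = intVec γ := by ext j; exact hγ j
  have h3 := congrArg (act (realMat M)) h2
  rw [act_act_inv hM.det_ne_zero, act_realMat_intVec] at h3
  rw [sub_zero]
  exact intVec_injective h3

/-- Orthogonality of the characters of `ℤ^d / M^* ℤ^d`. -/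
theorem sum_chr_transInvAct (hM : IsDilation M) {D : Finset (Fin d → ℤ)} (hD : IsDigitSet Mᵀ D)
    (k : Fin d → ℤ) [Decidable (CongrMod M k 0)] :
    ∑ s ∈ D, chr (intVec k) (transInvAct M (intVec s)) =
      if CongrMod M k 0 then (mdet M : ℂ) else 0 := by
  have hfam := hD.isDigitFamily
  split_ifs with hk
  · have hcard := hfam.card (by rw [Matrix.det_transpose]; exact hM.intDet_ne_zero)
    rw [Finset.sum_congr rfl fun s _ => chr_transInvAct_eq_one hM hk s]
    rw [Fintype.card_coe, mdet, Matrix.det_transpose] at hcard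
    simp [hcard, mdet]
  · obtain ⟨t, ht⟩ := exists_chr_ne_one hM hk
    rw [← Finset.sum_coe_sort]
    -- Adding `t` permutes the cosets. The sum is therefore reproduced by the permutation `σ` and at
    -- the same time multiplied by a number different from 1, so it is zero.
    choose σ hσ _ using fun i : D => hfam (i + t)
    have hinj : Function.Injective σ := fun i j hij => by
      have h1 := hσ j
      rw [← hij] at h1
      exact hfam.eq_of_congr ((hσ i).trans h1.symm).of_add_right
    have h1 : ∑ s : D, chr (intVec k) (transInvAct M (intVec (σ s))) =
        ∑ s : D, chr (intVec k) (transInvAct M (intVec s)) :=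
      (Finite.injective_iff_bijective.mp hinj).sum_comp
        (fun s : D => chr (intVec k) (transInvAct M (intVec s)))
    have h2 : ∀ s : D, chr (intVec k) (transInvAct M (intVec (σ s))) =
        chr (intVec k) (transInvAct M (intVec s)) * chr (intVec k) (transInvAct M (intVec t)) := by
      intro s
      rw [← chr_transInvAct_congr hM k (hσ s), intVec_add, transInvAct, act_add, chr_add_right]
      rfl
    simp_rw [h2, ← Finset.sum_mul] at h1
    by_contra hne
    exact ht (mul_left_cancel₀ hne (h1.trans (mul_one _).symm))

/-- Extraction of the part of a sum that has a prescribed behaviour under the shifts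
`M^{*-1} s`. -/
theorem sum_chr_mul_sum (hM : IsDilation M) {D : Finset (Fin d → ℤ)} (hD : IsDigitSet Mᵀ D)
    {I : Type*} [Fintype I] {T : I → Rn d → ℂ} {a : I → (Fin d → ℤ)}
    (hT : ∀ k ξ s, T k (ξ + transInvAct M (intVec s)) =
      chr (intVec (a k)) (transInvAct M (intVec s)) * T k ξ)
    {α : Fin d → ℤ} {k₀ : I} (hα : ∀ k, CongrMod M (a k) α ↔ k = k₀) (ξ : Rn d) :
    ∑ s ∈ D, chr (intVec (-α)) (transInvAct M (intVec s)) *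
      ∑ k, T k (ξ + transInvAct M (intVec s)) = mdet M * T k₀ ξ := by
  classical
  simp_rw [hT, Finset.mul_sum]
  rw [Finset.sum_comm, Finset.sum_eq_single k₀]
  · simp_rw [← mul_assoc, ← chr_add_left, ← intVec_add]
    rw [← Finset.sum_mul, sum_chr_transInvAct hM hD, if_pos]
    obtain ⟨γ, hγ⟩ := (hα k₀).mpr rfl
    exact ⟨γ, by rw [← hγ]; abel⟩
  · intro k _ hk
    simp_rw [← mul_assoc, ← chr_add_left, ← intVec_add]
    rw [← Finset.sum_mul, sum_chr_transInvAct hM hD, if_neg, zero_mul]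
    rintro ⟨γ, hγ⟩
    exact hk ((hα k).mp ⟨γ, by rw [← hγ]; abel⟩)
  · simp

/-! ### Coset components of a trigonometric polynomial -/

section Component

variable {I : Type} {dig : I → (Fin d → ℤ)} {τ : I → Rn d → ℂ} {t : Rn d → ℂ}

/-- The part of `assemble M dig τ` that belongs to the digit number `k`. -/
def component (M : Matrix (Fin d) (Fin d) ℤ) (dig : I → (Fin d → ℤ)) (τ : I → Rn d → ℂ) (k : I)
    (ξ : Rn d) : ℂ :=
  1 / sqrtm M * (chr (intVec (dig k)) ξ * τ k (transAct M ξ))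

theorem assemble_eq_sum_component [Fintype I] (ξ : Rn d) :
    assemble M dig τ ξ = ∑ k, component M dig τ k ξ := by
  simp only [assemble, component, Finset.mul_sum]

theorem isTrigPoly_periodic (ht : IsTrigPoly t) (ξ : Rn d) (k : Fin d → ℤ) :
    t (ξ + intVec k) = t ξ := by
  refine IsTrigPoly.induction (p := fun t => t (ξ + intVec k) = t ξ) ?_ rfl ?_ ?_ ht
  · intro l
    rw [chr_add_right, chr_intVec_intVec, mul_one]
  · intro t u ht hu
    simp [ht, hu]
  · intro a t ht
    simp [ht]

theorem component_add (hM : IsDilation M) (hτ : ∀ k, IsTrigPoly (τ k)) (k : I) (ξ : Rn d)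
    (s : Fin d → ℤ) : component M dig τ k (ξ + transInvAct M (intVec s)) =
      chr (intVec (dig k)) (transInvAct M (intVec s)) * component M dig τ k ξ := by
  have h1 : transAct M (ξ + transInvAct M (intVec s)) = transAct M ξ + intVec s := by
    rw [transAct, act_add, ← transAct, ← transAct, hM.transAct_transInvAct]
  rw [component, component, chr_add_right, h1, isTrigPoly_periodic (hτ k)]
  ring

/-- Fourier inversion on the finite group ℤ^d/M^*ℤ^d. It is the channel through which interpolation,
the sum rule and the symmetry of the mask reach its components. -/
theorem mdet_mul_component [Fintype I] (hM : IsDilation M) {D : Finset (Fin d → ℤ)} (hD : IsDigitSet Mᵀ D)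
    (hdig : IsDigitFamily M dig) (ht : IsPolyphase M dig t τ) (k : I) (ξ : Rn d) :
    mdet M * component M dig τ k ξ = ∑ s ∈ D, chr (intVec (-dig k)) (transInvAct M (intVec s)) *
      t (ξ + transInvAct M (intVec s)) := by
  rw [← sum_chr_mul_sum hM hD (component_add hM ht.1) (α := dig k) (k₀ := k)
    (fun j => ⟨fun h => hdig.eq_of_congr h, fun h => h ▸ CongrMod.refl _⟩)]
  simp_rw [ht.2, assemble_eq_sum_component]

theorem CongrMod.mulVec {α β : Fin d → ℤ} {K K' : Matrix (Fin d) (Fin d) ℤ} (hK : K * M = M * K')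
    (h : CongrMod M α β) : CongrMod M (K *ᵥ α) (K *ᵥ β) := by
  obtain ⟨γ, hγ⟩ := h
  exact ⟨K' *ᵥ γ, by rw [← Matrix.mulVec_sub, hγ, Matrix.mulVec_mulVec, hK, Matrix.mulVec_mulVec]⟩

theorem IsSymmetryGroup.congr_iff {H : Subgroup (GL (Fin d) ℤ)} (hH : IsSymmetryGroup M H)
    {K : GL (Fin d) ℤ} (hK : K ∈ H) {α β : Fin d → ℤ} :
    CongrMod M ((K : Matrix (Fin d) (Fin d) ℤ) *ᵥ α) ((K : Matrix (Fin d) (Fin d) ℤ) *ᵥ β) ↔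
      CongrMod M α β := by
  have key : ∀ {K : GL (Fin d) ℤ} (_ : K ∈ H) {α β : Fin d → ℤ}, CongrMod M α β →
      CongrMod M ((K : Matrix (Fin d) (Fin d) ℤ) *ᵥ α)
        ((K : Matrix (Fin d) (Fin d) ℤ) *ᵥ β) := fun hK _ _ h => by
    obtain ⟨K', -, e⟩ := hH.2 _ hK
    exact h.mulVec e
  refine ⟨fun h => ?_, key hK⟩
  have h1 := key (H.inv_mem hK) h
  rwa [Matrix.mulVec_mulVec, Matrix.mulVec_mulVec, ← Units.val_mul, inv_mul_cancel,
    Units.val_one, Matrix.one_mulVec, Matrix.one_mulVec] at h1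

/-- The coset components of a symmetric polynomial are permuted by the symmetry group. -/
theorem component_transAct [Fintype I] (hM : IsDilation M) {H : Subgroup (GL (Fin d) ℤ)}
    (hH : IsSymmetryGroup M H) {D : Finset (Fin d → ℤ)} (hD : IsDigitSet Mᵀ D)
    (hdig : IsDigitFamily M dig) (ht : IsPolyphase M dig t τ) {K : GL (Fin d) ℤ} (hK : K ∈ H)
    (hsym : ∀ ξ, t (transAct (K : Matrix (Fin d) (Fin d) ℤ) ξ) = t ξ) {k k' : I}
    (hkk : CongrMod M ((K : Matrix (Fin d) (Fin d) ℤ) *ᵥ dig k) (dig k')) (ξ : Rn d) :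
    component M dig τ k (transAct (K : Matrix (Fin d) (Fin d) ℤ) ξ) =
      component M dig τ k' ξ := by
  obtain ⟨K', -, hK'⟩ := hH.2 K hK
  -- The relation K M = M K' becomes K^* M^{*-1} = M^{*-1} K'^*. Since K' is integral, K^* maps the
  -- shifts M^{*-1}s to shifts of the same kind.
  have hcomm : ∀ s : Fin d → ℤ, transAct (K : Matrix (Fin d) (Fin d) ℤ)
      (transInvAct M (intVec s)) =
        transInvAct M (intVec ((K' : Matrix (Fin d) (Fin d) ℤ)ᵀ *ᵥ s)) := by
    intro s
    have h1 : transAct M (transAct (K : Matrix (Fin d) (Fin d) ℤ) (transInvAct M (intVec s))) =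
        transAct (K' : Matrix (Fin d) (Fin d) ℤ) (intVec s) := by
      rw [transAct, transAct, ← act_mul, ← Matrix.transpose_mul, ← realMat_mul, hK', realMat_mul,
        Matrix.transpose_mul, act_mul]
      exact congrArg _ (hM.transAct_transInvAct _)
    rw [← transAct_intVec, ← h1, hM.transInvAct_transAct]
  have hm : (mdet M : ℂ) ≠ 0 := by exact_mod_cast hM.mdet_pos.ne'
  refine mul_left_cancel₀ hm ?_
  rw [mdet_mul_component hM hD hdig ht k', ← sum_chr_mul_sum hM hD
    (T := fun j η => component M dig τ j (transAct (K : Matrix (Fin d) (Fin d) ℤ) η))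
    (a := fun j => (K : Matrix (Fin d) (Fin d) ℤ) *ᵥ dig j) (α := dig k') (k₀ := k)]
  · refine Finset.sum_congr rfl fun s _ => ?_
    rw [← assemble_eq_sum_component, ← ht.2, hsym]
  · intro j η s
    rw [transAct, act_add, ← transAct, ← transAct, hcomm, component_add hM ht.1, ← hcomm,
      chr_transAct]
  · intro j
    refine ⟨fun h => ?_, fun h => h ▸ hkk⟩
    exact hdig.eq_of_congr ((hH.congr_iff hK).mp (h.trans hkk.symm))

end Component

/-! ### Digits adapted to a symmetry group -/

/-- A coset lies in exactly one orbit, and inside an orbit s_{p,i} ≡ s_{p,j} puts E_j^{-1}E_i into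
the stabilizer, so the transversal gives i = j. The orbit of 0 consists of one coset, which is why a
single index of type `Unit` is enough for it. -/
theorem IsSymDigits.isDigitFamily {H : Subgroup (GL (Fin d) ℤ)} (hH : IsSymmetryGroup M H)
    {P : ℕ} {N : Fin (P + 1) → ℕ} {E : ∀ p, Fin (N p + 1) → GL (Fin d) ℤ}
    {s : ∀ p, Fin (N p + 1) → (Fin d → ℤ)} (hs : IsSymDigits M H E s) :
    IsDigitFamily M (digits s) := by
  have hex : ∀ α : Fin d → ℤ, ∃ p i, CongrMod M α (s p i) := by
    intro α
    obtain ⟨p, ⟨K, hK, hα⟩, -⟩ := hs.orbits α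
    obtain ⟨i, ⟨F, hF, rfl⟩, -⟩ := hs.transversal p K hK
    refine ⟨p, i, hα.trans ?_⟩
    rw [hs.digit p i, Units.val_mul, ← Matrix.mulVec_mulVec, hH.congr_iff (hs.mem p i)]
    exact hF.2
  have huniq : ∀ {p q i j}, CongrMod M (s p i) (s q j) →
      (⟨p, i⟩ : Σ p, Fin (N p + 1)) = ⟨q, j⟩ := by
    intro p q i j h
    have hpq : p = q := by
      refine (hs.orbits (s p i)).unique ⟨E p i, hs.mem p i, ?_⟩ ⟨E q j, hs.mem q j, ?_⟩
      · rw [hs.digit p i]; exact CongrMod.refl _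
      · rw [← hs.digit q j]; exact h
    subst hpq
    have hij : i = j := by
      refine (hs.transversal p (E p i) (hs.mem p i)).unique ⟨1, ⟨H.one_mem, ?_⟩, by simp⟩
        ⟨(E p j)⁻¹ * E p i, ⟨H.mul_mem (H.inv_mem (hs.mem p j)) (hs.mem p i), ?_⟩, by group⟩
      · rw [Units.val_one, Matrix.one_mulVec]; exact CongrMod.refl _
      · rw [hs.digit p i, hs.digit p j] at h
        rw [← hH.congr_iff (hs.mem p j), Matrix.mulVec_mulVec, ← Units.val_mul,
          mul_inv_cancel_left]
        exact h
    rw [hij]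
  have hzero : ∀ i, s 0 i = 0 := fun i => by
    rw [hs.digit 0 i, hs.zero, Matrix.mulVec_zero]
  intro α
  obtain ⟨p, i, hα⟩ := hex α
  have hgen : ∃ k, CongrMod M α (digits s k) := by
    induction p using Fin.cases with
    | zero => exact ⟨Sum.inl (), by simpa [digits, hzero] using hα⟩
    | succ p => exact ⟨Sum.inr ⟨p, i⟩, hα⟩
  obtain ⟨k, hk⟩ := hgen
  refine ⟨k, hk, fun l hl => ?_⟩
  have h1 : CongrMod M (digits s l) (digits s k) := hl.symm.trans hk
  rcases l with ⟨⟩ | ⟨q, j⟩ <;> rcases k with ⟨⟩ | ⟨p, i⟩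
  · rfl
  · have := congrArg Sigma.fst (huniq h1)
    exact absurd this (Fin.succ_ne_zero p).symm
  · have := congrArg Sigma.fst (huniq h1)
    exact absurd this (Fin.succ_ne_zero q)
  · have h2 := huniq h1
    have h3 : q = p := Fin.succ_injective _ (congrArg Sigma.fst h2)
    subst h3
    simp only [Sigma.mk.injEq, heq_eq_eq, true_and] at h2
    rw [h2]

end

section

/-! ### The wavelet masks -/

variable {d : ℕ} {M : Matrix (Fin d) (Fin d) ℤ} {W : Type}
  {dig : Unit ⊕ W → (Fin d → ℤ)} {μ : Unit ⊕ W → Rn d → ℂ} {m0 : Rn d → ℂ}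

/-- For the digit 0 the characters in the inversion formula are trivial and its right-hand side is
the interpolation sum. -/
theorem IsInterpolatory.mu_zero [Fintype W] (hM : IsDilation M) {D : Finset (Fin d → ℤ)}
    (hD : IsDigitSet Mᵀ D) (hdig : IsDigitFamily M dig) (h0 : dig (Sum.inl ()) = 0)
    (hμ : IsPolyphase M dig m0 μ) (hint : IsInterpolatory M D m0) (ξ : Rn d) :
    μ (Sum.inl ()) ξ = 1 / sqrtm M := by
  have h1 := mdet_mul_component hM hD hdig hμ (Sum.inl ()) (transInvAct M ξ)
  simp only [h0, neg_zero, intVec_zero, chr_zero_left, one_mul] at h1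
  rw [hint, component, hM.transAct_transInvAct, h0, intVec_zero, chr_zero_left,
    ← sqrtm_mul_self] at h1
  have := hM.sqrtm_ne_zero
  field_simp at h1 ⊢
  exact h1

theorem sum_component_inr [Fintype W] (hM : IsDilation M) (h0 : dig (Sum.inl ()) = 0)
    (hμ : IsPolyphase M dig m0 μ) (hμ0 : ∀ ξ, μ (Sum.inl ()) ξ = 1 / sqrtm M) (ξ : Rn d) :
    ∑ w : W, chr (intVec (dig (Sum.inr w))) ξ * μ (Sum.inr w) (transAct M ξ) =
      sqrtm M * m0 ξ - 1 / sqrtm M := by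
  have := hM.sqrtm_ne_zero
  rw [hμ.2, assemble, Fintype.sum_sum_type]
  simp only [Finset.univ_unique, Finset.sum_singleton, PUnit.default_eq_unit, h0, hμ0, intVec_zero,
    chr_zero_left]
  field_simp
  ring

theorem conj_component (w : W) (ξ : Rn d) :
    starRingEnd ℂ (component M dig μ (Sum.inr w) ξ) = 1 / sqrtm M *
      (chr (-intVec (dig (Sum.inr w))) ξ * starRingEnd ℂ (μ (Sum.inr w) (transAct M ξ))) := by
  rw [component, map_mul, map_mul, map_div₀, map_one, conj_sqrtm, chr_neg_left]

/-- The sum along the row telescopes into `m0` by `sum_component_inr`. In the result `w` enters only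
through a character and one component, so symmetry and vanishing moments become visible. -/
theorem waveMask_eq [Fintype W] [DecidableEq W] (hM : IsDilation M) (h0 : dig (Sum.inl ()) = 0)
    (hμ : IsPolyphase M dig m0 μ) (hμ0 : ∀ ξ, μ (Sum.inl ()) ξ = 1 / sqrtm M) (w : W) (ξ : Rn d) :
    waveMask M dig μ w ξ = chr (intVec (dig (Sum.inr w))) ξ *
      (1 - mdet M * starRingEnd ℂ (component M dig μ (Sum.inr w) ξ) * m0 ξ) := by
  have hq := hM.sqrtm_ne_zero
  have hs := sum_component_inr hM h0 hμ hμ0 ξ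
  have hc := chr_neg_left_mul (intVec (dig (Sum.inr w))) ξ
  rw [conj_component, ← sqrtm_mul_self, waveMask, assemble, Fintype.sum_sum_type]
  simp only [Finset.univ_unique, Finset.sum_singleton, PUnit.default_eq_unit, h0, intVec_zero,
    chr_zero_left, matN, Matrix.fromBlocks_apply₂₁, Matrix.fromBlocks_apply₂₂, rowP,
    Matrix.neg_apply, Matrix.conjTranspose_apply, Matrix.of_apply, Matrix.smul_apply,
    Matrix.sub_apply, Matrix.mul_apply, Matrix.one_apply, smul_eq_mul, RCLike.star_def]
  set c := starRingEnd ℂ (μ (Sum.inr w) (transAct M ξ))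
  have h1 : ∑ x : W, chr (intVec (dig (Sum.inr x))) ξ *
      (sqrtm M * ((if w = x then 1 else 0) - c * μ (Sum.inr x) (transAct M ξ))) =
      sqrtm M * chr (intVec (dig (Sum.inr w))) ξ -
        sqrtm M * c * (sqrtm M * m0 ξ - 1 / sqrtm M) := by
    rw [← hs, Finset.mul_sum]
    have : sqrtm M * chr (intVec (dig (Sum.inr w))) ξ =
        ∑ x : W, if w = x then sqrtm M * chr (intVec (dig (Sum.inr x))) ξ else 0 := by simp
    rw [this, ← Finset.sum_sub_distrib]
    refine Finset.sum_congr rfl fun x _ => ?_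
    split_ifs <;> ring
  rw [h1]
  field_simp
  linear_combination (sqrtm M ^ 2 * c * m0 ξ) * hc

theorem waveMaskDual_eq [Fintype W] [DecidableEq W] (hM : IsDilation M)
    (h0 : dig (Sum.inl ()) = 0) (w : W) (ξ : Rn d) :
    waveMaskDual M dig μ w ξ = 1 / mdet M * (chr (intVec (dig (Sum.inr w))) ξ *
      (1 - mdet M * starRingEnd ℂ (component M dig μ (Sum.inr w) ξ))) := by
  have hq := hM.sqrtm_ne_zero
  have hc := chr_neg_left_mul (intVec (dig (Sum.inr w))) ξ
  rw [conj_component, ← sqrtm_mul_self, waveMaskDual, assemble, Fintype.sum_sum_type]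
  simp only [Finset.univ_unique, Finset.sum_singleton, PUnit.default_eq_unit, h0, intVec_zero,
    chr_zero_left, matNt, Matrix.fromBlocks_apply₂₁, Matrix.fromBlocks_apply₂₂, rowP,
    Matrix.neg_apply, Matrix.conjTranspose_apply, Matrix.of_apply, Matrix.smul_apply,
    Matrix.one_apply, smul_eq_mul, RCLike.star_def]
  set c := starRingEnd ℂ (μ (Sum.inr w) (transAct M ξ))
  have h1 : ∑ x : W, chr (intVec (dig (Sum.inr x))) ξ *
      (1 / sqrtm M * (if w = x then 1 else 0)) =
      1 / sqrtm M * chr (intVec (dig (Sum.inr w))) ξ := by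
    simp [mul_comm]
  rw [h1]
  field_simp
  linear_combination (sqrtm M * c) * hc

theorem isTrigPoly_assemble {I : Type} [Fintype I] {dig : I → (Fin d → ℤ)} {τ : I → Rn d → ℂ}
    (hτ : ∀ k, IsTrigPoly (τ k)) : IsTrigPoly (assemble M dig τ) :=
  (isTrigPoly_sum _ fun k _ => (isTrigPoly_chr (dig k)).mul ((hτ k).comp_transAct M)).const_mul _

theorem isTrigPoly_matN [Fintype W] [DecidableEq W] (hμ : ∀ k, IsTrigPoly (μ k)) (k l : Unit ⊕ W) :
    IsTrigPoly fun ξ => matN M μ ξ k l := by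
  rcases k with ⟨⟩ | k <;> rcases l with ⟨⟩ | l <;>
    simp only [matN, Matrix.fromBlocks_apply₂₁, Matrix.fromBlocks_apply₂₂,
      Matrix.fromBlocks_apply₁₁, Matrix.fromBlocks_apply₁₂, rowP, Matrix.neg_apply,
      Matrix.conjTranspose_apply, Matrix.of_apply, Matrix.smul_apply, Matrix.sub_apply,
      Matrix.mul_apply, smul_eq_mul, RCLike.star_def]
  · exact isTrigPoly_const _
  · exact hμ _
  · exact (hμ _).conj.neg
  · exact ((isTrigPoly_const _).sub (isTrigPoly_sum _ fun _ _ => (hμ _).conj.mul (hμ _))).const_mul _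

theorem isTrigPoly_matNt [Fintype W] [DecidableEq W] (hμ : ∀ k, IsTrigPoly (μ k)) (k l : Unit ⊕ W) :
    IsTrigPoly fun ξ => matNt M μ ξ k l := by
  rcases k with ⟨⟩ | k <;> rcases l with ⟨⟩ | l <;>
    simp only [matNt, Matrix.fromBlocks_apply₂₁, Matrix.fromBlocks_apply₂₂,
      Matrix.fromBlocks_apply₁₁, Matrix.fromBlocks_apply₁₂, rowP, Matrix.neg_apply,
      Matrix.conjTranspose_apply, Matrix.of_apply, Matrix.smul_apply, Matrix.sub_apply,
      Matrix.mul_apply, smul_eq_mul, RCLike.star_def]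
  · exact ((isTrigPoly_const _).sub (isTrigPoly_sum _ fun _ _ => (hμ _).mul (hμ _).conj)).const_mul _
  · exact hμ _
  · exact (hμ _).conj.neg
  · exact isTrigPoly_const _

theorem isTrigPoly_waveMask [Fintype W] [DecidableEq W] (hμ : ∀ k, IsTrigPoly (μ k)) (w : W) :
    IsTrigPoly (waveMask M dig μ w) := isTrigPoly_assemble fun _ => isTrigPoly_matN hμ _ _

theorem isTrigPoly_waveMaskDual [Fintype W] [DecidableEq W] (hμ : ∀ k, IsTrigPoly (μ k)) (w : W) :
    IsTrigPoly (waveMaskDual M dig μ w) := isTrigPoly_assemble fun _ => isTrigPoly_matNt hμ _ _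

/-- The extended polyphase matrices are biorthogonal. -/
theorem conjTranspose_matNt_mul_matN [Fintype W] [DecidableEq W] (hM : IsDilation M) (ξ : Rn d) :
    (matNt M μ ξ)ᴴ * matN M μ ξ = 1 := by
  have hq := hM.sqrtm_ne_zero
  have hs : star (sqrtm M) = sqrtm M := conj_sqrtm M
  have hs' : star (1 / sqrtm M) = 1 / sqrtm M := by
    rw [star_div₀, star_one, hs]
  rw [matNt, matN, Matrix.fromBlocks_conjTranspose, Matrix.fromBlocks_multiply,
    ← Matrix.fromBlocks_one]
  simp only [Matrix.conjTranspose_smul, Matrix.conjTranspose_sub, Matrix.conjTranspose_one,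
    Matrix.conjTranspose_mul, Matrix.conjTranspose_conjTranspose, Matrix.conjTranspose_neg, hs, hs',
    Matrix.smul_mul, Matrix.mul_smul, smul_smul, Matrix.mul_neg, Matrix.neg_mul, neg_neg,
    one_div_mul_cancel hq, Matrix.mul_one, Matrix.one_mul, one_smul,
    Matrix.mul_sub, Matrix.sub_mul, Matrix.mul_assoc]
  congr 1
  · simp
  · module
  · simp
  · rw [smul_sub, smul_smul, smul_smul, mul_one_div_cancel hq, one_smul, one_smul]
    abel

theorem matN_inl [Fintype W] [DecidableEq W] (h : ∀ ξ, μ (Sum.inl ()) ξ = 1 / sqrtm M)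
    (ξ : Rn d) (k : Unit ⊕ W) :
    matN M μ ξ (Sum.inl ()) k = μ k ξ := by
  rcases k with ⟨⟩ | k
  · rw [h]
    simp [matN]
  · rfl

theorem dualMask_eq_assemble [Fintype W] [DecidableEq W] :
    dualMask M dig μ = assemble M dig fun k ξ => matNt M μ ξ (Sum.inl ()) k := by
  rw [dualMask]
  congr 1
  funext k ξ
  rcases k with ⟨⟩ | k
  · simp [matNt, rowP, Matrix.mul_apply, Complex.mul_conj']
  · rfl

/-! ### Vanishing moments -/

section Moments

variable {D : Finset (Fin d → ℤ)} {n : ℕ}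

/-- The substitution ξ ↦ M^*ξ + s carries the condition at the digit `s` to a condition at the
origin on a shifted mask. Flatness survives affine substitutions. -/
theorem HasSumRule.flatAt (hM : IsDilation M) (ht : IsTrigPoly m0) (h : HasSumRule M D n m0)
    {s : Fin d → ℤ} (hs : s ∈ D) (hs0 : s ≠ 0) :
    FlatAt n (fun ξ => m0 (ξ + transInvAct M (intVec s))) 0 := by
  have h1 := flatAt_comp_transInvAct ht (h s hs hs0)
  have hsm : Smooth fun ξ => m0 (transInvAct M ξ) := by
    have := Smooth.comp_affine (f := m0) ht.contDiff ((realMat M)ᵀ)⁻¹ 0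
    simpa [transInvAct] using this
  have h2 := FlatAt.comp_affine hsm (realMat M)ᵀ (intVec s) (x := 0) (n := n)
    (by rwa [act_zero, zero_add])
  refine (congrArg (FlatAt n · 0) (funext fun ξ => ?_)).mp h2
  rw [transInvAct, act_add]
  exact congrArg (fun x => m0 (x + _)) (hM.transInvAct_transAct ξ)

/-- By interpolation 1 - m0 is the sum of the shifts of m0 by the nonzero digits, each of which is
flat by the sum rule. -/
theorem flatAt_one_sub (hM : IsDilation M) (hD : IsDigitSet Mᵀ D) (ht : IsTrigPoly m0)
    (hint : IsInterpolatory M D m0) (h : HasSumRule M D n m0) :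
    FlatAt n (fun ξ => 1 - m0 ξ) 0 := by
  classical
  have h1 : (fun ξ => 1 - m0 ξ) =
      fun ξ => ∑ s ∈ D.erase 0, m0 (ξ + transInvAct M (intVec s)) := by
    funext ξ
    rw [← hint ξ, ← Finset.add_sum_erase D _ hD.1, intVec_zero, transInvAct, act_zero, add_zero,
      add_sub_cancel_left]
  rw [h1]
  refine flatAt_sum _ (fun s => ContDiff.comp ht.contDiff (contDiff_id.add contDiff_const))
    fun s hs => h.flatAt hM ht (Finset.mem_of_mem_erase hs) (Finset.ne_of_mem_erase hs)

/-- In the inversion formula the shift by 0 contributes m0 itself, and all other shifts are flat. -/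
theorem flatAt_one_sub_component [Fintype W] (hM : IsDilation M) (hD : IsDigitSet Mᵀ D)
    (hdig : IsDigitFamily M dig) (ht : IsTrigPoly m0) (hμ : IsPolyphase M dig m0 μ)
    (hint : IsInterpolatory M D m0) (h : HasSumRule M D n m0) (k : Unit ⊕ W) :
    FlatAt n (fun ξ => 1 - mdet M * component M dig μ k ξ) 0 := by
  classical
  have h1 : (fun ξ => 1 - mdet M * component M dig μ k ξ) = fun ξ => (1 - m0 ξ) +
      ∑ s ∈ D.erase 0, -chr (intVec (-dig k)) (transInvAct M (intVec s)) *
        m0 (ξ + transInvAct M (intVec s)) := by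
    funext ξ
    rw [mdet_mul_component hM hD hdig hμ, ← Finset.add_sum_erase D _ hD.1, intVec_zero,
      transInvAct, act_zero, add_zero, chr_zero_right, one_mul, ← sub_sub, sub_eq_add_neg _ (∑ _ ∈ _, _),
      ← Finset.sum_neg_distrib]
    simp only [neg_mul]
  have hsm : ∀ s : Fin d → ℤ, Smooth fun ξ => m0 (ξ + transInvAct M (intVec s)) := fun s =>
    ContDiff.comp ht.contDiff (contDiff_id.add contDiff_const)
  rw [h1]
  refine (flatAt_one_sub hM hD ht hint h).add (ContDiff.sub contDiff_const ht.contDiff)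
    (ContDiff.sum fun s _ => ContDiff.mul contDiff_const (hsm s))
    (flatAt_sum _ (fun s => ContDiff.mul contDiff_const (hsm s)) fun s hs => ?_)
  exact (h.flatAt hM ht (Finset.mem_of_mem_erase hs) (Finset.ne_of_mem_erase hs)).mul_left
    (hsm s) contDiff_const

theorem isTrigPoly_component (hμ : ∀ k, IsTrigPoly (μ k)) (k : Unit ⊕ W) :
    IsTrigPoly (component M dig μ k) :=
  ((isTrigPoly_chr (dig k)).mul ((hμ k).comp_transAct M)).const_mul _

theorem flatAt_conj_component [Fintype W] (hM : IsDilation M) (hD : IsDigitSet Mᵀ D)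
    (hdig : IsDigitFamily M dig) (ht : IsTrigPoly m0) (hμ : IsPolyphase M dig m0 μ)
    (hint : IsInterpolatory M D m0) (h : HasSumRule M D n m0) (k : Unit ⊕ W) :
    FlatAt n (fun ξ => 1 - mdet M * starRingEnd ℂ (component M dig μ k ξ)) 0 := by
  have h1 := (flatAt_one_sub_component hM hD hdig ht hμ hint h k).conj
    (((isTrigPoly_const 1).sub ((isTrigPoly_component hμ.1 k).const_mul (mdet M))).contDiff)
  simpa using h1

theorem hasVM_waveMaskDual [Fintype W] [DecidableEq W] (hM : IsDilation M) (hD : IsDigitSet Mᵀ D)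
    (hdig : IsDigitFamily M dig) (h0 : dig (Sum.inl ()) = 0) (ht : IsTrigPoly m0)
    (hμ : IsPolyphase M dig m0 μ) (hint : IsInterpolatory M D m0) (h : HasSumRule M D n m0)
    (w : W) : HasVM n (waveMaskDual M dig μ w) := by
  have hsm := (isTrigPoly_component (M := M) (dig := dig) hμ.1 (Sum.inr w)).conj
  have h1 := ((flatAt_conj_component hM hD hdig ht hμ hint h (Sum.inr w)).mul_left
    ((isTrigPoly_const 1).sub (hsm.const_mul (mdet M))).contDiff
    (contDiff_chr (intVec (dig (Sum.inr w))))).mul_left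
      ((isTrigPoly_chr _).mul ((isTrigPoly_const 1).sub (hsm.const_mul (mdet M)))).contDiff
      (contDiff_const (c := (1 / mdet M : ℂ)))
  rw [show waveMaskDual M dig μ w = _ from funext fun ξ => waveMaskDual_eq hM h0 w ξ]
  exact h1.hasVM

theorem hasVM_waveMask [Fintype W] [DecidableEq W] (hM : IsDilation M) (hD : IsDigitSet Mᵀ D)
    (hdig : IsDigitFamily M dig) (h0 : dig (Sum.inl ()) = 0) (ht : IsTrigPoly m0)
    (hμ : IsPolyphase M dig m0 μ) (hint : IsInterpolatory M D m0) (h : HasSumRule M D n m0)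
    (w : W) : HasVM n (waveMask M dig μ w) := by
  have hsm := (isTrigPoly_component (M := M) (dig := dig) hμ.1 (Sum.inr w)).conj
  have hs1 := (isTrigPoly_const 1).sub (hsm.const_mul (mdet M))
  have hs2 := (isTrigPoly_const 1).sub ht
  have h1 := (flatAt_conj_component hM hD hdig ht hμ hint h (Sum.inr w)).mul_left hs1.contDiff
    ht.contDiff
  -- The splitting used is 1 - m conj(c_w) m0 = (1 - m0) + m0 (1 - m conj(c_w)).
  have h2 := ((flatAt_one_sub hM hD ht hint h).add hs2.contDiff (ht.mul hs1).contDiff h1).mul_left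
    (hs2.add (ht.mul hs1)).contDiff (contDiff_chr (intVec (dig (Sum.inr w))))
  rw [show waveMask M dig μ w = _ from
    funext fun ξ => waveMask_eq hM h0 hμ (hint.mu_zero hM hD hdig h0 hμ) w ξ]
  refine ((congrArg (FlatAt n · 0) (funext fun ξ => ?_)).mp h2).hasVM
  ring

theorem HasVM.apply_zero {t : Rn d → ℂ} (hn : 0 < n) (h : HasVM n t) : t 0 = 0 := by
  have h1 := h 0 (by simpa using hn)
  rw [mderiv_eq_foldr] at h1
  have h2 : indexWord (0 : Fin d → ℕ) = [] := by
    rw [← List.length_eq_zero_iff, length_indexWord]; simp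
  rwa [h2] at h1

theorem FlatAt.apply_eq_zero {t : Rn d → ℂ} {x : Rn d} (hn : 0 < n) (h : FlatAt n t x) :
    t x = 0 := h [] hn

theorem norm_mu_zero [Fintype W] (hM : IsDilation M) (hD : IsDigitSet Mᵀ D)
    (hdig : IsDigitFamily M dig) (ht : IsTrigPoly m0) (hμ : IsPolyphase M dig m0 μ)
    (hint : IsInterpolatory M D m0) (hn : 0 < n) (h : HasSumRule M D n m0) (k : Unit ⊕ W) :
    μ k 0 = 1 / sqrtm M := by
  have hq := hM.sqrtm_ne_zero
  have h1 := (flatAt_one_sub_component hM hD hdig ht hμ hint h k).apply_eq_zero hn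
  rw [component, chr_zero_right, transAct, act_zero, ← sqrtm_mul_self] at h1
  field_simp at h1 ⊢
  linear_combination -h1

/-- At the origin every μ_k equals m^{-1/2}, so the loss in the zero digit component and the
contribution of the other digits cancel, whatever their number. -/
theorem dualMask_zero [Fintype W] (hM : IsDilation M) (hD : IsDigitSet Mᵀ D)
    (hdig : IsDigitFamily M dig) (ht : IsTrigPoly m0) (hμ : IsPolyphase M dig m0 μ)
    (hint : IsInterpolatory M D m0) (hn : 0 < n) (h : HasSumRule M D n m0) :
    dualMask M dig μ 0 = 1 := by
  have hq := hM.sqrtm_ne_zero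
  have h1 := norm_mu_zero hM hD hdig ht hμ hint hn h
  have h2 : ((‖1 / sqrtm M‖ ^ 2 : ℝ) : ℂ) = 1 / mdet M := by
    rw [Complex.ofReal_pow, ← Complex.mul_conj', map_div₀, conj_sqrtm, map_one, div_mul_div_comm,
      sqrtm_mul_self, one_mul]
  rw [dualMask, assemble, Fintype.sum_sum_type]
  simp only [Finset.univ_unique, PUnit.default_eq_unit, transAct, act_zero,
    chr_zero_right, Sum.elim_inl, Sum.elim_inr, h1, Finset.sum_const, nsmul_eq_mul,
    Complex.ofReal_mul, h2, ← sqrtm_mul_self]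
  simp only [Finset.card_singleton, Nat.cast_one]
  push_cast
  field_simp
  ring

end Moments

/-! ### Symmetry of the wavelet masks -/

section Symmetry

variable {D : Finset (Fin d → ℤ)} {H : Subgroup (GL (Fin d) ℤ)}

theorem IsSymmAbout.transAct_eq {t : Rn d → ℂ} (h : IsSymmAbout (H : Set (GL (Fin d) ℤ)) 0 t)
    {K : GL (Fin d) ℤ} (hK : K ∈ H) (ξ : Rn d) :
    t (transAct (K : Matrix (Fin d) (Fin d) ℤ) ξ) = t ξ := by
  have := (h.2 K hK).2 ξ
  rw [act_zero, sub_zero, chr_zero_left, one_mul] at this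
  exact this.symm

/-- If `⟨K s_w⟩ = ⟨s_w'⟩`, the masks number `w` and `w'` differ by the action of `K` and a
character. -/
theorem waveMask_transAct [Fintype W] [DecidableEq W] (hM : IsDilation M)
    (hH : IsSymmetryGroup M H) (hD : IsDigitSet Mᵀ D)
    (hdig : IsDigitFamily M dig) (h0 : dig (Sum.inl ()) = 0)
    (hμ : IsPolyphase M dig m0 μ) (hint : IsInterpolatory M D m0) {K : GL (Fin d) ℤ} (hK : K ∈ H)
    (hsym : ∀ ξ, m0 (transAct (K : Matrix (Fin d) (Fin d) ℤ) ξ) = m0 ξ) {w w' : W}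
    (hw : CongrMod M ((K : Matrix (Fin d) (Fin d) ℤ) *ᵥ dig (Sum.inr w)) (dig (Sum.inr w')))
    (ξ : Rn d) :
    waveMask M dig μ w' ξ = chr (intVec (dig (Sum.inr w') -
        (K : Matrix (Fin d) (Fin d) ℤ) *ᵥ dig (Sum.inr w))) ξ *
      waveMask M dig μ w (transAct (K : Matrix (Fin d) (Fin d) ℤ) ξ) ∧
    waveMaskDual M dig μ w' ξ = chr (intVec (dig (Sum.inr w') -
        (K : Matrix (Fin d) (Fin d) ℤ) *ᵥ dig (Sum.inr w))) ξ *
      waveMaskDual M dig μ w (transAct (K : Matrix (Fin d) (Fin d) ℤ) ξ) := by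
  have hμ0 := hint.mu_zero hM hD hdig h0 hμ
  have h1 := component_transAct hM hH hD hdig hμ hK hsym hw ξ
  have h2 : chr (intVec (dig (Sum.inr w'))) ξ = chr (intVec (dig (Sum.inr w') -
      (K : Matrix (Fin d) (Fin d) ℤ) *ᵥ dig (Sum.inr w))) ξ *
        chr (intVec (dig (Sum.inr w))) (transAct (K : Matrix (Fin d) (Fin d) ℤ) ξ) := by
    rw [chr_transAct, ← chr_add_left, ← intVec_add, sub_add_cancel]
  rw [waveMask_eq hM h0 hμ hμ0, waveMask_eq hM h0 hμ hμ0, waveMaskDual_eq hM h0,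
    waveMaskDual_eq hM h0, h1, hsym, h2]
  constructor <;> ring

end Symmetry

end

section

/-! ### Translations, dilations and modulations of `L_2(ℝ^d)` -/

variable {d : ℕ}

theorem memLp_weightedComp {w : Rn d → ℂ} {T : Rn d → Rn d}
    (hw : AEStronglyMeasurable w (volume : Measure (Rn d)))
    (hT : Measure.QuasiMeasurePreserving T (volume : Measure (Rn d)) volume)
    (h : ∀ f : Rn d → ℂ, AEStronglyMeasurable f (volume : Measure (Rn d)) →
      eLpNorm (fun x => w x * f (T x)) 2 volume = eLpNorm f 2 volume) (f : L2 d) :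
    MemLp (fun x => w x * f (T x)) 2 volume :=
  ⟨hw.mul ((Lp.aestronglyMeasurable f).comp_quasiMeasurePreserving hT), by
    rw [h _ (Lp.aestronglyMeasurable f)]; exact Lp.eLpNorm_lt_top f⟩

/-- The isometry `f ↦ w · (f ∘ T)` of `L_2(ℝ^d)`. -/
def weightedComp (w : Rn d → ℂ) (T : Rn d → Rn d)
    (hw : AEStronglyMeasurable w (volume : Measure (Rn d)))
    (hT : Measure.QuasiMeasurePreserving T (volume : Measure (Rn d)) volume)
    (h : ∀ f : Rn d → ℂ, AEStronglyMeasurable f (volume : Measure (Rn d)) →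
      eLpNorm (fun x => w x * f (T x)) 2 volume = eLpNorm f 2 volume) : L2 d →ₗᵢ[ℂ] L2 d :=
  have hmem : ∀ f : L2 d, MemLp (fun x => w x * f (T x)) 2 volume := memLp_weightedComp hw hT h
  { toFun := fun f => (hmem f).toLp _
    map_add' := fun f g => by
      refine Lp.ext ?_
      filter_upwards [(hmem (f + g)).coeFn_toLp, Lp.coeFn_add ((hmem f).toLp _) ((hmem g).toLp _),
        (hmem f).coeFn_toLp, (hmem g).coeFn_toLp, hT.ae_eq_comp (Lp.coeFn_add f g)]
        with x h1 h2 h3 h4 h5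
      simp only [Function.comp_apply, Pi.add_apply] at h5
      rw [h1, h2, Pi.add_apply, h3, h4, h5, mul_add]
    map_smul' := fun c f => by
      refine Lp.ext ?_
      filter_upwards [(hmem (c • f)).coeFn_toLp, Lp.coeFn_smul c ((hmem f).toLp _),
        (hmem f).coeFn_toLp, hT.ae_eq_comp (Lp.coeFn_smul c f)] with x h1 h2 h3 h4
      simp only [Function.comp_apply, Pi.smul_apply, smul_eq_mul] at h4
      rw [h1, RingHom.id_apply, h2, Pi.smul_apply, h3, h4, smul_eq_mul]
      ring
    norm_map' := fun f => by
      change ‖(hmem f).toLp _‖ = ‖f‖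
      rw [Lp.norm_toLp, h _ (Lp.aestronglyMeasurable f), Lp.norm_def] }

theorem coeFn_weightedComp (w : Rn d → ℂ) (T : Rn d → Rn d)
    (hw : AEStronglyMeasurable w (volume : Measure (Rn d)))
    (hT : Measure.QuasiMeasurePreserving T (volume : Measure (Rn d)) volume)
    (h : ∀ f : Rn d → ℂ, AEStronglyMeasurable f (volume : Measure (Rn d)) →
      eLpNorm (fun x => w x * f (T x)) 2 volume = eLpNorm f 2 volume) (f : L2 d) :
    weightedComp w T hw hT h f =ᵐ[volume] fun x => w x * f (T x) :=
  MemLp.coeFn_toLp (memLp_weightedComp hw hT h f)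

theorem quasiMeasurePreserving_add (b : Rn d) :
    Measure.QuasiMeasurePreserving (fun x : Rn d => x + b) volume volume :=
  (measurePreserving_add_right volume b).quasiMeasurePreserving

/-- The translation `f ↦ f(· + b)`. -/
def tr (b : Rn d) : L2 d →ₗᵢ[ℂ] L2 d :=
  weightedComp (fun _ => 1) (fun x => x + b) aestronglyMeasurable_const
    (quasiMeasurePreserving_add b) fun f hf => by
      simp only [one_mul]
      exact eLpNorm_comp_measurePreserving hf (measurePreserving_add_right volume b)

theorem coeFn_tr (b : Rn d) (f : L2 d) : tr b f =ᵐ[volume] fun x => f (x + b) := by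
  filter_upwards [coeFn_weightedComp (fun _ => (1 : ℂ)) (fun x => x + b)
    aestronglyMeasurable_const (quasiMeasurePreserving_add b) _ f] with x hx
  rw [tr, hx, one_mul]

/-- The modulation `f ↦ e^{2π i (b, ·)} f`. -/
def modul (b : Rn d) : L2 d →ₗᵢ[ℂ] L2 d :=
  weightedComp (chr b) id (continuous_chr b).aestronglyMeasurable (.id _) fun f _ =>
    eLpNorm_congr_norm_ae (Filter.Eventually.of_forall fun x => by simp [norm_chr])

theorem coeFn_modul (b : Rn d) (f : L2 d) : modul b f =ᵐ[volume] fun x => chr b x * f x :=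
  coeFn_weightedComp _ _ _ _ _ f

variable {A B : Matrix (Fin d) (Fin d) ℝ}

theorem map_act (hA : A.det ≠ 0) : Measure.map (act A) (volume : Measure (Rn d)) =
    ENNReal.ofReal |A.det⁻¹| • volume := by
  have h := Measure.map_linearMap_addHaar_eq_smul_addHaar (volume : Measure (Rn d))
    (f := Matrix.toEuclideanLin A) (by simpa using hA)
  rw [show LinearMap.det (Matrix.toEuclideanLin A) = A.det by simp] at h
  exact h

theorem quasiMeasurePreserving_act (hA : A.det ≠ 0) :
    Measure.QuasiMeasurePreserving (act A) (volume : Measure (Rn d)) volume := by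
  refine ⟨(continuous_act A).measurable, ?_⟩
  rw [map_act hA]
  exact Measure.smul_absolutelyContinuous

/-- `act A` as a homeomorphism. -/
def actHomeomorph (hA : A.det ≠ 0) : Rn d ≃ₜ Rn d where
  toFun := act A
  invFun := act A⁻¹
  left_inv := act_inv_act hA
  right_inv := act_act_inv hA
  continuous_toFun := continuous_act A
  continuous_invFun := continuous_act A⁻¹

theorem integral_act (hA : A.det ≠ 0) (f : Rn d → ℂ) :
    ∫ x, f (act A x) = |A.det|⁻¹ * ∫ x, f x := by
  have h1 : MeasurableEmbedding (act A) := (actHomeomorph hA).measurableEmbedding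
  rw [← h1.integral_map (μ := volume) f, map_act hA, integral_smul_measure,
    ENNReal.toReal_ofReal (abs_nonneg _), abs_inv, Complex.real_smul, Complex.ofReal_inv]

/-- The normalized dilation `f ↦ |det A|^{1/2} f(A ·)`. -/
def dil (A : Matrix (Fin d) (Fin d) ℝ) (hA : A.det ≠ 0) : L2 d →ₗᵢ[ℂ] L2 d :=
  weightedComp (fun _ => (√|A.det| : ℂ)) (act A) aestronglyMeasurable_const
    (quasiMeasurePreserving_act hA) fun f hf => by
      have h1 : AEStronglyMeasurable f (Measure.map (act A) volume) := by
        rw [map_act hA]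
        exact hf.smul_measure _
      have h2 : (0 : ℝ) < |A.det| := abs_pos.mpr hA
      have h3 := eLpNorm_map_measure h1 (continuous_act A).aemeasurable (p := 2)
      rw [map_act hA, eLpNorm_smul_measure_of_ne_zero (by
        rw [abs_inv]; simpa using h2)] at h3
      have h4 : (fun x => (√|A.det| : ℂ) * f (act A x)) =
          (√|A.det| : ℂ) • (f ∘ act A) := rfl
      rw [h4, eLpNorm_const_smul, ← h3, smul_eq_mul, ← mul_assoc]
      have h5 : ‖(√|A.det| : ℂ)‖ₑ * ENNReal.ofReal |A.det⁻¹| ^ (1 / (2 : ℝ≥0∞)).toReal = 1 := by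
        rw [abs_inv, ← ofReal_norm, Complex.norm_real, Real.norm_of_nonneg
          (Real.sqrt_nonneg _), ENNReal.ofReal_rpow_of_pos (by positivity),
          ← ENNReal.ofReal_mul (Real.sqrt_nonneg _)]
        have : |A.det|⁻¹ ^ (1 / (2 : ℝ≥0∞)).toReal = (√|A.det|)⁻¹ := by
          rw [← Real.sqrt_inv, Real.sqrt_eq_rpow]
          simp
        rw [this, mul_inv_cancel₀ (Real.sqrt_pos.mpr h2).ne', ENNReal.ofReal_one]
      rw [h5, one_mul]

theorem coeFn_dil (hA : A.det ≠ 0) (f : L2 d) :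
    dil A hA f =ᵐ[volume] fun x => (√|A.det| : ℂ) * f (act A x) :=
  coeFn_weightedComp _ _ _ _ _ f

theorem tr_tr (a b : Rn d) (f : L2 d) : tr a (tr b f) = tr (a + b) f := by
  refine Lp.ext ?_
  filter_upwards [coeFn_tr a (tr b f), coeFn_tr (a + b) f,
    (quasiMeasurePreserving_add a).ae_eq_comp (coeFn_tr b f)] with x h1 h2 h3
  simp only [Function.comp_apply] at h3
  rw [h1, h2, h3, add_assoc]

theorem tr_zero (f : L2 d) : tr 0 f = f := by
  refine Lp.ext ?_
  filter_upwards [coeFn_tr 0 f] with x h1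
  rw [h1, add_zero]

theorem tr_comm (a b : Rn d) (f : L2 d) : tr a (tr b f) = tr b (tr a f) := by
  rw [tr_tr, tr_tr, add_comm]

theorem inner_tr_left (a : Rn d) (f g : L2 d) : inner ℂ (tr a f) g = inner ℂ f (tr (-a) g) := by
  rw [← (tr a).inner_map_map f, tr_tr, add_neg_cancel, tr_zero]

theorem dil_dil (hA : A.det ≠ 0) (hB : B.det ≠ 0) (f : L2 d) :
    dil B hB (dil A hA f) = dil (A * B) (by rw [Matrix.det_mul]; exact mul_ne_zero hA hB) f := by
  refine Lp.ext ?_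
  filter_upwards [coeFn_dil hB (dil A hA f), coeFn_dil (A := A * B)
    (by rw [Matrix.det_mul]; exact mul_ne_zero hA hB) f,
    (quasiMeasurePreserving_act hB).ae_eq_comp (coeFn_dil hA f)] with x h1 h2 h3
  simp only [Function.comp_apply] at h3
  rw [h1, h2, h3, act_mul, Matrix.det_mul, abs_mul, Real.sqrt_mul (abs_nonneg _)]
  push_cast
  ring

theorem dil_one (h : (1 : Matrix (Fin d) (Fin d) ℝ).det ≠ 0) (f : L2 d) : dil 1 h f = f := by
  refine Lp.ext ?_
  filter_upwards [coeFn_dil h f] with x h1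
  rw [h1, act_one]
  simp

theorem dil_congr {hA : A.det ≠ 0} (h : A = B) (f : L2 d) : dil A hA f = dil B (h ▸ hA) f := by
  subst h; rfl

theorem tr_dil (hA : A.det ≠ 0) (b : Rn d) (f : L2 d) :
    tr b (dil A hA f) = dil A hA (tr (act A b) f) := by
  refine Lp.ext ?_
  filter_upwards [coeFn_tr b (dil A hA f), coeFn_dil hA (tr (act A b) f),
    (quasiMeasurePreserving_add b).ae_eq_comp (coeFn_dil hA f),
    (quasiMeasurePreserving_act hA).ae_eq_comp (coeFn_tr (act A b) f)] with x h1 h2 h3 h4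
  simp only [Function.comp_apply] at h3 h4
  rw [h1, h2, h3, h4, act_add]

theorem det_inv_ne_zero (hA : A.det ≠ 0) : A⁻¹.det ≠ 0 := by
  rw [Matrix.det_nonsing_inv]
  simpa using hA

/-! ### The Fourier transform of translations and dilations -/

theorem fourier_eq_chr (f : Rn d → ℂ) (ξ : Rn d) : 𝓕 f ξ = ∫ x, chr (-x) ξ * f x := by
  rw [Real.fourier_eq']
  refine integral_congr_ae (Filter.Eventually.of_forall fun x => ?_)
  simp only [smul_eq_mul, chr_eq_exp_inner, inner_neg_left]
  congr 2
  push_cast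
  ring

theorem fourierInv_eq_chr (f : Rn d → ℂ) (x : Rn d) : 𝓕⁻ f x = ∫ ξ, chr x ξ * f ξ := by
  rw [Real.fourierInv_eq']
  refine integral_congr_ae (Filter.Eventually.of_forall fun ξ => ?_)
  simp only [smul_eq_mul, chr_eq_exp_inner, real_inner_comm x ξ]
  congr 2
  push_cast
  ring

/-- Two continuous operators that agree on Schwartz functions are equal. -/
theorem eq_of_eq_schwartz {S T : L2 d → L2 d} (hS : Continuous S) (hT : Continuous T)
    (h : ∀ f : SchwartzMap (Rn d) ℂ, S (f.toLp 2) = T (f.toLp 2)) (f : L2 d) : S f = T f := by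
  have hd : DenseRange (SchwartzMap.toLpCLM ℝ ℂ 2 (volume : Measure (Rn d))) :=
    SchwartzMap.denseRange_toLpCLM (by simp)
  exact congrFun (hd.equalizer hS hT (funext fun f => h f)) f

theorem continuous_fourier_L2 : Continuous fun f : L2 d => (𝓕 f : L2 d) :=
  (Lp.fourierTransformₗᵢ (Rn d) ℂ).continuous

/-- This rule and the one for dilations are checked on Schwartz functions, where the transform is an
integral, and extended to L_2 by density and continuity. -/
theorem fourier_tr (b : Rn d) (f : L2 d) : (𝓕 (tr b f) : L2 d) = modul b (𝓕 f) := by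
  refine eq_of_eq_schwartz (S := fun f => 𝓕 (tr b f)) (T := fun f => modul b (𝓕 f))
    (continuous_fourier_L2.comp (tr b).continuous)
    ((modul b).continuous.comp continuous_fourier_L2) (fun f => ?_) f
  have h1 : tr b (f.toLp 2) = (SchwartzMap.compSubConstCLM ℂ (-b) f).toLp 2 := by
    refine Lp.ext ?_
    filter_upwards [coeFn_tr b (f.toLp 2), SchwartzMap.coeFn_toLp
      (SchwartzMap.compSubConstCLM ℂ (-b) f) 2,
      (quasiMeasurePreserving_add b).ae_eq_comp (f.coeFn_toLp 2)] with x h1 h2 h3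
    simp only [Function.comp_apply] at h3
    rw [h1, h2, h3, SchwartzMap.compSubConstCLM_apply, sub_neg_eq_add]
  simp only [h1]
  rw [SchwartzMap.toLp_fourier_eq, SchwartzMap.toLp_fourier_eq]
  refine Lp.ext ?_
  filter_upwards [coeFn_modul b ((𝓕 f).toLp 2), SchwartzMap.coeFn_toLp (𝓕 f) 2,
    SchwartzMap.coeFn_toLp (𝓕 (SchwartzMap.compSubConstCLM ℂ (-b) f)) 2] with ξ h1 h2 h3
  rw [h1, h2, h3, SchwartzMap.fourier_coe, SchwartzMap.fourier_coe, fourier_eq_chr, fourier_eq_chr,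
    ← integral_const_mul, ← integral_sub_right_eq_self _ b]
  refine integral_congr_ae (Filter.Eventually.of_forall fun x => ?_)
  simp only [SchwartzMap.compSubConstCLM_apply]
  rw [sub_neg_eq_add, sub_add_cancel, neg_sub, sub_eq_add_neg, chr_add_left, mul_assoc]

theorem det_inv_transpose_ne_zero (hA : A.det ≠ 0) : (A⁻¹)ᵀ.det ≠ 0 := by
  rw [Matrix.det_transpose]
  exact det_inv_ne_zero hA

theorem fourier_dil (hA : A.det ≠ 0) (f : L2 d) :
    (𝓕 (dil A hA f) : L2 d) = dil (A⁻¹)ᵀ (det_inv_transpose_ne_zero hA) (𝓕 f) := by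
  refine eq_of_eq_schwartz (S := fun f => 𝓕 (dil A hA f))
    (T := fun f => dil (A⁻¹)ᵀ (det_inv_transpose_ne_zero hA) (𝓕 f))
    (continuous_fourier_L2.comp (dil A hA).continuous)
    ((dil _ _).continuous.comp continuous_fourier_L2) (fun f => ?_) f
  let L : Rn d ≃L[ℝ] Rn d :=
    { Matrix.toEuclideanLin A with
      invFun := act A⁻¹
      left_inv := act_inv_act hA
      right_inv := act_act_inv hA
      continuous_toFun := continuous_act A
      continuous_invFun := continuous_act A⁻¹ }
  set g : SchwartzMap (Rn d) ℂ :=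
    (√|A.det| : ℂ) • SchwartzMap.compCLMOfContinuousLinearEquiv ℂ L f with hg
  have hgx : ∀ x, g x = (√|A.det| : ℂ) * f (act A x) := fun x => rfl
  have h1 : dil A hA (f.toLp 2) = g.toLp 2 := by
    refine Lp.ext ?_
    filter_upwards [coeFn_dil hA (f.toLp 2), g.coeFn_toLp 2,
      (quasiMeasurePreserving_act hA).ae_eq_comp (f.coeFn_toLp 2)] with x h1 h2 h3
    simp only [Function.comp_apply] at h3
    rw [h1, h2, h3, hgx]
  simp only [h1]
  rw [SchwartzMap.toLp_fourier_eq, SchwartzMap.toLp_fourier_eq]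
  refine Lp.ext ?_
  filter_upwards [coeFn_dil (det_inv_transpose_ne_zero hA) ((𝓕 f).toLp 2),
    SchwartzMap.coeFn_toLp (𝓕 g) 2, (quasiMeasurePreserving_act
      (det_inv_transpose_ne_zero hA)).ae_eq_comp (SchwartzMap.coeFn_toLp (𝓕 f) 2)] with ξ h1 h2 h3
  simp only [Function.comp_apply] at h3
  rw [h1, h2, h3, SchwartzMap.fourier_coe, SchwartzMap.fourier_coe, fourier_eq_chr, fourier_eq_chr]
  have h4 : ∀ x, chr (-x) ξ * g x =
      (√|A.det| : ℂ) * (chr (-(act A x)) (act (A⁻¹)ᵀ ξ) * f (act A x)) := by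
    intro x
    rw [← chr_act, act_neg, act_inv_act hA, hgx]
    ring
  simp_rw [h4]
  rw [integral_const_mul, integral_act hA fun y => chr (-y) (act (A⁻¹)ᵀ ξ) * f y, ← mul_assoc]
  congr 1
  rw [Matrix.det_transpose, Matrix.det_nonsing_inv, Ring.inverse_eq_inv', abs_inv, Real.sqrt_inv]
  rw [← Complex.ofReal_mul]
  congr 1
  have h2 : (0 : ℝ) < |A.det| := abs_pos.mpr hA
  have h3 := Real.mul_self_sqrt h2.le
  have h4 := Real.sqrt_pos.mpr h2
  field_simp
  rw [sq, h3]

theorem fourier_injective_L2 {f g : L2 d} (h : (𝓕 f : L2 d) = 𝓕 g) : f = g :=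
  (Lp.fourierTransformₗᵢ (Rn d) ℂ).injective h

/-- Strong continuity of translations. -/
theorem continuous_tr (f : L2 d) : Continuous fun b => tr b f := by
  let g : C(Rn d × Rn d, Rn d) := ⟨fun p => p.2 + p.1, by fun_prop⟩
  have h1 := (continuous_const (y := f)).compMeasurePreservingLp g.curry.continuous
    (fun b => measurePreserving_add_right volume b) (by simp : (2 : ℝ≥0∞) ≠ ∞)
  refine (congrArg Continuous (funext fun b => Lp.ext ?_)).mp h1
  filter_upwards [coeFn_tr b f, Lp.coeFn_compMeasurePreserving f
    (measurePreserving_add_right volume b)] with x h2 h3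
  rw [h2]
  exact h3

end

open Filter Topology

section

/-! ### Powers of the inverse of a dilation matrix -/

variable {d : ℕ} {M : Matrix (Fin d) (Fin d) ℤ}

section Gelfand

attribute [local instance] Matrix.linftyOpNormedRing Matrix.linftyOpNormedAlgebra

/-- Gelfand's formula: the spectral radius is below some r < 1, so ‖B^n‖ ≤ r^n for large n. -/
theorem tendsto_norm_pow_of_spectrum [Nonempty (Fin d)] (B : Matrix (Fin d) (Fin d) ℂ)
    (hB : ∀ z ∈ spectrum ℂ B, ‖z‖ < 1) : Tendsto (fun n : ℕ => ‖B ^ n‖) atTop (𝓝 0) := by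
  have : CompleteSpace (Matrix (Fin d) (Fin d) ℂ) := FiniteDimensional.complete ℂ _
  have h1 : spectralRadius ℂ B < ((1 : NNReal) : ℝ≥0∞) :=
    spectrum.spectralRadius_lt_of_forall_lt B fun z hz => hB z hz
  obtain ⟨r, hr1, hr2⟩ := ENNReal.lt_iff_exists_nnreal_btwn.mp h1
  have h2 := (spectrum.pow_nnnorm_pow_one_div_tendsto_nhds_spectralRadius B).eventually_lt_const hr1
  have hr3 : (r : ℝ) < 1 := by exact_mod_cast hr2
  refine squeeze_zero' (Eventually.of_forall fun n => norm_nonneg _) ?_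
    (tendsto_pow_atTop_nhds_zero_of_lt_one r.2 hr3)
  filter_upwards [h2, eventually_gt_atTop 0] with n hn hn0
  have hn1 : (0 : ℝ) < n := by exact_mod_cast hn0
  have h3 := ENNReal.rpow_le_rpow hn.le hn1.le
  rw [← ENNReal.rpow_mul, one_div_mul_cancel hn1.ne', ENNReal.rpow_one,
    ENNReal.rpow_natCast] at h3
  exact_mod_cast h3

/-- Over ℂ the spectrum of the inverse consists of the inverses of the eigenvalues of M, which lie
inside the unit disc. -/
theorem IsDilation.tendsto_inv_pow (hM : IsDilation M) (i j : Fin d) :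
    Tendsto (fun n : ℕ => ((realMat M)⁻¹ ^ n) i j) atTop (𝓝 0) := by
  have : Nonempty (Fin d) := ⟨i⟩
  set C : Matrix (Fin d) (Fin d) ℂ := M.map (Int.cast : ℤ → ℂ) with hC
  have hCr : C = (realMat M).map Complex.ofRealHom := by
    ext a b
    simp [hC, realMat]
  have hdet : IsUnit (realMat M).det := isUnit_iff_ne_zero.mpr hM.det_ne_zero
  set B : Matrix (Fin d) (Fin d) ℂ := (realMat M)⁻¹.map Complex.ofRealHom with hBdef
  have hCB : C * B = 1 := by
    rw [hCr, hBdef, ← Matrix.map_mul, Matrix.mul_nonsing_inv _ hdet]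
    exact Complex.ofRealHom.mapMatrix.map_one
  have hBC : B * C = 1 := by
    rw [hCr, hBdef, ← Matrix.map_mul, Matrix.nonsing_inv_mul _ hdet]
    exact Complex.ofRealHom.mapMatrix.map_one
  let u : (Matrix (Fin d) (Fin d) ℂ)ˣ := ⟨C, B, hCB, hBC⟩
  have hspec : ∀ z ∈ spectrum ℂ B, ‖z‖ < 1 := by
    intro z hz
    have h1 : z ∈ (spectrum ℂ (u : Matrix (Fin d) (Fin d) ℂ))⁻¹ := by
      rw [spectrum.map_inv]
      exact hz
    have h2 := hM _ (Set.mem_inv.mp h1)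
    rw [norm_inv] at h2
    by_contra! h3
    exact absurd h2 (not_lt.mpr (inv_le_one_of_one_le₀ h3))
  have h1 := tendsto_norm_pow_of_spectrum B hspec
  refine squeeze_zero_norm (fun n => ?_) h1
  have h2 : B ^ n = ((realMat M)⁻¹ ^ n).map Complex.ofRealHom :=
    (map_pow Complex.ofRealHom.mapMatrix (realMat M)⁻¹ n).symm
  have h3 : ‖((realMat M)⁻¹ ^ n) i j‖ = ‖(B ^ n) i j‖ := by
    rw [h2, Matrix.map_apply]
    simp
  rw [h3, Matrix.linfty_opNorm_def]
  have h4 : ‖(B ^ n) i j‖₊ ≤ Finset.univ.sup fun i => ∑ j, ‖(B ^ n) i j‖₊ :=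
    (Finset.single_le_sum (f := fun j => ‖(B ^ n) i j‖₊) (fun _ _ => zero_le) (Finset.mem_univ j)).trans
      (Finset.le_sup (f := fun i => ∑ j, ‖(B ^ n) i j‖₊) (Finset.mem_univ i))
  exact_mod_cast h4

end Gelfand

theorem norm_act_le (A : Matrix (Fin d) (Fin d) ℝ) (x : Rn d) :
    ‖act A x‖ ≤ (∑ i, ∑ j, |A i j|) * ‖x‖ := by
  have h1 : act A x = ∑ i, ∑ j, (A i j * x j) • (EuclideanSpace.single i 1 : Rn d) := by
    ext k
    simp [act_apply, Pi.single_apply]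
  rw [h1, Finset.sum_mul]
  refine (norm_sum_le _ _).trans (Finset.sum_le_sum fun i _ => ?_)
  rw [Finset.sum_mul]
  refine (norm_sum_le _ _).trans (Finset.sum_le_sum fun j _ => ?_)
  rw [norm_smul, PiLp.norm_single, norm_one, mul_one, norm_mul]
  exact mul_le_mul_of_nonneg_left (PiLp.norm_apply_le x j) (abs_nonneg _)

/-- A norm-like function that is contracted by `A`. -/
structure IsContracted (A : Matrix (Fin d) (Fin d) ℝ) (q : Rn d → ℝ) (C ρ : ℝ) : Prop where
  pos : 0 < ρ
  lt_one : ρ < 1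
  const_pos : 0 < C
  norm_le : ∀ x, ‖x‖ ≤ q x
  le_norm : ∀ x, q x ≤ C * ‖x‖
  add_le : ∀ x y, q (x + y) ≤ q x + q y
  act_le : ∀ x, q (act A x) ≤ ρ * q x

/-- An adapted norm. If A^N at least halves every vector and ρ^N = 1/2, then q(x) = ∑_{i<N}
ρ^{-i}‖A^i x‖ satisfies q(Ax) = ρ (q(x) - ‖x‖ + ρ^{-N}‖A^N x‖) ≤ ρ q(x). The `+ 1` in the upper
constant only makes it positive. -/
theorem exists_isContracted {A : Matrix (Fin d) (Fin d) ℝ}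
    (hA : ∀ i j, Tendsto (fun n : ℕ => (A ^ n) i j) atTop (𝓝 0)) :
    ∃ q C ρ, IsContracted A q C ρ := by
  have h1 : Tendsto (fun n : ℕ => ∑ i, ∑ j, |(A ^ n) i j|) atTop (𝓝 0) := by
    have : (0 : ℝ) = ∑ i : Fin d, ∑ j : Fin d, |(0 : ℝ)| := by simp
    rw [this]
    exact tendsto_finsetSum _ fun i _ => tendsto_finsetSum _ fun j _ => (hA i j).abs
  obtain ⟨N, hN, hN0⟩ := ((h1.eventually_le_const (by norm_num : (0 : ℝ) < 1 / 2)).and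
    (eventually_gt_atTop 0)).exists
  set ρ : ℝ := (1 / 2 : ℝ) ^ (1 / (N : ℝ)) with hρ
  have hρ0 : 0 < ρ := by positivity
  have hρN : ρ ^ N = 1 / 2 := by
    rw [hρ, ← Real.rpow_natCast, ← Real.rpow_mul (by norm_num), one_div_mul_cancel
      (by positivity), Real.rpow_one]
  have hρ1 : ρ < 1 := Real.rpow_lt_one (by norm_num) (by norm_num) (by positivity)
  set q : Rn d → ℝ := fun x => ∑ i ∈ Finset.range N, (ρ ^ i)⁻¹ * ‖act (A ^ i) x‖ with hq
  have hnn : ∀ x i, 0 ≤ (ρ ^ i)⁻¹ * ‖act (A ^ i) x‖ := fun x i => by positivity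
  refine ⟨q, ∑ i ∈ Finset.range N, (ρ ^ i)⁻¹ * (∑ k, ∑ j, |(A ^ i) k j|) + 1, ρ, hρ0, hρ1,
    add_pos_of_nonneg_of_pos (Finset.sum_nonneg fun i _ => by positivity) one_pos,
    fun x => ?_, fun x => ?_, fun x y => ?_, fun x => ?_⟩
  · have := Finset.single_le_sum (f := fun i => (ρ ^ i)⁻¹ * ‖act (A ^ i) x‖) (fun i _ => hnn x i)
      (Finset.mem_range.mpr hN0)
    simpa [act_one] using this
  · rw [add_mul, Finset.sum_mul]
    refine le_add_of_le_of_nonneg (Finset.sum_le_sum fun i _ => ?_) (by positivity)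
    rw [mul_assoc]
    exact mul_le_mul_of_nonneg_left (norm_act_le _ _) (by positivity)
  · rw [hq, ← Finset.sum_add_distrib]
    refine Finset.sum_le_sum fun i _ => ?_
    rw [← mul_add, act_add]
    exact mul_le_mul_of_nonneg_left (norm_add_le _ _) (by positivity)
  · have h2 : q (act A x) = ρ * ∑ i ∈ Finset.range N, (ρ ^ (i + 1))⁻¹ * ‖act (A ^ (i + 1)) x‖ := by
      rw [hq, Finset.mul_sum]
      refine Finset.sum_congr rfl fun i _ => ?_
      rw [← act_mul, ← pow_succ]
      field_simp
      ring
    rw [h2]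
    refine mul_le_mul_of_nonneg_left ?_ hρ0.le
    have h3 := Finset.sum_range_succ (fun i => (ρ ^ i)⁻¹ * ‖act (A ^ i) x‖) N
    rw [Finset.sum_range_succ'] at h3
    have h4 : (ρ ^ N)⁻¹ * ‖act (A ^ N) x‖ ≤ ‖x‖ := by
      rw [hρN]
      have := (norm_act_le (A ^ N) x).trans (mul_le_mul_of_nonneg_right hN (norm_nonneg x))
      linarith
    simp only [pow_zero, inv_one, one_mul, act_one] at h3
    linarith

namespace IsContracted

variable {A : Matrix (Fin d) (Fin d) ℝ} {q : Rn d → ℝ} {C ρ : ℝ}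

theorem nonneg (h : IsContracted A q C ρ) (x : Rn d) : 0 ≤ q x := (norm_nonneg x).trans (h.norm_le x)

theorem iterate_le (h : IsContracted A q C ρ) (n : ℕ) (x : Rn d) :
    q ((act A)^[n] x) ≤ ρ ^ n * q x := by
  induction n with
  | zero => simp
  | succ n ih =>
    rw [Function.iterate_succ_apply', pow_succ', mul_assoc]
    exact (h.act_le _).trans (mul_le_mul_of_nonneg_left ih h.pos.le)

theorem norm_iterate_le (h : IsContracted A q C ρ) (n : ℕ) (x : Rn d) :
    ‖(act A)^[n] x‖ ≤ ρ ^ n * (C * ‖x‖) :=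
  (h.norm_le _).trans ((h.iterate_le n x).trans
    (mul_le_mul_of_nonneg_left (h.le_norm x) (pow_nonneg h.pos.le n)))

end IsContracted

theorem act_pow (A : Matrix (Fin d) (Fin d) ℝ) (n : ℕ) : act (A ^ n) = (act A)^[n] := by
  induction n with
  | zero => funext x; simp [act_one]
  | succ n ih =>
    funext x
    rw [pow_succ', act_mul, ih, Function.iterate_succ_apply']

theorem IsDilation.exists_isContracted_inv (hM : IsDilation M) :
    ∃ q C ρ, IsContracted (realMat M)⁻¹ q C ρ := exists_isContracted hM.tendsto_inv_pow

theorem IsDilation.exists_isContracted_transInv (hM : IsDilation M) :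
    ∃ q C ρ, IsContracted ((realMat M)ᵀ)⁻¹ q C ρ :=
  exists_isContracted fun i j => by
    rw [← Matrix.transpose_nonsing_inv]
    simp_rw [← Matrix.transpose_pow, Matrix.transpose_apply]
    exact hM.tendsto_inv_pow j i

/-! ### The infinite product -/

section Product

variable {t : Rn d → ℂ}

/-- The partial products of `refinableFT`. -/
def partialFT (M : Matrix (Fin d) (Fin d) ℤ) (t : Rn d → ℂ) (n : ℕ) (ξ : Rn d) : ℂ :=
  ∏ j ∈ Finset.range n, t ((transInvAct M)^[j + 1] ξ)

theorem partialFT_succ (n : ℕ) (ξ : Rn d) :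
    partialFT M t (n + 1) ξ = t (transInvAct M ξ) * partialFT M t n (transInvAct M ξ) := by
  rw [partialFT, Finset.prod_range_succ', mul_comm]
  rfl

theorem exists_summable_bound (hM : IsDilation M) (ht : IsTrigPoly t) (ht0 : t 0 = 1) :
    ∃ L ρ : ℝ, 0 < L ∧ 0 < ρ ∧ ρ < 1 ∧
      ∀ ξ j, ‖t ((transInvAct M)^[j + 1] ξ) - 1‖ ≤ ρ ^ j * (L * ‖ξ‖) := by
  obtain ⟨q, C, ρ, hq⟩ := hM.exists_isContracted_transInv
  obtain ⟨L, hL, hLt⟩ := ht.norm_sub_le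
  refine ⟨L * C, ρ, mul_pos hL hq.const_pos, hq.pos, hq.lt_one, fun ξ j => ?_⟩
  rw [← ht0]
  refine (hLt _).trans ?_
  have h1 := hq.norm_iterate_le (j + 1) ξ
  have h2 : ρ ^ (j + 1) * (C * ‖ξ‖) ≤ ρ ^ j * (C * ‖ξ‖) := by
    have := hq.const_pos
    have : ρ ^ (j + 1) ≤ ρ ^ j := pow_le_pow_of_le_one hq.pos.le hq.lt_one.le (Nat.le_succ j)
    gcongr
  calc L * ‖(transInvAct M)^[j + 1] ξ‖ ≤ L * (ρ ^ j * (C * ‖ξ‖)) :=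
        mul_le_mul_of_nonneg_left (h1.trans h2) hL.le
    _ = _ := by ring

theorem summable_sub_one (hM : IsDilation M) (ht : IsTrigPoly t) (ht0 : t 0 = 1) (ξ : Rn d) :
    Summable fun j : ℕ => ‖t ((transInvAct M)^[j + 1] ξ) - 1‖ := by
  obtain ⟨L, ρ, hL, hρ0, hρ1, h⟩ := exists_summable_bound hM ht ht0
  exact Summable.of_nonneg_of_le (fun _ => norm_nonneg _) (h ξ)
    ((summable_geometric_of_lt_one hρ0.le hρ1).mul_right _)

theorem multipliable_refinable (hM : IsDilation M) (ht : IsTrigPoly t) (ht0 : t 0 = 1) (ξ : Rn d) :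
    Multipliable fun j : ℕ => t ((transInvAct M)^[j + 1] ξ) := by
  have := multipliable_one_add_of_summable (summable_sub_one hM ht ht0 ξ)
  simpa using this

theorem tendsto_partialFT (hM : IsDilation M) (ht : IsTrigPoly t) (ht0 : t 0 = 1) (ξ : Rn d) :
    Tendsto (fun n => partialFT M t n ξ) atTop (𝓝 (refinableFT M t ξ)) :=
  (multipliable_refinable hM ht ht0 ξ).hasProd.tendsto_prod_nat

theorem refinableFT_eq (hM : IsDilation M) (ht : IsTrigPoly t) (ht0 : t 0 = 1) (ξ : Rn d) :
    refinableFT M t ξ = t (transInvAct M ξ) * refinableFT M t (transInvAct M ξ) := by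
  have h1 := (tendsto_partialFT hM ht ht0 ξ).comp (tendsto_add_atTop_nat 1)
  refine tendsto_nhds_unique h1 ?_
  simp only [Function.comp_def, partialFT_succ]
  exact (tendsto_partialFT hM ht ht0 _).const_mul _

/-- The estimate |∏(1 + a_j) - 1| ≤ exp(∑|a_j|) - 1 is uniform over the partial products, and ∑|a_j|
is of order ‖ξ‖ because the factors approach 1 geometrically. -/
theorem tendsto_refinableFT_zero (hM : IsDilation M) (ht : IsTrigPoly t) (ht0 : t 0 = 1) :
    Tendsto (refinableFT M t) (𝓝 0) (𝓝 1) := by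
  obtain ⟨L, ρ, hL, hρ0, hρ1, h⟩ := exists_summable_bound hM ht ht0
  have hb : ∀ ξ, ‖refinableFT M t ξ - 1‖ ≤ Real.exp ((1 - ρ)⁻¹ * (L * ‖ξ‖)) - 1 := by
    intro ξ
    refine le_of_tendsto ((tendsto_partialFT hM ht ht0 ξ).sub_const 1).norm
      (Eventually.of_forall fun n => ?_)
    have h1 := Finset.norm_prod_one_add_sub_one_le (Finset.range n)
      fun j => t ((transInvAct M)^[j + 1] ξ) - 1
    simp only [add_sub_cancel] at h1
    refine h1.trans (sub_le_sub_right (Real.exp_le_exp.mpr ?_) 1)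
    refine (Finset.sum_le_sum fun j _ => h ξ j).trans ?_
    rw [← Finset.sum_mul]
    refine mul_le_mul_of_nonneg_right ?_ (by positivity)
    rw [← tsum_geometric_of_lt_one hρ0.le hρ1]
    exact (summable_geometric_of_lt_one hρ0.le hρ1).sum_le_tsum _ fun _ _ => by positivity
  rw [tendsto_iff_norm_sub_tendsto_zero]
  refine squeeze_zero (fun _ => norm_nonneg _) hb ?_
  have h2 : Continuous fun ξ : Rn d => Real.exp ((1 - ρ)⁻¹ * (L * ‖ξ‖)) - 1 := by fun_prop
  simpa using h2.tendsto 0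

/-- The partial products grow at most polynomially, uniformly. -/
theorem exists_norm_partialFT_le (hM : IsDilation M) (ht : IsTrigPoly t) (ht0 : t 0 = 1) :
    ∃ (C : ℝ) (N : ℕ), 0 < C ∧ ∀ n ξ, ‖partialFT M t n ξ‖ ≤ (1 + C * ‖ξ‖) ^ N := by
  obtain ⟨q, C, ρ, hq⟩ := hM.exists_isContracted_transInv
  obtain ⟨L, hL, hLt⟩ := ht.norm_sub_le
  obtain ⟨K, hK, hKt⟩ := ht.bounded
  have hρ := hq.pos
  have hρ1 := hq.lt_one
  have hκ : 0 < 1 / ρ - 1 := by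
    rw [sub_pos, lt_div_iff₀ hρ]
    linarith
  obtain ⟨N, hN⟩ := exists_nat_ge (2 * (L + K) / (1 / ρ - 1))
  rw [div_le_iff₀ hκ] at hN
  -- This closes the induction with the weight (1 + q)^N: going from M^{*-1}ξ to ξ enlarges q at
  -- least by the factor 1/ρ, and N was taken so large that the gain in the weight absorbs the
  -- factor t. By Bernoulli's inequality the gain is at least 1 + (L + K)y for y ≤ 1, where t is
  -- within L y of 1, and at least 1 + L + K for y ≥ 1, where the bound K for t is enough.
  have key : ∀ y η, 0 ≤ y → y = q η → ‖t η‖ * (1 + y) ^ N ≤ (1 + y / ρ) ^ N := by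
    intro y η hy hyq
    have h1 : (1 + y / ρ) = (1 + (1 / ρ - 1) * (y / (1 + y))) * (1 + y) := by
      field_simp
      ring
    rw [h1, mul_pow]
    refine mul_le_mul_of_nonneg_right ?_ (by positivity)
    have h2 := one_add_mul_le_pow (a := (1 / ρ - 1) * (y / (1 + y)))
      (by have : 0 ≤ (1 / ρ - 1) * (y / (1 + y)) := by positivity
          linarith) N
    refine le_trans ?_ h2
    rw [← mul_assoc]
    rcases le_total y 1 with hy1 | hy1
    · have h3 : ‖t η‖ ≤ 1 + L * y := by
        have h4 := norm_add_le (t η - t 0) (t 0)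
        rw [sub_add_cancel, ht0, norm_one] at h4
        have h5 := hLt η
        have h6 : L * ‖η‖ ≤ L * y := mul_le_mul_of_nonneg_left (hyq ▸ hq.norm_le η) hL.le
        rw [ht0] at h5
        linarith
      have h4 : y / 2 ≤ y / (1 + y) := by
        apply div_le_div_of_nonneg_left hy (by positivity) (by linarith)
      have h5 : 2 * (L + K) * (y / 2) ≤ N * (1 / ρ - 1) * (y / (1 + y)) :=
        mul_le_mul hN h4 (by positivity) (by positivity)
      nlinarith
    · have h4 : 1 / 2 ≤ y / (1 + y) := by
        rw [div_le_div_iff₀ (by norm_num) (by positivity)]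
        linarith
      have h5 : 2 * (L + K) * (1 / 2) ≤ N * (1 / ρ - 1) * (y / (1 + y)) :=
        mul_le_mul hN h4 (by positivity) (by positivity)
      linarith [hKt η]
  have main : ∀ n ξ, ‖partialFT M t n ξ‖ ≤ (1 + q ξ) ^ N := by
    intro n
    induction n with
    | zero =>
      intro ξ
      simp only [partialFT, Finset.range_zero, Finset.prod_empty, norm_one]
      exact one_le_pow₀ (by linarith [hq.nonneg ξ])
    | succ n ih =>
      intro ξ
      rw [partialFT_succ, norm_mul]
      have h1 : q (transInvAct M ξ) / ρ ≤ q ξ := by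
        rw [div_le_iff₀ hρ, mul_comm]
        exact hq.act_le ξ
      calc ‖t (transInvAct M ξ)‖ * ‖partialFT M t n (transInvAct M ξ)‖
          ≤ ‖t (transInvAct M ξ)‖ * (1 + q (transInvAct M ξ)) ^ N := by gcongr; exact ih _
        _ ≤ (1 + q (transInvAct M ξ) / ρ) ^ N := key _ _ (hq.nonneg _) rfl
        _ ≤ _ := by
          have := hq.nonneg (transInvAct M ξ)
          gcongr
  refine ⟨C, N, hq.const_pos, fun n ξ => (main n ξ).trans ?_⟩
  have := hq.nonneg ξ
  gcongr
  exact hq.le_norm ξ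

/-- The frequencies of the partial products stay in a bounded set. -/
theorem exists_partialFT_mem_span (hM : IsDilation M) (ht : IsTrigPoly t) :
    ∃ R : ℝ, 0 ≤ R ∧ ∀ n, partialFT M t n ∈ Submodule.span ℂ (chr '' {x : Rn d | ‖x‖ ≤ R}) := by
  obtain ⟨q, C, ρ, hq⟩ := hM.exists_isContracted_inv
  obtain ⟨h, hh⟩ := ht
  have hρ := hq.pos
  have hρ1 : 0 < 1 - ρ := by linarith [hq.lt_one]
  set L := ∑ l ∈ h.support, q (intVec l) with hL
  have hL0 : 0 ≤ L := Finset.sum_nonneg fun l _ => hq.nonneg _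
  -- One more factor replaces a frequency x by M^{-1}(l + x) with q(l) ≤ L. The radius R is the
  -- fixed point of R = ρ(L + R), so the ball is preserved.
  set R := ρ * L / (1 - ρ) with hR
  have hR0 : 0 ≤ R := by positivity
  have hfix : ρ * (L + R) = R := by
    rw [hR]
    field_simp
    ring
  have hchr : ∀ a ξ : Rn d, chr a (transInvAct M ξ) = chr (act (realMat M)⁻¹ a) ξ := fun a ξ =>
    chr_transInvAct M a ξ
  have main : ∀ n, partialFT M t n ∈ Submodule.span ℂ (chr '' {x : Rn d | q x ≤ R}) := by
    intro n
    induction n with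
    | zero =>
      refine Submodule.subset_span ⟨0, ?_, ?_⟩
      · have := hq.le_norm 0
        rw [norm_zero, mul_zero] at this
        exact this.trans hR0
      · funext ξ
        simp [partialFT, chr_zero_left]
    | succ n ih =>
      have h1 : partialFT M t (n + 1) = fun ξ => t (transInvAct M ξ) *
          partialFT M t n (transInvAct M ξ) := funext fun ξ => partialFT_succ n ξ
      rw [h1]
      generalize partialFT M t n = p at ih
      induction ih using Submodule.span_induction with
      | mem p hp =>
        obtain ⟨x, hx, rfl⟩ := hp
        have h2 : (fun ξ => t (transInvAct M ξ) * chr x (transInvAct M ξ)) =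
            ∑ l ∈ h.support, h l • chr (act (realMat M)⁻¹ (intVec l + x)) := by
          funext ξ
          rw [hh, Finsupp.sum, Finset.sum_mul, Finset.sum_apply]
          refine Finset.sum_congr rfl fun l _ => ?_
          rw [mul_assoc, ← chr_add_left, hchr]
          rfl
        rw [h2]
        refine Submodule.sum_mem _ fun l hl => Submodule.smul_mem _ _ (Submodule.subset_span
          ⟨_, ?_, rfl⟩)
        have h3 : q (intVec l) ≤ L :=
          Finset.single_le_sum (f := fun l => q (intVec l)) (fun l _ => hq.nonneg _) hl
        calc q (act (realMat M)⁻¹ (intVec l + x)) ≤ ρ * q (intVec l + x) := hq.act_le _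
          _ ≤ ρ * (L + R) := by
            refine mul_le_mul_of_nonneg_left ((hq.add_le _ _).trans (add_le_add h3 hx)) hρ.le
          _ = R := hfix
      | zero =>
        simp only [Pi.zero_apply, mul_zero]
        exact Submodule.zero_mem _
      | add p p' _ _ hp hp' =>
        simp only [Pi.add_apply, mul_add]
        exact Submodule.add_mem _ hp hp'
      | smul a p _ hp =>
        simp only [Pi.smul_apply, smul_eq_mul, mul_left_comm]
        exact Submodule.smul_mem _ a hp
  exact ⟨R, hR0, fun n => Submodule.span_mono
    (Set.image_mono fun x hx => (hq.norm_le x).trans hx) (main n)⟩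

end Product

end

section

/-! ### The refinement equation -/

variable {d : ℕ} {M : Matrix (Fin d) (Fin d) ℤ}

theorem abs_det_realMat (M : Matrix (Fin d) (Fin d) ℤ) : |(realMat M).det| = mdet M := by
  rw [realMat_det, mdet, ← Int.cast_abs, Nat.cast_natAbs]

theorem transInvAct_eq (M : Matrix (Fin d) (Fin d) ℤ) (ξ : Rn d) :
    transInvAct M ξ = act ((realMat M)⁻¹)ᵀ ξ := by
  rw [Matrix.transpose_nonsing_inv, transInvAct]

/-- The operator `f ↦ m ∑ h_l f(M · + l)`. -/
def maskOp (hM : IsDilation M) (h : (Fin d → ℤ) →₀ ℂ) : L2 d →ₗ[ℂ] L2 d :=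
  ∑ l ∈ h.support, (sqrtm M * h l) •
    ((dil (realMat M) hM.det_ne_zero).toLinearMap ∘ₗ (tr (intVec l)).toLinearMap)

theorem maskOp_apply (hM : IsDilation M) (h : (Fin d → ℤ) →₀ ℂ) (f : L2 d) :
    maskOp hM h f =
      ∑ l ∈ h.support, (sqrtm M * h l) • dil (realMat M) hM.det_ne_zero (tr (intVec l) f) := by
  simp [maskOp]

theorem ae_sum {ι : Type*} (s : Finset ι) (g : ι → L2 d) (u : ι → Rn d → ℂ)
    (h : ∀ i ∈ s, g i =ᵐ[volume] u i) :
    (∑ i ∈ s, g i : L2 d) =ᵐ[volume] fun x => ∑ i ∈ s, u i x := by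
  classical
  induction s using Finset.induction_on with
  | empty =>
    simp only [Finset.sum_empty]
    exact Lp.coeFn_zero _ _ _
  | insert i s hi ih =>
    rw [Finset.sum_insert hi]
    filter_upwards [Lp.coeFn_add (g i) (∑ j ∈ s, g j), h i (Finset.mem_insert_self _ _),
      ih fun j hj => h j (Finset.mem_insert_of_mem hj)] with x h1 h2 h3
    rw [h1, Pi.add_apply, h2, h3, Finset.sum_insert hi]

/-- On the Fourier side `maskOp` is multiplication by the mask followed by the dilation, the factor
`sqrtm M` cancelling the normalization of `dil`. Thus wavelets are images of φ under such operators,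
which settles their membership in L_2, and φ itself is a fixed point. -/
theorem fourier_maskOp (hM : IsDilation M) {h : (Fin d → ℤ) →₀ ℂ} {t : Rn d → ℂ}
    (ht : ∀ ξ, t ξ = h.sum fun k a => a * chr (intVec k) ξ) {f : L2 d} {F : Rn d → ℂ}
    (hf : (𝓕 f : L2 d) =ᵐ[volume] F) :
    (𝓕 (maskOp hM h f) : L2 d) =ᵐ[volume] fun ξ => t (transInvAct M ξ) * F (transInvAct M ξ) := by
  have hdet := det_inv_transpose_ne_zero hM.det_ne_zero
  have h1 : (𝓕 (maskOp hM h f) : L2 d) = ∑ l ∈ h.support,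
      (sqrtm M * h l) • dil ((realMat M)⁻¹)ᵀ hdet (modul (intVec l) (𝓕 f)) := by
    change Lp.fourierTransformₗᵢ (Rn d) ℂ (maskOp hM h f) = _
    rw [maskOp_apply, map_sum]
    refine Finset.sum_congr rfl fun l _ => ?_
    rw [map_smul]
    change (sqrtm M * h l) • (𝓕 (dil (realMat M) hM.det_ne_zero (tr (intVec l) f)) : L2 d) = _
    rw [fourier_dil, fourier_tr]
  have h2 : ∀ l ∈ h.support, ((sqrtm M * h l) • dil ((realMat M)⁻¹)ᵀ hdet
      (modul (intVec l) (𝓕 f)) : L2 d) =ᵐ[volume] fun ξ =>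
        h l * chr (intVec l) (transInvAct M ξ) * F (transInvAct M ξ) := by
    intro l _
    filter_upwards [Lp.coeFn_smul (sqrtm M * h l) (dil ((realMat M)⁻¹)ᵀ hdet
      (modul (intVec l) (𝓕 f))), coeFn_dil hdet (modul (intVec l) (𝓕 f)),
      (quasiMeasurePreserving_act hdet).ae_eq_comp (coeFn_modul (intVec l) (𝓕 f)),
      (quasiMeasurePreserving_act hdet).ae_eq_comp hf] with ξ h1 h2 h3 h4
    simp only [Function.comp_apply] at h3 h4
    rw [h1, Pi.smul_apply, smul_eq_mul, h2, h3, h4, ← transInvAct_eq, Matrix.det_transpose,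
      Matrix.det_nonsing_inv, Ring.inverse_eq_inv', abs_inv, abs_det_realMat, Real.sqrt_inv,
      Complex.ofReal_inv]
    have := hM.sqrtm_ne_zero
    rw [sqrtm] at this ⊢
    field_simp
  rw [h1]
  filter_upwards [ae_sum h.support _ _ h2] with ξ h3
  rw [h3, ht, Finsupp.sum, Finset.sum_mul]

theorem maskOp_eq_self (hM : IsDilation M) {h : (Fin d → ℤ) →₀ ℂ} {t : Rn d → ℂ}
    (ht : ∀ ξ, t ξ = h.sum fun k a => a * chr (intVec k) ξ) (ht0 : t 0 = 1) {φ : L2 d}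
    (hφ : IsRefinableL2 M t φ) : maskOp hM h φ = φ := by
  refine fourier_injective_L2 (Lp.ext ?_)
  filter_upwards [fourier_maskOp hM ht hφ, hφ] with ξ h1 h2
  rw [h1, h2, refinableFT_eq hM ⟨h, ht⟩ ht0 ξ]

/-! ### Refinable functions have compact support -/

theorem integral_conj_fourier_mul_chr (g : SchwartzMap (Rn d) ℂ) (x : Rn d) :
    ∫ ξ, starRingEnd ℂ ((𝓕 g) ξ) * chr x ξ = starRingEnd ℂ (g (-x)) := by
  have h1 : g (-x) = (𝓕⁻ (𝓕 g) : SchwartzMap (Rn d) ℂ) (-x) := by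
    rw [FourierTransform.fourierInv_fourier_eq]
  rw [h1, SchwartzMap.fourierInv_coe, fourierInv_eq_chr, ← integral_conj]
  refine integral_congr_ae (Eventually.of_forall fun ξ => ?_)
  simp only [map_mul]
  rw [← chr_neg_left, neg_neg, mul_comm]

/-- A combination of characters with frequencies in a ball is the transform of a discrete measure on
that ball, so it pairs to zero with the transform of a function vanishing there. -/
theorem integral_conj_fourier_mul_span {R : ℝ} (g : SchwartzMap (Rn d) ℂ)
    (hg : ∀ x, ‖x‖ ≤ R → g x = 0) {p : Rn d → ℂ}
    (hp : p ∈ Submodule.span ℂ (chr '' {x : Rn d | ‖x‖ ≤ R})) :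
    Integrable (fun ξ => starRingEnd ℂ ((𝓕 g) ξ) * p ξ) ∧
      ∫ ξ, starRingEnd ℂ ((𝓕 g) ξ) * p ξ = 0 := by
  induction hp using Submodule.span_induction with
  | mem p hp =>
    obtain ⟨x, hx, rfl⟩ := hp
    refine ⟨?_, ?_⟩
    · refine Integrable.mono' (𝓕 g).integrable.norm ?_ (Eventually.of_forall fun ξ => ?_)
      · exact ((Complex.continuous_conj.comp (𝓕 g).continuous).mul
          (continuous_chr x)).aestronglyMeasurable
      · rw [norm_mul, norm_chr, mul_one, RCLike.norm_conj]
    · rw [integral_conj_fourier_mul_chr, hg (-x) (by rwa [norm_neg]), map_zero]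
  | zero => simp
  | add p p' _ _ h h' =>
    have e : (fun ξ => starRingEnd ℂ ((𝓕 g) ξ) * (p + p') ξ) =
        fun ξ => starRingEnd ℂ ((𝓕 g) ξ) * p ξ + starRingEnd ℂ ((𝓕 g) ξ) * p' ξ := by
      funext ξ
      rw [Pi.add_apply, mul_add]
    rw [e]
    exact ⟨h.1.add h'.1, by rw [integral_add h.1 h'.1, h.2, h'.2, add_zero]⟩
  | smul a p _ h =>
    have e : (fun ξ => starRingEnd ℂ ((𝓕 g) ξ) * (a • p) ξ) =
        fun ξ => a * (starRingEnd ℂ ((𝓕 g) ξ) * p ξ) := by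
      funext ξ
      rw [Pi.smul_apply, smul_eq_mul]
      ring
    rw [e]
    exact ⟨h.1.const_mul a, by rw [integral_const_mul, h.2, mul_zero]⟩

theorem continuous_transInvAct (M : Matrix (Fin d) (Fin d) ℤ) : Continuous (transInvAct M) :=
  continuous_act _

theorem continuous_partialFT {t : Rn d → ℂ} (ht : IsTrigPoly t) (n : ℕ) :
    Continuous (partialFT M t n) :=
  continuous_finsetProd _ fun j _ => ht.continuous.comp ((continuous_transInvAct M).iterate (j + 1))

/-- A weak Paley–Wiener theorem. The pairing of φ with a test function supported off the ball is, by
Plancherel, a limit of pairings with partial products, all of which vanish. The uniform polynomial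
bound against the decay of a Schwartz function justifies dominated convergence. -/
theorem exists_ae_eq_zero_of_norm_gt (hM : IsDilation M) {t : Rn d → ℂ} (ht : IsTrigPoly t)
    (ht0 : t 0 = 1) {φ : L2 d} (hφ : IsRefinableL2 M t φ) :
    ∃ R : ℝ, 0 ≤ R ∧ ∀ᵐ x, R < ‖x‖ → φ x = 0 := by
  obtain ⟨R, hR, hspan⟩ := exists_partialFT_mem_span hM ht
  obtain ⟨C, N, hC, hbound⟩ := exists_norm_partialFT_le hM ht ht0
  refine ⟨R, hR, ?_⟩
  have hopen : IsOpen {x : Rn d | R < ‖x‖} := isOpen_lt continuous_const continuous_norm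
  have hloc : LocallyIntegrable (φ : Rn d → ℂ) volume :=
    (Lp.memLp φ).locallyIntegrable (by norm_num)
  refine hopen.ae_eq_zero_of_integral_contDiff_smul_eq_zero (hloc.locallyIntegrableOn _) ?_
  intro g hg hgc hgs
  have hgc' : HasCompactSupport fun x => (g x : ℂ) := hgc.comp_left (g := Complex.ofReal) (by simp)
  set G : SchwartzMap (Rn d) ℂ := hgc'.toSchwartzMap (Complex.ofRealCLM.contDiff.comp hg) with hG
  have hGx : ∀ x, G x = (g x : ℂ) := fun x => rfl
  have hG0 : ∀ x, ‖x‖ ≤ R → G x = 0 := by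
    intro x hx
    rw [hGx, image_eq_zero_of_notMem_tsupport fun h => (not_lt.mpr hx) (hgs h), Complex.ofReal_zero]
  have h1 : inner ℂ (G.toLp 2 : L2 d) φ = ∫ x, g x • φ x := by
    rw [L2.inner_def]
    refine integral_congr_ae ?_
    filter_upwards [G.coeFn_toLp 2] with x hx
    rw [hx, hGx, RCLike.inner_apply, Complex.conj_ofReal, mul_comm, Complex.real_smul]
  rw [← h1, ← Lp.inner_fourier_eq, SchwartzMap.toLp_fourier_eq, L2.inner_def]
  have h2 : ∫ ξ, inner ℂ (((𝓕 G).toLp 2 : L2 d) ξ) ((𝓕 φ : L2 d) ξ) =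
      ∫ ξ, starRingEnd ℂ ((𝓕 G) ξ) * refinableFT M t ξ := by
    refine integral_congr_ae ?_
    filter_upwards [(𝓕 G).coeFn_toLp 2, hφ] with ξ h2 h3
    rw [h2, h3, RCLike.inner_apply, mul_comm]
  rw [h2]
  have hint : Integrable (fun ξ => ‖(𝓕 G) ξ‖ * (1 + C * ‖ξ‖) ^ N) := by
    have h3 := ((𝓕 G).integrable_pow_mul volume 0).const_mul (2 ^ (N - 1))
    have h4 := ((𝓕 G).integrable_pow_mul volume N).const_mul (2 ^ (N - 1) * C ^ N)
    refine Integrable.mono' (h3.add h4) ?_ (Eventually.of_forall fun ξ => ?_)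
    · exact ((𝓕 G).continuous.norm.mul (by fun_prop)).aestronglyMeasurable
    · rw [Real.norm_of_nonneg (by positivity), Pi.add_apply]
      have := add_pow_le zero_le_one (by positivity : 0 ≤ C * ‖ξ‖) N
      calc ‖(𝓕 G) ξ‖ * (1 + C * ‖ξ‖) ^ N
          ≤ ‖(𝓕 G) ξ‖ * (2 ^ (N - 1) * (1 ^ N + (C * ‖ξ‖) ^ N)) := by gcongr
        _ = _ := by
          rw [one_pow, mul_pow, pow_zero]
          ring
  have hlim : Tendsto (fun n => ∫ ξ, starRingEnd ℂ ((𝓕 G) ξ) * partialFT M t n ξ) atTop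
      (𝓝 (∫ ξ, starRingEnd ℂ ((𝓕 G) ξ) * refinableFT M t ξ)) := by
    refine tendsto_integral_of_dominated_convergence _ (fun n => ?_) hint (fun n => ?_)
      (Eventually.of_forall fun ξ => ?_)
    · exact ((Complex.continuous_conj.comp (𝓕 G).continuous).mul
        (continuous_partialFT ht n)).aestronglyMeasurable
    · refine Eventually.of_forall fun ξ => ?_
      rw [norm_mul, RCLike.norm_conj]
      exact mul_le_mul_of_nonneg_left (hbound n ξ) (norm_nonneg _)
    · exact (tendsto_partialFT hM ht ht0 ξ).const_mul _
  simp_rw [fun n => (integral_conj_fourier_mul_span G hG0 (hspan n)).2] at hlim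
  exact tendsto_nhds_unique hlim tendsto_const_nhds

end

section

/-! ### Gram sequences of integer translates -/

variable {d : ℕ} {M : Matrix (Fin d) (Fin d) ℤ}

/-- `f` vanishes outside the ball of radius `R`. -/
def SuppIn (R : ℝ) (f : L2 d) : Prop := ∀ᵐ x, R < ‖x‖ → f x = 0

theorem SuppIn.inner_tr_eq_zero {R : ℝ} {f g : L2 d} (hf : SuppIn R f) (hg : SuppIn R g) {b : Rn d}
    (hb : 2 * R < ‖b‖) : inner ℂ f (tr b g) = 0 := by
  rw [L2.inner_def]
  refine integral_eq_zero_of_ae ?_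
  filter_upwards [hf, coeFn_tr b g, (quasiMeasurePreserving_add b).ae hg] with x h1 h2 h3
  rw [h2, Pi.zero_apply]
  by_cases h4 : R < ‖x‖
  · rw [h1 h4, inner_zero_left]
  · rw [h3, inner_zero_right]
    have h5 : ‖b‖ ≤ ‖x + b‖ + ‖x‖ := by
      have := norm_sub_le (x + b) x
      rwa [add_sub_cancel_left] at this
    linarith

/-- The integer vectors with entries of modulus at most `r`. -/
def intBox (d : ℕ) (r : ℝ) : Finset (Fin d → ℤ) :=
  Fintype.piFinset fun _ => Finset.Icc (-⌈r⌉) ⌈r⌉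

theorem norm_gt_of_notMem_intBox {r : ℝ} {k : Fin d → ℤ} (hk : k ∉ intBox d r) :
    r < ‖intVec k‖ := by
  contrapose! hk
  refine Fintype.mem_piFinset.mpr fun j => ?_
  have h1 : |(k j : ℝ)| ≤ r := (PiLp.norm_apply_le (intVec k) j).trans hk
  rw [abs_le] at h1
  have h2 := Int.le_ceil r
  rw [Finset.mem_Icc]
  constructor
  · have : (-⌈r⌉ : ℝ) ≤ k j := by linarith
    exact_mod_cast this
  · have : (k j : ℝ) ≤ ⌈r⌉ := by linarith
    exact_mod_cast this

/-- The Gram sequence of the integer translates of `f`. -/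
def gram (f : L2 d) (k : Fin d → ℤ) : ℂ := inner ℂ f (tr (intVec k) f)

theorem inner_tr_tr (f : L2 d) (k l : Fin d → ℤ) :
    inner ℂ (tr (intVec k) f) (tr (intVec l) f) = gram f (l - k) := by
  rw [inner_tr_left, tr_tr, gram, intVec_sub, neg_add_eq_sub]

theorem SuppIn.gram_eq_zero {R : ℝ} {f : L2 d} (hf : SuppIn R f) {k : Fin d → ℤ}
    (hk : k ∉ intBox d (2 * R)) : gram f k = 0 :=
  hf.inner_tr_eq_zero hf (norm_gt_of_notMem_intBox hk)

theorem SuppIn.isBessel {R : ℝ} {f : L2 d} (hf : SuppIn R f) :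
    IsBessel (fun k => tr (intVec k) f) (∑ u ∈ intBox d (2 * R), ‖gram f u‖) :=
  isBessel_of_gram (inner_tr_tr f) _ fun _ hu => hf.gram_eq_zero hu

theorem norm_gram_le (f : L2 d) (k : Fin d → ℤ) : ‖gram f k‖ ≤ ‖f‖ ^ 2 := by
  rw [sq]
  refine (norm_inner_le_norm _ _).trans (le_of_eq ?_)
  rw [LinearIsometry.norm_map]

theorem tr_maskOp (hM : IsDilation M) (h : (Fin d → ℤ) →₀ ℂ) (b : Rn d) (f : L2 d) :
    tr b (maskOp hM h f) = maskOp hM h (tr (act (realMat M) b) f) := by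
  simp only [maskOp_apply, map_sum, map_smul, tr_dil]
  simp only [tr_comm (act (realMat M) b)]

/-- The Gram sequence of `maskOp h f` is obtained from that of `f` by a fixed finite filter. -/
theorem gram_maskOp (hM : IsDilation M) (h : (Fin d → ℤ) →₀ ℂ) (f : L2 d) (k : Fin d → ℤ) :
    gram (maskOp hM h f) k = ∑ l ∈ h.support, ∑ l' ∈ h.support,
      starRingEnd ℂ (sqrtm M * h l) * (sqrtm M * h l') * gram f (M *ᵥ k + l' - l) := by
  rw [gram, tr_maskOp, maskOp_apply, maskOp_apply, sum_inner]
  refine Finset.sum_congr rfl fun l _ => ?_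
  rw [inner_sum]
  refine Finset.sum_congr rfl fun l' _ => ?_
  rw [inner_smul_left, inner_smul_right, LinearIsometry.inner_map_map, act_realMat_intVec, tr_tr,
    ← intVec_add, inner_tr_tr, add_comm l']
  ring

/-! ### Decay of difference operators applied to a refinable function -/

/-- The operator `f ↦ ∑ conj(a_i) f(· - M^{-n} i)`. -/
def diffOp (M : Matrix (Fin d) (Fin d) ℤ) (a : (Fin d → ℤ) →₀ ℂ) (n : ℕ) : L2 d →ₗ[ℂ] L2 d :=
  ∑ i ∈ a.support, starRingEnd ℂ (a i) • (tr (-act ((realMat M)⁻¹ ^ n) (intVec i))).toLinearMap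

theorem diffOp_apply (a : (Fin d → ℤ) →₀ ℂ) (n : ℕ) (f : L2 d) :
    diffOp M a n f =
      ∑ i ∈ a.support, starRingEnd ℂ (a i) • tr (-act ((realMat M)⁻¹ ^ n) (intVec i)) f := by
  simp [diffOp]

theorem diffOp_tr (a : (Fin d → ℤ) →₀ ℂ) (n : ℕ) (b : Rn d) (f : L2 d) :
    diffOp M a n (tr b f) = tr b (diffOp M a n f) := by
  simp only [diffOp_apply, map_sum, map_smul]
  exact Finset.sum_congr rfl fun i _ => by rw [tr_comm]

/-- A translation that passes through the dilation has its step multiplied by M. For φ fixed by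
`maskOp` the differences at successive scales are therefore iterates of one operator. -/
theorem diffOp_maskOp (hM : IsDilation M) (a h : (Fin d → ℤ) →₀ ℂ) (n : ℕ) (f : L2 d) :
    diffOp M a (n + 1) (maskOp hM h f) = maskOp hM h (diffOp M a n f) := by
  simp only [diffOp_apply, map_sum, map_smul, tr_maskOp]
  refine Finset.sum_congr rfl fun i _ => ?_
  rw [act_neg, pow_succ', act_mul, act_act_inv hM.det_ne_zero]

theorem ae_smul_eq_zero {c : ℂ} {g : L2 d} {p : Rn d → Prop} (h : ∀ᵐ x, p x → g x = 0) :
    ∀ᵐ x, p x → (c • g : L2 d) x = 0 := by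
  filter_upwards [h, Lp.coeFn_smul c g] with x h1 h2 hp
  rw [h2, Pi.smul_apply, h1 hp, smul_zero]

theorem ae_sum_eq_zero {ι : Type*} (s : Finset ι) (g : ι → L2 d) {p : Rn d → Prop}
    (h : ∀ i ∈ s, ∀ᵐ x, p x → g i x = 0) : ∀ᵐ x, p x → (∑ i ∈ s, g i : L2 d) x = 0 := by
  have h1 : ∀ᵐ x, ∀ i ∈ s, p x → g i x = 0 := (Finset.eventually_all s).mpr h
  filter_upwards [h1, ae_sum s g (fun i => g i) fun i _ => ae_eq_refl _] with x h2 h3 hp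
  rw [h3]
  exact Finset.sum_eq_zero fun i hi => h2 i hi hp

/-- The steps M^{-n}i are bounded uniformly in n. A common support confines all Gram sequences to
one finite-dimensional space. -/
theorem exists_suppIn_diffOp (hM : IsDilation M) (a : (Fin d → ℤ) →₀ ℂ) {R : ℝ} {f : L2 d}
    (hf : SuppIn R f) : ∃ R', ∀ n, SuppIn R' (diffOp M a n f) := by
  obtain ⟨q, C, ρ, hq⟩ := hM.exists_isContracted_inv
  refine ⟨R + ∑ i ∈ a.support, C * ‖intVec i‖, fun n => ?_⟩
  rw [diffOp_apply]
  refine ae_sum_eq_zero _ _ fun i hi => ae_smul_eq_zero ?_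
  set b := -act ((realMat M)⁻¹ ^ n) (intVec i) with hb
  filter_upwards [coeFn_tr b f, (quasiMeasurePreserving_add b).ae hf] with x h1 h2 hx
  rw [h1]
  refine h2 ?_
  have h3 : ‖b‖ ≤ C * ‖intVec i‖ := by
    rw [hb, norm_neg, act_pow]
    refine (hq.norm_iterate_le n _).trans ?_
    have : 0 ≤ C * ‖intVec i‖ := mul_nonneg hq.const_pos.le (norm_nonneg _)
    exact mul_le_of_le_one_left this (pow_le_one₀ hq.pos.le hq.lt_one.le)
  have h4 : C * ‖intVec i‖ ≤ ∑ i ∈ a.support, C * ‖intVec i‖ :=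
    Finset.single_le_sum (f := fun i => C * ‖intVec i‖)
      (fun i _ => mul_nonneg hq.const_pos.le (norm_nonneg _)) hi
  have h5 : ‖x‖ ≤ ‖x + b‖ + ‖b‖ := by
    have := norm_sub_le (x + b) b
    rwa [add_sub_cancel_right] at this
  linarith

/-- As the steps shrink to 0, strong continuity of translations turns the operator into
multiplication by the conjugate of the coefficient sum, which is 0. No rate is obtained here. -/
theorem tendsto_diffOp (hM : IsDilation M) {a : (Fin d → ℤ) →₀ ℂ} (ha : a.sum (fun _ c => c) = 0)
    (f : L2 d) : Tendsto (fun n => diffOp M a n f) atTop (𝓝 0) := by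
  obtain ⟨q, C, ρ, hq⟩ := hM.exists_isContracted_inv
  have h1 : ∀ i : Fin d → ℤ,
      Tendsto (fun n : ℕ => -act ((realMat M)⁻¹ ^ n) (intVec i)) atTop (𝓝 0) := by
    intro i
    have h0 := (tendsto_pow_atTop_nhds_zero_of_lt_one hq.pos.le hq.lt_one).mul_const
      (C * ‖intVec i‖)
    rw [zero_mul] at h0
    refine squeeze_zero_norm (fun n => ?_) h0
    rw [norm_neg, act_pow]
    exact hq.norm_iterate_le n _
  have h2 : Tendsto (fun n => diffOp M a n f) atTop
      (𝓝 (∑ i ∈ a.support, starRingEnd ℂ (a i) • tr 0 f)) := by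
    simp only [diffOp_apply]
    exact tendsto_finsetSum _ fun i _ =>
      ((continuous_tr f).continuousAt.tendsto.comp (h1 i)).const_smul _
  rw [← Finset.sum_smul, ← map_sum, show ∑ i ∈ a.support, a i = 0 from ha, map_zero, zero_smul]
    at h2
  exact h2

/-- The translates of `diffOp a n φ` have exponentially small Bessel bounds. -/
theorem exists_isBessel_diffOp (hM : IsDilation M) {h a : (Fin d → ℤ) →₀ ℂ}
    (ha : a.sum (fun _ c => c) = 0) {R : ℝ} {φ : L2 d} (hφ : maskOp hM h φ = φ)
    (hR : SuppIn R φ) : ∃ C ρ : ℝ, 0 ≤ C ∧ 0 < ρ ∧ ρ < 1 ∧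
      ∀ n, IsBessel (fun k => tr (intVec k) (diffOp M a n φ)) (C * ρ ^ n) := by
  classical
  obtain ⟨R', hR'⟩ := exists_suppIn_diffOp hM a hR
  set K := intBox d (2 * R')
  have hrec : ∀ n, diffOp M a (n + 1) φ = maskOp hM h (diffOp M a n φ) := fun n => by
    rw [← diffOp_maskOp, hφ]
  -- The transition operator of the filter, cut down to the box `K`. Nothing is lost, since all Gram
  -- sequences in question vanish off `K`.
  let T : (K → ℂ) →ₗ[ℂ] (K → ℂ) :=
    { toFun := fun x k => ∑ l ∈ h.support, ∑ l' ∈ h.support,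
        starRingEnd ℂ (sqrtm M * h l) * (sqrtm M * h l') *
          (if hk : M *ᵥ (k : Fin d → ℤ) + l' - l ∈ K then x ⟨_, hk⟩ else 0)
      map_add' := fun x y => by
        funext k
        simp only [Pi.add_apply, ← Finset.sum_add_distrib]
        refine Finset.sum_congr rfl fun l _ => Finset.sum_congr rfl fun l' _ => ?_
        split_ifs <;> ring
      map_smul' := fun c x => by
        funext k
        simp only [Pi.smul_apply, smul_eq_mul, RingHom.id_apply, Finset.mul_sum]
        refine Finset.sum_congr rfl fun l _ => Finset.sum_congr rfl fun l' _ => ?_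
        split_ifs <;> ring }
  let x : ℕ → K → ℂ := fun n k => gram (diffOp M a n φ) k
  have hx : ∀ n, x (n + 1) = T (x n) := by
    intro n
    funext k
    change gram (diffOp M a (n + 1) φ) k = ∑ l ∈ h.support, ∑ l' ∈ h.support,
      starRingEnd ℂ (sqrtm M * h l) * (sqrtm M * h l') *
        (if hk : M *ᵥ (k : Fin d → ℤ) + l' - l ∈ K then x n ⟨_, hk⟩ else 0)
    simp only [hrec n, gram_maskOp]
    refine Finset.sum_congr rfl fun l _ => Finset.sum_congr rfl fun l' _ => ?_
    congr 1
    split_ifs with hk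
    · rfl
    · exact (hR' n).gram_eq_zero hk
  -- The Gram entries are at most the squared norms of the differences. Convergence without a rate
  -- is enough, since finite dimension upgrades it to geometric decay.
  have hx0 : Tendsto x atTop (𝓝 0) := by
    refine tendsto_pi_nhds.mpr fun k => squeeze_zero_norm (fun n => norm_gram_le _ _) ?_
    simpa using (tendsto_diffOp hM ha φ).norm.pow 2
  obtain ⟨C, ρ, hC, hρ0, hρ1, hb⟩ := exists_geometric_bound_of_tendsto_zero T hx hx0
  refine ⟨K.card * C, ρ, by positivity, hρ0, hρ1, fun n => (hR' n).isBessel.mono ?_⟩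
  rw [mul_assoc, ← nsmul_eq_mul]
  refine Finset.sum_le_card_nsmul _ _ _ fun u hu => ?_
  exact (norm_le_pi_norm (x n) ⟨u, hu⟩).trans (hb n)

/-! ### Dilated systems -/

theorem IsDilation.det_zpow_ne_zero (hM : IsDilation M) (j : ℤ) : (realMat M ^ j).det ≠ 0 :=
  ((isUnit_iff_ne_zero.mpr hM.det_ne_zero).det_zpow j).ne_zero

/-- The unitary operator `f ↦ m^{j/2} f(M^j ·)`. -/
def dilM (hM : IsDilation M) (j : ℤ) : L2 d →ₗᵢ[ℂ] L2 d := dil (realMat M ^ j) (hM.det_zpow_ne_zero j)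

theorem dilM_dilM (hM : IsDilation M) (i j : ℤ) (f : L2 d) :
    dilM hM i (dilM hM j f) = dilM hM (i + j) f := by
  rw [dilM, dilM, dil_dil, dilM]
  refine dil_congr ?_ f
  rw [add_comm, Matrix.zpow_add (isUnit_iff_ne_zero.mpr hM.det_ne_zero)]

theorem dilM_zero (hM : IsDilation M) (f : L2 d) : dilM hM 0 f = f := by
  rw [dilM, dil_congr (zpow_zero _), dil_one]

theorem dilM_one (hM : IsDilation M) (f : L2 d) :
    dilM hM 1 f = dil (realMat M) hM.det_ne_zero f := by
  rw [dilM, dil_congr (zpow_one _)]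

theorem dilM_neg_cancel (hM : IsDilation M) (j : ℤ) (f : L2 d) :
    dilM hM j (dilM hM (-j) f) = f := by
  rw [dilM_dilM, add_neg_cancel, dilM_zero]

theorem inner_dilM_left (hM : IsDilation M) (j : ℤ) (f g : L2 d) :
    inner ℂ (dilM hM j f) g = inner ℂ f (dilM hM (-j) g) := by
  rw [← (dilM hM j).inner_map_map f, dilM_neg_cancel]

theorem tr_dilM (hM : IsDilation M) (j : ℤ) (b : Rn d) (f : L2 d) :
    tr b (dilM hM j f) = dilM hM j (tr (act (realMat M ^ j) b) f) := tr_dil _ b f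

theorem det_zpow_eq (A : Matrix (Fin d) (Fin d) ℝ) (j : ℤ) : (A ^ j).det = A.det ^ j := by
  cases j with
  | ofNat n => simp [Matrix.det_pow]
  | negSucc n => simp [Matrix.det_nonsing_inv, Matrix.det_pow, zpow_negSucc]

theorem sqrt_abs_det_zpow (M : Matrix (Fin d) (Fin d) ℤ) (j : ℤ) :
    √|(realMat M ^ j).det| = (mdet M : ℝ) ^ ((j : ℝ) / 2) := by
  rw [det_zpow_eq, abs_zpow, abs_det_realMat, Real.sqrt_eq_rpow, ← Real.rpow_intCast,
    ← Real.rpow_mul (Nat.cast_nonneg _)]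
  congr 1
  ring

theorem dilShiftL2_eq (hM : IsDilation M) (j : ℤ) (k : Fin d → ℤ) (f : L2 d) :
    dilShiftL2 hM j k f = dilM hM j (tr (intVec k) f) := by
  refine Lp.ext ?_
  filter_upwards [(memLp_dilShift hM j k f).coeFn_toLp,
    coeFn_dil (hM.det_zpow_ne_zero j) (tr (intVec k) f),
    (quasiMeasurePreserving_act (hM.det_zpow_ne_zero j)).ae_eq_comp (coeFn_tr (intVec k) f)]
    with x h1 h2 h3
  simp only [Function.comp_apply] at h3
  rw [dilShiftL2, h1, dilM, h2, h3, sqrt_abs_det_zpow, dilShift]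

theorem tr_intVec_maskOp (hM : IsDilation M) (a : (Fin d → ℤ) →₀ ℂ) (k : Fin d → ℤ) (f : L2 d) :
    tr (intVec k) (maskOp hM a f) =
      ∑ i ∈ a.support, (sqrtm M * a i) • dilM hM 1 (tr (intVec (M *ᵥ k + i)) f) := by
  rw [tr_maskOp, maskOp_apply]
  refine Finset.sum_congr rfl fun i _ => ?_
  rw [dilM_one, act_realMat_intVec, tr_tr, ← intVec_add, add_comm i]

theorem mulVec_injective_of_isDilation (hM : IsDilation M) :
    Function.Injective fun k : Fin d → ℤ => M *ᵥ k := by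
  intro x y hxy
  by_contra hne
  exact hM.intDet_ne_zero (Matrix.exists_mulVec_eq_zero_iff.mp ⟨x - y, sub_ne_zero.mpr hne, by
    rw [Matrix.mulVec_sub]; exact sub_eq_zero.mpr hxy⟩)

theorem norm_sum_smul_le_sqrt {ι : Type*} {g : ι → L2 d} {B : ℝ} (hg : IsBessel g B) (hB : 0 ≤ B)
    (s : Finset ι) (c : ι → ℂ) :
    ‖∑ k ∈ s, c k • g k‖ ≤ √B * √(∑ k ∈ s, ‖c k‖ ^ 2) := by
  rw [← Real.sqrt_mul hB]
  exact Real.le_sqrt_of_sq_le (hg s c)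

/-- The wavelet system generated by a finite combination of fine scale translates of a refinable
function is a Bessel system if the combination has mean zero. -/
theorem exists_isBessel_wavelet (hM : IsDilation M) {h a : (Fin d → ℤ) →₀ ℂ}
    (ha : a.sum (fun _ c => c) = 0) {R : ℝ} {φ : L2 d} (hφ : maskOp hM h φ = φ)
    (hR : SuppIn R φ) : ∃ B, 0 < B ∧ IsBessel
      (fun p : ℤ × (Fin d → ℤ) => dilM hM p.1 (tr (intVec p.2) (maskOp hM a φ))) B := by
  obtain ⟨C, ρ, hC, hρ0, hρ1, hb⟩ := exists_isBessel_diffOp hM ha hφ hR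
  set B₀ := ∑ u ∈ intBox d (2 * R), ‖gram φ u‖ with hB₀
  have hB₀0 : 0 ≤ B₀ := Finset.sum_nonneg fun _ _ => norm_nonneg _
  have hφB : IsBessel (fun k => tr (intVec k) φ) B₀ := hR.isBessel
  set Q := ∑ i ∈ a.support, ‖sqrtm M * a i‖ with hQ
  have hQ0 : 0 ≤ Q := Finset.sum_nonneg fun _ _ => norm_nonneg _
  -- The Bessel bound of the differences decays like ρ^n and norms are controlled by its square
  -- root, hence the ratio √ρ.
  refine isBessel_of_almost_orthogonal (a := fun n => ‖sqrtm M‖ * Q * √C * √B₀ * √ρ ^ n)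
    ((summable_geometric_of_lt_one (Real.sqrt_nonneg _)
      ((Real.sqrt_lt' one_pos).mpr (by simpa using hρ1))).mul_left _)
    (fun n => by positivity) fun j n s c e => ?_
  simp only
  set X := ∑ k ∈ s, c k • tr (intVec k) (maskOp hM a φ) with hX
  set Y := ∑ l ∈ s, e l • dilM hM (n + 1) (tr (intVec (M *ᵥ l)) φ) with hY
  have e1 : ∑ k ∈ s, c k • dilM hM j (tr (intVec k) (maskOp hM a φ)) = dilM hM j X := by
    simp only [hX, map_sum, map_smul]
  have hinv : realMat M ^ ((n : ℤ) + 1) * (realMat M)⁻¹ ^ (n + 1) = 1 := by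
    rw [show ((n : ℤ) + 1) = ((n + 1 : ℕ) : ℤ) by push_cast; rfl, zpow_natCast,
      Matrix.inv_pow', Matrix.mul_nonsing_inv]
    rw [Matrix.det_pow]
    exact (isUnit_iff_ne_zero.mpr hM.det_ne_zero).pow _
  -- The fine side is a superposition, with the filter coefficients, of translates by M^{-(n+1)}i of
  -- the single function `Y`, a combination of translates of φ at the scale n + 1.
  have e2 : ∑ k ∈ s, e k • dilM hM (j + n) (tr (intVec k) (maskOp hM a φ)) =
      dilM hM j (∑ i ∈ a.support,
        (sqrtm M * a i) • tr (act ((realMat M)⁻¹ ^ (n + 1)) (intVec i)) Y) := by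
    simp only [hY, map_sum, map_smul, tr_intVec_maskOp, Finset.smul_sum, smul_smul, dilM_dilM,
      tr_dilM, tr_tr]
    rw [Finset.sum_comm]
    refine Finset.sum_congr rfl fun i _ => Finset.sum_congr rfl fun k _ => ?_
    rw [← act_mul, hinv, act_one, ← intVec_add, add_comm i, mul_comm (e k), add_assoc]
  rw [e1, e2, LinearIsometry.inner_map_map]
  -- By adjunction the filter passes from the fine side to the coarse side, where it becomes a
  -- difference operator of small step.
  have e3 : inner ℂ X (∑ i ∈ a.support,
      (sqrtm M * a i) • tr (act ((realMat M)⁻¹ ^ (n + 1)) (intVec i)) Y) =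
      sqrtm M * inner ℂ (diffOp M a (n + 1) X) Y := by
    rw [diffOp_apply, inner_sum, sum_inner, Finset.mul_sum]
    refine Finset.sum_congr rfl fun i _ => ?_
    rw [inner_smul_left, inner_smul_right, inner_tr_left, neg_neg, Complex.conj_conj, mul_assoc]
  -- The difference operator moves through the refinement and meets φ with index `n`, where the
  -- exponentially small Bessel bound is available.
  have e4 : diffOp M a (n + 1) X = ∑ i ∈ a.support, (sqrtm M * a i) •
      dilM hM 1 (∑ k ∈ s, c k • tr (intVec (M *ᵥ k + i)) (diffOp M a n φ)) := by
    simp only [hX, map_sum, map_smul, diffOp_tr, diffOp_maskOp]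
    simp only [tr_intVec_maskOp, Finset.smul_sum, smul_smul]
    rw [Finset.sum_comm]
    refine Finset.sum_congr rfl fun i _ => Finset.sum_congr rfl fun k _ => ?_
    rw [mul_comm]
  have hXn : ‖diffOp M a (n + 1) X‖ ≤ Q * (√(C * ρ ^ n) * √(∑ k ∈ s, ‖c k‖ ^ 2)) := by
    rw [e4, hQ, Finset.sum_mul]
    refine (norm_sum_le _ _).trans (Finset.sum_le_sum fun i _ => ?_)
    rw [norm_smul, LinearIsometry.norm_map]
    refine mul_le_mul_of_nonneg_left ?_ (norm_nonneg _)
    have hinj : Function.Injective fun k : Fin d → ℤ => M *ᵥ k + i :=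
      (add_left_injective i).comp (mulVec_injective_of_isDilation hM)
    exact norm_sum_smul_le_sqrt ((hb n).comp_injective hinj) (by positivity) s c
  have hYn : ‖Y‖ ≤ √B₀ * √(∑ k ∈ s, ‖e k‖ ^ 2) := by
    have : Y = dilM hM (n + 1) (∑ l ∈ s, e l • tr (intVec (M *ᵥ l)) φ) := by
      simp only [hY, map_sum, map_smul]
    rw [this, LinearIsometry.norm_map]
    exact norm_sum_smul_le_sqrt (hφB.comp_injective (mulVec_injective_of_isDilation hM)) hB₀0 s e
  rw [e3, norm_mul]
  calc ‖sqrtm M‖ * ‖inner ℂ (diffOp M a (n + 1) X) Y‖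
      ≤ ‖sqrtm M‖ * (‖diffOp M a (n + 1) X‖ * ‖Y‖) := by
        gcongr
        exact norm_inner_le_norm _ _
    _ ≤ ‖sqrtm M‖ * (Q * (√(C * ρ ^ n) * √(∑ k ∈ s, ‖c k‖ ^ 2)) *
          (√B₀ * √(∑ k ∈ s, ‖e k‖ ^ 2))) := by gcongr
    _ = _ := by
      have : √(C * ρ ^ n) = √C * √ρ ^ n := by
        rw [Real.sqrt_mul hC, Real.sqrt_eq_rpow (ρ ^ n), Real.sqrt_eq_rpow ρ, ← Real.rpow_natCast,
          ← Real.rpow_natCast, ← Real.rpow_mul hρ0.le, ← Real.rpow_mul hρ0.le, mul_comm (1 / 2 : ℝ)]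
      rw [this]
      ring

end

section

/-! ### One step of the filter bank -/

variable {d : ℕ} {M : Matrix (Fin d) (Fin d) ℤ}

/-- The trigonometric polynomial with given coefficients. -/
def trigSum (a : (Fin d → ℤ) →₀ ℂ) (ξ : Rn d) : ℂ := a.sum fun k c => c * chr (intVec k) ξ

theorem trigSum_injective : Function.Injective (trigSum (d := d)) := by
  intro a b hab
  refine linearIndependent_chr (funext fun ξ => ?_)
  have h : ∀ c : (Fin d → ℤ) →₀ ℂ, (Finsupp.linearCombination ℂ
      (fun k : Fin d → ℤ => (chr (intVec k) : Rn d → ℂ)) c) ξ = trigSum c ξ := fun c => by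
    simp [Finsupp.linearCombination_apply, Finsupp.sum, trigSum]
  rw [h, h, hab]

theorem trigSum_linear (a : (Fin d → ℤ) →₀ ℂ) (ξ : Rn d) :
    trigSum a ξ = Finsupp.linearCombination ℂ (fun k => chr (intVec k) ξ) a := by
  simp [Finsupp.linearCombination_apply, trigSum]

/-- An identity between trigonometric polynomials, applied as a convolution filter. -/
theorem sum_coeff_mul_conj {I : Type*} [Fintype I] (a b : I → (Fin d → ℤ) →₀ ℂ) (δ : ℂ)
    (h : ∀ ξ, ∑ t, trigSum (a t) ξ * starRingEnd ℂ (trigSum (b t) ξ) = δ)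
    (G : (Fin d → ℤ) → ℂ) :
    ∑ t, ∑ r ∈ (a t).support, ∑ r' ∈ (b t).support,
      a t r * starRingEnd ℂ (b t r') * G (r' - r) = δ * G 0 := by
  -- `F` collects the coefficients of the trigonometric polynomial in the hypothesis. Independence
  -- of characters identifies it with the constant δ.
  let F : (Fin d → ℤ) →₀ ℂ := ∑ t, ∑ r ∈ (a t).support, ∑ r' ∈ (b t).support,
    Finsupp.single (r - r') (a t r * starRingEnd ℂ (b t r'))
  have hF : F = Finsupp.single 0 δ := by
    refine trigSum_injective (funext fun ξ => ?_)
    rw [trigSum_linear, trigSum_linear]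
    simp only [F, map_sum, Finsupp.linearCombination_single, intVec_zero, chr_zero_left,
      smul_eq_mul, mul_one]
    rw [← h ξ]
    refine Finset.sum_congr rfl fun t _ => ?_
    rw [trigSum, trigSum, Finsupp.sum, Finsupp.sum, map_sum, Finset.sum_mul_sum]
    refine Finset.sum_congr rfl fun r _ => Finset.sum_congr rfl fun r' _ => ?_
    rw [map_mul, intVec_sub, chr_sub_left, chr_neg_left]
    ring
  -- The weights are G(-u) because the frequencies of `F` are r - r' while the claim evaluates G at
  -- r' - r.
  have := congrArg (Finsupp.linearCombination ℂ fun u => G (-u)) hF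
  simpa only [F, map_sum, Finsupp.linearCombination_single, neg_sub, neg_zero, smul_eq_mul]
    using this

/-- The coefficients of the function assembled from polyphase components with coefficients `a`. -/
def assembleCoeff {I : Type*} [Fintype I] (M : Matrix (Fin d) (Fin d) ℤ) (dig : I → (Fin d → ℤ))
    (a : I → (Fin d → ℤ) →₀ ℂ) : (Fin d → ℤ) →₀ ℂ :=
  ∑ q, ∑ r ∈ (a q).support, Finsupp.single (M *ᵥ r + dig q) (a q r / sqrtm M)

theorem trigSum_assembleCoeff {I : Type} [Fintype I] (dig : I → (Fin d → ℤ))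
    (a : I → (Fin d → ℤ) →₀ ℂ) (ξ : Rn d) :
    trigSum (assembleCoeff M dig a) ξ = assemble M dig (fun q => trigSum (a q)) ξ := by
  rw [trigSum_linear]
  simp only [assembleCoeff, map_sum, Finsupp.linearCombination_single, assemble, trigSum,
    Finsupp.sum, chr_transAct, Finset.mul_sum, intVec_add, chr_add_left, smul_eq_mul]
  refine Finset.sum_congr rfl fun q _ => Finset.sum_congr rfl fun r _ => ?_
  ring

theorem dilM_tr_maskOp_assembleCoeff (hM : IsDilation M) {I : Type*} [Fintype I]
    (dig : I → (Fin d → ℤ)) (a : I → (Fin d → ℤ) →₀ ℂ) (j : ℤ) (k : Fin d → ℤ) (f : L2 d) :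
    dilM hM j (tr (intVec k) (maskOp hM (assembleCoeff M dig a) f)) =
      ∑ q, ∑ r ∈ (a q).support, a q r •
        dilM hM (j + 1) (tr (intVec (M *ᵥ (k + r) + dig q)) f) := by
  have h1 : tr (intVec k) (maskOp hM (assembleCoeff M dig a) f) =
      Finsupp.linearCombination ℂ
        (fun i => sqrtm M • dilM hM 1 (tr (intVec (M *ᵥ k + i)) f)) (assembleCoeff M dig a) := by
    rw [tr_intVec_maskOp, Finsupp.linearCombination_apply, Finsupp.sum]
    refine Finset.sum_congr rfl fun i _ => ?_
    rw [smul_smul, mul_comm]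
  rw [h1]
  simp only [assembleCoeff, map_sum, Finsupp.linearCombination_single, map_smul, dilM_dilM,
    smul_smul]
  refine Finset.sum_congr rfl fun q _ => Finset.sum_congr rfl fun r _ => ?_
  rw [div_mul_cancel₀ _ hM.sqrtm_ne_zero, mulVec_add, add_assoc]

/-- The sesquilinear form `∑_k ⟨f, φ_{jk}⟩ ⟨φ'_{jk}, g⟩`. -/
def levelSum (hM : IsDilation M) (φ φ' : L2 d) (j : ℤ) (f g : L2 d) : ℂ :=
  ∑' k : Fin d → ℤ, inner ℂ f (dilM hM j (tr (intVec k) φ)) *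
    inner ℂ (dilM hM j (tr (intVec k) φ')) g

theorem hasSum_filter_mul {x y : (Fin d → ℤ) → ℂ} (hx : Summable fun k => ‖x k‖ ^ 2)
    (hy : Summable fun k => ‖y k‖ ^ 2) (r r' : Fin d → ℤ) :
    HasSum (fun k => x (k + r) * y (k + r')) (∑' k, x k * y (k + (r' - r))) := by
  have h1 : Summable fun k => x k * y (k + (r' - r)) :=
    summable_mul_of_sq hx (hy.comp_injective (add_left_injective (r' - r)))
  have h2 := (Equiv.addRight r).hasSum_iff.mpr h1.hasSum
  convert h2 using 2 with k
  simp only [Function.comp_apply, Equiv.coe_addRight]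
  rw [add_assoc, add_sub_cancel]

/-- The digits and the sublattice `M ℤ^d` parametrize `ℤ^d`. -/
theorem IsDigitFamily.bijective (hM : IsDilation M) {I : Type*} {dig : I → (Fin d → ℤ)}
    (hdig : IsDigitFamily M dig) :
    Function.Bijective fun p : I × (Fin d → ℤ) => M *ᵥ p.2 + dig p.1 := by
  refine ⟨fun p p' h => ?_, fun α => ?_⟩
  · simp only at h
    have h1 : p.1 = p'.1 := by
      obtain ⟨i, -, hi⟩ := hdig (M *ᵥ p.2 + dig p.1)
      rw [hi p.1 ⟨p.2, by simp⟩, hi p'.1 ⟨p'.2, by simp only [h]; simp⟩]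
    rw [h1, add_left_inj] at h
    exact Prod.ext h1 (mulVec_injective_of_isDilation hM h)
  · obtain ⟨i, ⟨γ, hγ⟩, -⟩ := hdig α
    exact ⟨(i, γ), by simp only [← hγ]; simp⟩

/-- Perfect reconstruction for one step. Functions of level j are expanded in level j + 1, with ℤ^d
split into the cosets M k + s_q. The products become correlations G q l (r' - r) weighted by filter
coefficients, and the biorthogonality relation leaves only q = l at shift 0. The cosets then
recombine to the full sum of level j + 1. -/
theorem sum_levelSum_assembleCoeff (hM : IsDilation M) {I : Type*} [Fintype I] [DecidableEq I]
    {dig : I → (Fin d → ℤ)} (hdig : IsDigitFamily M dig) {a b : I → I → (Fin d → ℤ) →₀ ℂ}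
    (hab : ∀ q l ξ, ∑ t, trigSum (a t q) ξ * starRingEnd ℂ (trigSum (b t l) ξ) =
      if q = l then 1 else 0) {φ φ' : L2 d} {B B' : ℝ} (hB : 0 ≤ B) (hB' : 0 ≤ B')
    (hφ : IsBessel (fun k => tr (intVec k) φ) B) (hφ' : IsBessel (fun k => tr (intVec k) φ') B')
    (j : ℤ) (f g : L2 d) :
    ∑ t, levelSum hM (maskOp hM (assembleCoeff M dig (a t)) φ)
      (maskOp hM (assembleCoeff M dig (b t)) φ') j f g = levelSum hM φ φ' (j + 1) f g := by
  set x : I → (Fin d → ℤ) → ℂ := fun q k =>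
    inner ℂ f (dilM hM (j + 1) (tr (intVec (M *ᵥ k + dig q)) φ)) with hx
  set y : I → (Fin d → ℤ) → ℂ := fun q k =>
    inner ℂ (dilM hM (j + 1) (tr (intVec (M *ᵥ k + dig q)) φ')) g with hy
  have hinj : ∀ q, Function.Injective fun k : Fin d → ℤ => M *ᵥ k + dig q := fun q =>
    (add_left_injective (dig q)).comp (mulVec_injective_of_isDilation hM)
  have hxs : ∀ q, Summable fun k => ‖x q k‖ ^ 2 := fun q => by
    have := ((hφ.map (dilM hM (j + 1))).comp_injective (hinj q)).summable hB f
    simpa only [hx, norm_inner_symm f, Function.comp_apply] using this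
  have hys : ∀ q, Summable fun k => ‖y q k‖ ^ 2 := fun q =>
    ((hφ'.map (dilM hM (j + 1))).comp_injective (hinj q)).summable hB' g
  let G : I → I → (Fin d → ℤ) → ℂ := fun q l u => ∑' k, x q k * y l (k + u)
  have h1 : ∀ t, levelSum hM (maskOp hM (assembleCoeff M dig (a t)) φ)
      (maskOp hM (assembleCoeff M dig (b t)) φ') j f g =
      ∑ q, ∑ l, ∑ r ∈ (a t q).support, ∑ r' ∈ (b t l).support,
        a t q r * starRingEnd ℂ (b t l r') * G q l (r' - r) := by
    intro t
    have h2 : HasSum (fun k => ∑ q, ∑ l, ∑ r ∈ (a t q).support, ∑ r' ∈ (b t l).support,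
        a t q r * starRingEnd ℂ (b t l r') * (x q (k + r) * y l (k + r')))
        (∑ q, ∑ l, ∑ r ∈ (a t q).support, ∑ r' ∈ (b t l).support,
          a t q r * starRingEnd ℂ (b t l r') * G q l (r' - r)) :=
      hasSum_sum fun q _ => hasSum_sum fun l _ => hasSum_sum fun r _ => hasSum_sum fun r' _ =>
        (hasSum_filter_mul (hxs q) (hys l) r r').mul_left _
    rw [← h2.tsum_eq, levelSum]
    refine tsum_congr fun k => ?_
    simp only [dilM_tr_maskOp_assembleCoeff, inner_sum, sum_inner, inner_smul_left,
      inner_smul_right]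
    rw [Finset.sum_mul_sum]
    refine Finset.sum_congr rfl fun q _ => Finset.sum_congr rfl fun l _ => ?_
    rw [Finset.sum_mul_sum]
    refine Finset.sum_congr rfl fun r _ => Finset.sum_congr rfl fun r' _ => ?_
    simp only [hx, hy]
    ring
  have h3 : ∑ t, ∑ q, ∑ l, ∑ r ∈ (a t q).support, ∑ r' ∈ (b t l).support,
        a t q r * starRingEnd ℂ (b t l r') * G q l (r' - r) = ∑ q, G q q 0 := by
    rw [Finset.sum_comm]
    refine Finset.sum_congr rfl fun q _ => ?_
    rw [Finset.sum_comm]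
    calc _ = ∑ l, (if q = l then 1 else 0) * G q l 0 := Finset.sum_congr rfl fun l _ =>
          sum_coeff_mul_conj (fun t => a t q) (fun t => b t l) _ (hab q l) (G q l)
      _ = _ := by simp
  rw [Finset.sum_congr rfl fun t _ => h1 t, h3]
  have h4 := summable_inner_mul (hφ.map (dilM hM (j + 1))) (hφ'.map (dilM hM (j + 1))) hB hB' f g
  have h5 := (Equiv.ofBijective _ (hdig.bijective hM)).tsum_eq fun k : Fin d → ℤ =>
    inner ℂ f (dilM hM (j + 1) (tr (intVec k) φ)) * inner ℂ (dilM hM (j + 1) (tr (intVec k) φ')) g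
  have h6 := (Equiv.ofBijective _ (hdig.bijective hM)).summable_iff.mpr h4
  rw [levelSum, ← h5]
  refine Eq.trans ?_ (h6.tsum_prod).symm
  rw [tsum_fintype]
  refine Finset.sum_congr rfl fun q _ => ?_
  simp only [G, add_zero]
  rfl

end

section

/-! ### Parseval's identity on the unit cube -/

variable {d : ℕ}

/-- The cube `(-1/2, 1/2]^d`. -/
def unitCube (d : ℕ) : Set (Rn d) := {ξ | ∀ i, ξ i ∈ Set.Ioc (-1 / 2 : ℝ) (-1 / 2 + 1)}

theorem measurableSet_unitCube : MeasurableSet (unitCube d) := by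
  rw [unitCube, Set.ofPred_forall]
  exact MeasurableSet.iInter fun i => measurableSet_Ioc.preimage
    (EuclideanSpace.proj (𝕜 := ℝ) i).continuous.measurable

theorem mem_unitCube_of_norm_lt {ξ : Rn d} (hξ : ‖ξ‖ < 1 / 2) : ξ ∈ unitCube d := by
  intro i
  have h1 : |ξ i| < 1 / 2 := lt_of_le_of_lt (PiLp.norm_apply_le ξ i) hξ
  rw [abs_lt] at h1
  constructor <;> linarith

section Torus

attribute [local instance] instMeasureSpaceUnitAddCircle

/-- The representative in `(-1/2, 1/2]^d` of a point of the torus. -/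
def torusLift (t : UnitAddTorus (Fin d)) : Rn d :=
  WithLp.toLp 2 (UnitAddTorus.measurableEquivPiIoc (fun _ : Fin d => (-1 / 2 : ℝ)) t).1

theorem measurePreserving_torusLift : MeasurePreserving (torusLift (d := d)) volume
    (volume.restrict (unitCube d)) := by
  have h1 := UnitAddTorus.measurePreserving_equivPiIoc (fun _ : Fin d => (-1 / 2 : ℝ))
  have h2 := (PiLp.volume_preserving_toLp (Fin d)).restrict_preimage
    (measurableSet_unitCube (d := d))
  have hm : MeasurableSet {x : Fin d → ℝ | ∀ i, x i ∈ Set.Ioc (-1 / 2 : ℝ) (-1 / 2 + 1)} :=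
    MeasurableSet.univ_pi' fun i => measurableSet_Ioc
  have h3 := measurePreserving_subtype_coe (μa := (volume : Measure (Fin d → ℝ))) hm
  exact h2.comp (h3.comp h1)

theorem mFourier_eq_chr (k : Fin d → ℤ) (t : UnitAddTorus (Fin d)) :
    UnitAddTorus.mFourier k t = chr (intVec k) (torusLift t) := by
  have h1 : t = fun i => ((torusLift t i : ℝ) : UnitAddCircle) :=
    ((UnitAddTorus.measurableEquivPiIoc (fun _ : Fin d => (-1 / 2 : ℝ))).symm_apply_apply t).symm
  conv_lhs => rw [h1]
  simp only [UnitAddTorus.mFourier, ContinuousMap.coe_mk, fourier_coe_apply]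
  rw [← Complex.exp_sum, chr]
  congr 1
  push_cast
  rw [Finset.mul_sum]
  refine Finset.sum_congr rfl fun i _ => ?_
  simp only [intVec, Complex.ofReal_intCast, div_one]
  ring

theorem integral_torusLift {w : Rn d → ℂ} (hw : AEStronglyMeasurable w volume)
    (hw0 : ∀ ξ ∉ unitCube d, w ξ = 0) : ∫ t, w (torusLift t) = ∫ ξ, w ξ := by
  rw [← setIntegral_eq_integral_of_forall_compl_eq_zero hw0,
    ← measurePreserving_torusLift.map_eq, integral_map measurePreserving_torusLift.aemeasurable]
  rw [measurePreserving_torusLift.map_eq]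
  exact hw.restrict

/-- Parseval's identity for functions supported in the unit cube. -/
theorem hasSum_fourierCoeff_mul {u v : Rn d → ℂ} (hu : MemLp u 2 volume) (hv : MemLp v 2 volume)
    (hu0 : ∀ ξ ∉ unitCube d, u ξ = 0) (hv0 : ∀ ξ ∉ unitCube d, v ξ = 0) :
    HasSum (fun k : Fin d → ℤ => starRingEnd ℂ (∫ ξ, chr (-intVec k) ξ * u ξ) *
      ∫ ξ, chr (-intVec k) ξ * v ξ) (∫ ξ, starRingEnd ℂ (u ξ) * v ξ) := by
  have hm : ∀ {w : Rn d → ℂ}, MemLp w 2 volume → MemLp (fun t => w (torusLift t)) 2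
      (volume : Measure (UnitAddTorus (Fin d))) := fun hw =>
    (hw.restrict (unitCube d)).comp_measurePreserving measurePreserving_torusLift
  have hc : ∀ {w : Rn d → ℂ} (hw : MemLp w 2 volume), (∀ ξ ∉ unitCube d, w ξ = 0) →
      ∀ k : Fin d → ℤ, UnitAddTorus.mFourierCoeff ((hm hw).toLp _) k =
        ∫ ξ, chr (-intVec k) ξ * w ξ := by
    intro w hw hw0 k
    rw [← integral_torusLift (w := fun ξ => chr (-intVec k) ξ * w ξ)
      ((continuous_chr _).aestronglyMeasurable.mul hw.1)
      (fun ξ hξ => by rw [hw0 ξ hξ, mul_zero]), UnitAddTorus.mFourierCoeff]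
    refine integral_congr_ae ?_
    filter_upwards [(hm hw).coeFn_toLp] with t ht
    rw [ht, mFourier_eq_chr, intVec_neg, smul_eq_mul]
  have h := UnitAddTorus.hasSum_prod_mFourierCoeff ((hm hu).toLp _) ((hm hv).toLp _)
  have h2 : ∫ t, starRingEnd ℂ ((hm hu).toLp _ t) * (hm hv).toLp _ t =
      ∫ ξ, starRingEnd ℂ (u ξ) * v ξ := by
    rw [← integral_torusLift (w := fun ξ => starRingEnd ℂ (u ξ) * v ξ)
      ((Complex.continuous_conj.comp_aestronglyMeasurable hu.1).mul hv.1)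
      (fun ξ hξ => by rw [hv0 ξ hξ, mul_zero])]
    refine integral_congr_ae ?_
    filter_upwards [(hm hu).coeFn_toLp, (hm hv).coeFn_toLp] with t h1 h2
    rw [h1, h2]
  rw [← h2]
  simpa only [hc hu hu0, hc hv hv0] using h

end Torus

/-! ### The fine scale limit of the level sums -/

variable {M : Matrix (Fin d) (Fin d) ℤ}

/-- Multiplication by a function close to `1` on a ball is close to the identity on functions
supported in that ball. -/
theorem exists_conj_mul_near (A F : L2 d) {ε δ : ℝ}
    (hA : ∀ᵐ ξ, ‖ξ‖ ≤ δ → ‖A ξ - 1‖ ≤ ε) (hF : SuppIn δ F) :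
    ∃ U : L2 d, ‖U - F‖ ≤ ε * ‖F‖ ∧ ∃ u : Rn d → ℂ, MemLp u 2 volume ∧ U =ᵐ[volume] u ∧
      u =ᵐ[volume] (fun ξ => starRingEnd ℂ (A ξ) * F ξ) ∧ ∀ ξ, δ < ‖ξ‖ → u ξ = 0 := by
  -- The cutoff makes `u` vanish at every point off the ball, as `hasSum_fourierCoeff_mul` requires.
  -- A product of two L_2 functions need not be in L_2; here membership follows from the pointwise
  -- estimate of u - F by ε|F|.
  set u : Rn d → ℂ := (Metric.closedBall (0 : Rn d) δ).indicator
    fun ξ => starRingEnd ℂ (A ξ) * F ξ with hu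
  have hu1 : ∀ ξ, ‖ξ‖ ≤ δ → u ξ = starRingEnd ℂ (A ξ) * F ξ := fun ξ hξ =>
    Set.indicator_of_mem (by simpa using hξ) _
  have hu0 : ∀ ξ, δ < ‖ξ‖ → u ξ = 0 := fun ξ hξ =>
    Set.indicator_of_notMem (by simpa using hξ) _
  have hm : AEStronglyMeasurable u volume :=
    ((Complex.continuous_conj.comp_aestronglyMeasurable (Lp.aestronglyMeasurable A)).mul
      (Lp.aestronglyMeasurable F)).indicator Metric.isClosed_closedBall.measurableSet
  have hsub : ∀ᵐ ξ, ‖u ξ - F ξ‖ ≤ ε * ‖F ξ‖ := by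
    filter_upwards [hA, hF] with ξ h1 h2
    rcases le_or_gt ‖ξ‖ δ with h | h
    · rw [hu1 ξ h, ← sub_one_mul, norm_mul]
      have : starRingEnd ℂ (A ξ) - 1 = starRingEnd ℂ (A ξ - 1) := by simp
      rw [this, RCLike.norm_conj]
      exact mul_le_mul_of_nonneg_right (h1 h) (norm_nonneg _)
    · rw [hu0 ξ h, h2 h]
      simp
  have hmem : MemLp u 2 volume := by
    have h1 : MemLp (fun ξ => u ξ - F ξ) 2 volume :=
      ((Lp.memLp F).norm.const_mul ε).mono' (hm.sub (Lp.aestronglyMeasurable F)) hsub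
    have h2 := h1.add (Lp.memLp F)
    refine (memLp_congr_ae (Eventually.of_forall fun ξ => ?_)).mp h2
    simp
  refine ⟨hmem.toLp u, ?_, u, hmem, hmem.coeFn_toLp, ?_, hu0⟩
  · refine Lp.norm_le_mul_norm_of_ae_le_mul ?_
    filter_upwards [hsub, Lp.coeFn_sub (hmem.toLp u) F, hmem.coeFn_toLp] with ξ h1 h2 h3
    rwa [h2, Pi.sub_apply, h3]
  · filter_upwards [hF] with ξ h2
    rcases le_or_gt ‖ξ‖ δ with h | h
    · exact hu1 ξ h
    · rw [hu0 ξ h, h2 h, mul_zero]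

/-- The numbers on the left, as k varies, are the Fourier coefficients of one function, which makes
the level sum accessible to Parseval's identity. -/
theorem inner_dilM_tr (hM : IsDilation M) (j : ℤ) (k : Fin d → ℤ) (φ f : L2 d) {u : Rn d → ℂ}
    (hu : u =ᵐ[volume] fun ξ => starRingEnd ℂ ((𝓕 φ : L2 d) ξ) * (𝓕 (dilM hM (-j) f) : L2 d) ξ) :
    inner ℂ (dilM hM j (tr (intVec k) φ)) f = ∫ ξ, chr (-intVec k) ξ * u ξ := by
  rw [inner_dilM_left, ← Lp.inner_fourier_eq, fourier_tr, L2.inner_def]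
  refine integral_congr_ae ?_
  filter_upwards [hu, coeFn_modul (intVec k) (𝓕 φ : L2 d)] with ξ h1 h2
  rw [h1, h2, RCLike.inner_apply, map_mul, chr_neg_left]
  ring

/-- Spectra inside the unit cube do not overlap under periodization, so the level sum is exactly the
inner product of conj(φ^)F and conj(φ'^)G. Replacing the two multipliers by 1 costs 2ε and ε, the 2
being the bound for 1 + ε in the norm of `V`. -/
theorem norm_levelSum_sub_inner_le (hM : IsDilation M) {φ φ' : L2 d} {j : ℤ} {f g : L2 d}
    {ε δ : ℝ} (hε : 0 ≤ ε) (hε1 : ε ≤ 1) (hδ : δ < 1 / 2)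
    (hφ : ∀ᵐ ξ, ‖ξ‖ ≤ δ → ‖(𝓕 φ : L2 d) ξ - 1‖ ≤ ε)
    (hφ' : ∀ᵐ ξ, ‖ξ‖ ≤ δ → ‖(𝓕 φ' : L2 d) ξ - 1‖ ≤ ε)
    (hf : SuppIn δ (𝓕 (dilM hM (-j) f))) (hg : SuppIn δ (𝓕 (dilM hM (-j) g))) :
    ‖levelSum hM φ φ' j f g - inner ℂ f g‖ ≤ 3 * ε * (‖f‖ * ‖g‖) := by
  set F : L2 d := 𝓕 (dilM hM (-j) f) with hF
  set G : L2 d := 𝓕 (dilM hM (-j) g) with hG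
  obtain ⟨U, hU, u, hu, hUu, huF, hu0⟩ := exists_conj_mul_near (𝓕 φ) F hφ hf
  obtain ⟨V, hV, v, hv, hVv, hvG, hv0⟩ := exists_conj_mul_near (𝓕 φ') G hφ' hg
  have hcube : ∀ {w : Rn d → ℂ}, (∀ ξ, δ < ‖ξ‖ → w ξ = 0) → ∀ ξ ∉ unitCube d, w ξ = 0 := by
    intro w hw ξ hξ
    refine hw ξ ?_
    by_contra! h
    exact hξ (mem_unitCube_of_norm_lt (h.trans_lt hδ))
  have h1 : levelSum hM φ φ' j f g = inner ℂ U V := by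
    have h2 := (hasSum_fourierCoeff_mul hu hv (hcube hu0) (hcube hv0)).tsum_eq
    rw [levelSum, L2.inner_def]
    refine Eq.trans (tsum_congr fun k => ?_) (h2.trans (integral_congr_ae ?_))
    · rw [← inner_conj_symm, inner_dilM_tr hM j k φ f huF, inner_dilM_tr hM j k φ' g hvG]
    · filter_upwards [hUu, hVv] with ξ h3 h4
      rw [h3, h4, RCLike.inner_apply, mul_comm]
  have h2 : inner ℂ f g = inner ℂ F G := by
    rw [hF, hG, Lp.inner_fourier_eq, LinearIsometry.inner_map_map]
  have hFn : ‖F‖ = ‖f‖ := by rw [hF, Lp.norm_fourier_eq, LinearIsometry.norm_map]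
  have hGn : ‖G‖ = ‖g‖ := by rw [hG, Lp.norm_fourier_eq, LinearIsometry.norm_map]
  have hVn : ‖V‖ ≤ 2 * ‖G‖ := by
    have h3 : ‖V‖ ≤ ‖V - G‖ + ‖G‖ := by simpa using norm_add_le (V - G) G
    nlinarith [norm_nonneg G]
  have h3 : inner ℂ U V - inner ℂ F G = inner ℂ (U - F) V + inner ℂ F (V - G) := by
    rw [inner_sub_left, inner_sub_right]
    ring
  rw [h1, h2, h3, ← hFn, ← hGn]
  calc ‖inner ℂ (U - F) V + inner ℂ F (V - G)‖
      ≤ ‖U - F‖ * ‖V‖ + ‖F‖ * ‖V - G‖ := (norm_add_le _ _).trans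
        (add_le_add (norm_inner_le_norm _ _) (norm_inner_le_norm _ _))
    _ ≤ (ε * ‖F‖) * (2 * ‖G‖) + ‖F‖ * (ε * ‖G‖) := by gcongr
    _ = _ := by ring

theorem dilM_fourier_suppIn (hM : IsDilation M) {R : ℝ} {f : L2 d} (hf : SuppIn R (𝓕 f)) {δ : ℝ}
    (hδ : 0 < δ) : ∀ᶠ j : ℕ in atTop, SuppIn δ (𝓕 (dilM hM (-(j : ℤ)) f)) := by
  obtain ⟨q, C, ρ, hq⟩ := hM.exists_isContracted_transInv
  have h0 := (tendsto_pow_atTop_nhds_zero_of_lt_one hq.pos.le hq.lt_one).mul_const (C * R)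
  rw [zero_mul] at h0
  filter_upwards [h0.eventually_lt_const hδ] with j hj
  have hdet := hM.det_zpow_ne_zero (-(j : ℤ))
  rw [dilM, fourier_dil]
  filter_upwards [coeFn_dil (det_inv_transpose_ne_zero hdet) (𝓕 f),
    (quasiMeasurePreserving_act (det_inv_transpose_ne_zero hdet)).ae hf] with ξ h1 h2 h3
  rw [h1, h2, mul_zero]
  by_contra! h4
  refine absurd h3 (not_lt.mpr (le_trans ?_ hj.le))
  set η := act ((realMat M ^ (-(j : ℤ)))⁻¹)ᵀ ξ with hη
  have h5 : ξ = (act ((realMat M)ᵀ)⁻¹)^[j] η := by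
    rw [← act_pow, hη, ← act_mul]
    have h6 : (realMat M)⁻¹ ^ j = realMat M ^ (-(j : ℤ)) := by
      rw [Matrix.inv_pow', ← zpow_natCast, Matrix.zpow_neg (isUnit_iff_ne_zero.mpr hM.det_ne_zero)]
    have : ((realMat M)ᵀ)⁻¹ ^ j * ((realMat M ^ (-(j : ℤ)))⁻¹)ᵀ = 1 := by
      rw [← Matrix.transpose_nonsing_inv, ← Matrix.transpose_pow, ← Matrix.transpose_mul, h6,
        Matrix.nonsing_inv_mul _ (isUnit_iff_ne_zero.mpr hdet), Matrix.transpose_one]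
    rw [this, act_one]
  rw [h5]
  refine (hq.norm_iterate_le j η).trans ?_
  have := hq.pos
  have := hq.const_pos
  gcongr

theorem ae_norm_fourier_sub_one_le (hM : IsDilation M) {t : Rn d → ℂ} (ht : IsTrigPoly t)
    (ht0 : t 0 = 1) {φ : L2 d} (hφ : IsRefinableL2 M t φ) {ε : ℝ} (hε : 0 < ε) :
    ∃ δ, 0 < δ ∧ ∀ᵐ ξ, ‖ξ‖ ≤ δ → ‖(𝓕 φ : L2 d) ξ - 1‖ ≤ ε := by
  obtain ⟨δ, hδ, h⟩ := Metric.tendsto_nhds_nhds.mp (tendsto_refinableFT_zero hM ht ht0) ε hε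
  refine ⟨δ / 2, by positivity, ?_⟩
  filter_upwards [hφ] with ξ h1 h2
  rw [h1, ← dist_eq_norm]
  refine (h ?_).le
  rw [dist_zero_right]
  linarith

theorem tendsto_levelSum_sub_inner (hM : IsDilation M) {t t' : Rn d → ℂ} (ht : IsTrigPoly t)
    (ht0 : t 0 = 1) (ht' : IsTrigPoly t') (ht0' : t' 0 = 1) {φ φ' : L2 d}
    (hφ : IsRefinableL2 M t φ) (hφ' : IsRefinableL2 M t' φ') {R R' : ℝ} {f g : L2 d}
    (hf : SuppIn R (𝓕 f)) (hg : SuppIn R' (𝓕 g)) :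
    Tendsto (fun j : ℕ => levelSum hM φ φ' j f g - inner ℂ f g) atTop (𝓝 0) := by
  rw [Metric.tendsto_nhds]
  intro η hη
  -- The bound 1 is what `norm_levelSum_sub_inner_le` demands, and the `+ 1` keeps the denominator
  -- positive when f or g is zero.
  set ε := min 1 (η / (3 * (‖f‖ * ‖g‖) + 1)) with hε
  have hε0 : 0 < ε := lt_min one_pos (by positivity)
  obtain ⟨δ₁, hδ₁, h1⟩ := ae_norm_fourier_sub_one_le hM ht ht0 hφ hε0
  obtain ⟨δ₂, hδ₂, h2⟩ := ae_norm_fourier_sub_one_le hM ht' ht0' hφ' hε0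
  set δ := min (1 / 4) (min δ₁ δ₂) with hδ
  have hδ0 : 0 < δ := lt_min (by norm_num) (lt_min hδ₁ hδ₂)
  have hδ4 : δ ≤ 1 / 4 := min_le_left _ _
  have hδ1 : δ ≤ δ₁ := (min_le_right _ _).trans (min_le_left _ _)
  have hδ2 : δ ≤ δ₂ := (min_le_right _ _).trans (min_le_right _ _)
  filter_upwards [dilM_fourier_suppIn hM hf hδ0, dilM_fourier_suppIn hM hg hδ0] with j hj1 hj2
  rw [dist_zero_right]
  refine (norm_levelSum_sub_inner_le hM hε0.le (min_le_left _ _) (by linarith)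
    (h1.mono fun ξ h h' => h (h'.trans hδ1)) (h2.mono fun ξ h h' => h (h'.trans hδ2))
    hj1 hj2).trans_lt ?_
  have h3 : ε * (3 * (‖f‖ * ‖g‖) + 1) ≤ η := by
    rw [← le_div_iff₀ (by positivity)]
    exact min_le_right _ _
  nlinarith

end

section

/-! ### Limits of uniformly bounded forms -/

theorem tendsto_zero_of_dense {𝓗 : Type*} [NormedAddCommGroup 𝓗] {Q : ℕ → 𝓗 → 𝓗 → ℂ} {C : ℝ}
    (hl : ∀ n f f' g, Q n (f - f') g = Q n f g - Q n f' g)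
    (hr : ∀ n f g g', Q n f (g - g') = Q n f g - Q n f g')
    (hQ : ∀ n f g, ‖Q n f g‖ ≤ C * (‖f‖ * ‖g‖)) {S T : Set 𝓗} (hS : Dense S) (hT : Dense T)
    (h : ∀ f ∈ S, ∀ g ∈ T, Tendsto (fun n => Q n f g) atTop (𝓝 0)) (f g : 𝓗) :
    Tendsto (fun n => Q n f g) atTop (𝓝 0) := by
  have step : ∀ f ∈ S, ∀ g, Tendsto (fun n => Q n f g) atTop (𝓝 0) := by
    intro f hf g
    rw [Metric.tendsto_nhds]
    intro ε hε
    obtain ⟨g', hg', hgg⟩ := Metric.dense_iff.mp hT g (ε / (2 * (|C| * ‖f‖ + 1))) (by positivity)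
    filter_upwards [Metric.tendsto_nhds.mp (h f hf g' hgg) (ε / 2) (by positivity)] with n hn
    rw [dist_zero_right] at hn ⊢
    rw [Metric.mem_ball, dist_comm, dist_eq_norm, lt_div_iff₀ (by positivity)] at hg'
    have h1 : Q n f g = Q n f (g - g') + Q n f g' := by rw [hr]; ring
    have h2 : ‖Q n f (g - g')‖ ≤ |C| * ‖f‖ * ‖g - g'‖ := by
      refine (hQ n _ _).trans ?_
      rw [← mul_assoc]
      gcongr
      exact le_abs_self C
    rw [h1]
    refine (norm_add_le _ _).trans_lt ?_
    nlinarith [norm_nonneg (g - g')]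
  rw [Metric.tendsto_nhds]
  intro ε hε
  obtain ⟨f', hf', hff⟩ := Metric.dense_iff.mp hS f (ε / (2 * (|C| * ‖g‖ + 1))) (by positivity)
  filter_upwards [Metric.tendsto_nhds.mp (step f' hff g) (ε / 2) (by positivity)] with n hn
  rw [dist_zero_right] at hn ⊢
  rw [Metric.mem_ball, dist_comm, dist_eq_norm, lt_div_iff₀ (by positivity)] at hf'
  have h1 : Q n f g = Q n (f - f') g + Q n f' g := by rw [hl]; ring
  have h2 : ‖Q n (f - f') g‖ ≤ |C| * ‖g‖ * ‖f - f'‖ := by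
    refine (hQ n _ _).trans ?_
    rw [mul_comm ‖f - f'‖, ← mul_assoc]
    gcongr
    exact le_abs_self C
  rw [h1]
  refine (norm_add_le _ _).trans_lt ?_
  nlinarith [norm_nonneg (f - f')]

variable {d : ℕ} {M : Matrix (Fin d) (Fin d) ℤ}

/-! ### Level sums as bounded forms -/

section LevelSum

variable {φ φ' : L2 d} {B B' : ℝ}

theorem summable_levelSum (hM : IsDilation M) (hB : 0 ≤ B) (hB' : 0 ≤ B')
    (hφ : IsBessel (fun k => tr (intVec k) φ) B) (hφ' : IsBessel (fun k => tr (intVec k) φ') B')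
    (j : ℤ) (f g : L2 d) : Summable fun k : Fin d → ℤ =>
      inner ℂ f (dilM hM j (tr (intVec k) φ)) * inner ℂ (dilM hM j (tr (intVec k) φ')) g :=
  summable_inner_mul (hφ.map (dilM hM j)) (hφ'.map (dilM hM j)) hB hB' f g

theorem norm_levelSum_le (hM : IsDilation M) (hB : 0 ≤ B) (hB' : 0 ≤ B')
    (hφ : IsBessel (fun k => tr (intVec k) φ) B) (hφ' : IsBessel (fun k => tr (intVec k) φ') B')
    (j : ℤ) (f g : L2 d) : ‖levelSum hM φ φ' j f g‖ ≤ √B * √B' * (‖f‖ * ‖g‖) := by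
  refine (norm_tsum_inner_mul_le (hφ.map (dilM hM j)) (hφ'.map (dilM hM j)) hB hB' f g).trans
    (le_of_eq ?_)
  ring

theorem levelSum_sub_left (hM : IsDilation M) (hB : 0 ≤ B) (hB' : 0 ≤ B')
    (hφ : IsBessel (fun k => tr (intVec k) φ) B) (hφ' : IsBessel (fun k => tr (intVec k) φ') B')
    (j : ℤ) (f f' g : L2 d) : levelSum hM φ φ' j (f - f') g =
      levelSum hM φ φ' j f g - levelSum hM φ φ' j f' g := by
  rw [levelSum, levelSum, levelSum, ← (summable_levelSum hM hB hB' hφ hφ' j f g).tsum_sub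
    (summable_levelSum hM hB hB' hφ hφ' j f' g)]
  refine tsum_congr fun k => ?_
  rw [inner_sub_left, sub_mul]

theorem levelSum_sub_right (hM : IsDilation M) (hB : 0 ≤ B) (hB' : 0 ≤ B')
    (hφ : IsBessel (fun k => tr (intVec k) φ) B) (hφ' : IsBessel (fun k => tr (intVec k) φ') B')
    (j : ℤ) (f g g' : L2 d) : levelSum hM φ φ' j f (g - g') =
      levelSum hM φ φ' j f g - levelSum hM φ φ' j f g' := by
  rw [levelSum, levelSum, levelSum, ← (summable_levelSum hM hB hB' hφ hφ' j f g).tsum_sub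
    (summable_levelSum hM hB hB' hφ hφ' j f g')]
  refine tsum_congr fun k => ?_
  rw [inner_sub_right, mul_sub]

end LevelSum

/-! ### The fine scale limit -/

/-- Compactly supported functions are dense in L_2, and the Fourier transform is unitary. -/
theorem dense_bandlimited : Dense {f : L2 d | ∃ R, SuppIn R (𝓕 f)} := by
  rw [Metric.dense_iff]
  intro f ε hε
  obtain ⟨g, hg, hgε, -, hgm⟩ := (Lp.memLp (𝓕 f : L2 d)).exists_hasCompactSupport_eLpNorm_sub_le
    (by simp) (ε := ENNReal.ofReal (ε / 2)) (by simpa using hε)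
  obtain ⟨R, hR⟩ := hg.isCompact.isBounded.subset_closedBall 0
  refine ⟨(𝓕⁻ (hgm.toLp g) : L2 d), ?_, R, ?_⟩
  · have h0 : (𝓕 (f - 𝓕⁻ (hgm.toLp g)) : L2 d) = 𝓕 f - 𝓕 (𝓕⁻ (hgm.toLp g) : L2 d) :=
      (Lp.fourierTransformₗᵢ (Rn d) ℂ).map_sub f (𝓕⁻ (hgm.toLp g))
    rw [FourierTransform.fourier_fourierInv_eq] at h0
    rw [Metric.mem_ball, dist_comm, dist_eq_norm, ← Lp.norm_fourier_eq, h0, Lp.norm_def]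
    refine lt_of_le_of_lt (ENNReal.toReal_mono (b := ENNReal.ofReal (ε / 2)) (by simp) ?_)
      (by rw [ENNReal.toReal_ofReal (by positivity)]; linarith)
    refine le_trans (le_of_eq (eLpNorm_congr_ae ?_)) hgε
    filter_upwards [Lp.coeFn_sub (𝓕 f : L2 d) (hgm.toLp g), hgm.coeFn_toLp] with ξ h1 h2
    rw [h1, Pi.sub_apply, h2, Pi.sub_apply]
  · rw [FourierTransform.fourier_fourierInv_eq]
    filter_upwards [hgm.coeFn_toLp] with ξ h1 h2
    rw [h1]
    by_contra h3
    have := hR (subset_tsupport g h3)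
    rw [mem_closedBall_zero_iff] at this
    linarith

theorem tendsto_levelSum_atTop (hM : IsDilation M) {t t' : Rn d → ℂ} (ht : IsTrigPoly t)
    (ht0 : t 0 = 1) (ht' : IsTrigPoly t') (ht0' : t' 0 = 1) {φ φ' : L2 d}
    (hφ : IsRefinableL2 M t φ) (hφ' : IsRefinableL2 M t' φ') {B B' : ℝ} (hB : 0 ≤ B)
    (hB' : 0 ≤ B') (hb : IsBessel (fun k => tr (intVec k) φ) B)
    (hb' : IsBessel (fun k => tr (intVec k) φ') B') (f g : L2 d) :
    Tendsto (fun j : ℕ => levelSum hM φ φ' j f g) atTop (𝓝 (inner ℂ f g)) := by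
  have h := tendsto_zero_of_dense
    (Q := fun j : ℕ => fun f g : L2 d => levelSum hM φ φ' j f g - inner ℂ f g)
    (C := √B * √B' + 1) (fun j f f' g => by
      simp only [levelSum_sub_left hM hB hB' hb hb', inner_sub_left]; ring)
    (fun j f g g' => by
      simp only [levelSum_sub_right hM hB hB' hb hb', inner_sub_right]; ring)
    (fun j f g => by
      refine (norm_sub_le _ _).trans ?_
      rw [add_mul, one_mul]
      exact add_le_add (norm_levelSum_le hM hB hB' hb hb' j f g) (norm_inner_le_norm _ _))
    dense_bandlimited dense_bandlimited
    (fun f ⟨R, hf⟩ g ⟨R', hg⟩ => tendsto_levelSum_sub_inner hM ht ht0 ht' ht0' hφ hφ' hf hg) f g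
  simpa using h.add_const (inner ℂ f g)

/-! ### The coarse scale limit -/

theorem volume_setOf_coord_eq (i : Fin d) (c : ℝ) : volume {ξ : Rn d | ξ i = c} = 0 := by
  have h := (PiLp.volume_preserving_ofLp (Fin d)).measure_preimage
    (s := {x : Fin d → ℝ | x i = c})
    (measurableSet_eq_fun (measurable_pi_apply i) measurable_const).nullMeasurableSet
  have h2 : {ξ : Rn d | ξ i = c} = WithLp.ofLp ⁻¹' {x : Fin d → ℝ | x i = c} := rfl
  rw [h2, h]
  exact Measure.pi_hyperplane (fun _ : Fin d => (volume : Measure ℝ)) i c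

theorem ae_chr_single_ne_one (i : Fin d) :
    ∀ᵐ ξ : Rn d, chr (-intVec (Pi.single i 1)) ξ ≠ 1 := by
  have h1 : ∀ᵐ ξ : Rn d, ∀ n : ℤ, ξ i ≠ n := by
    rw [ae_all_iff]
    intro n
    rw [ae_iff]
    simpa using volume_setOf_coord_eq i (n : ℝ)
  filter_upwards [h1] with ξ hξ h2
  rw [chr, Complex.exp_eq_one_iff] at h2
  obtain ⟨n, hn⟩ := h2
  have h3 : (∑ j, (-intVec (Pi.single i 1 : Fin d → ℤ)) j * ξ j : ℝ) = -ξ i := by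
    simp [intVec, Pi.single_apply]
  rw [h3, mul_comm] at hn
  have h4 := mul_right_cancel₀ Complex.two_pi_I_ne_zero hn
  refine hξ (-n) ?_
  have h5 : -ξ i = n := by exact_mod_cast h4
  push_cast
  linarith

/-- A function orthogonal to the range is invariant under a unit translation. Its transform is then
carried by the set where a nontrivial character equals 1, a countable union of hyperplanes of
measure zero, so the function vanishes. -/
theorem dense_range_tr_sub (i : Fin d) :
    Dense (Set.range fun h : L2 d => tr (intVec (Pi.single i 1)) h - h) := by
  set b : Rn d := intVec (Pi.single i 1) with hb
  let T : L2 d →ₗ[ℂ] L2 d := (tr b).toLinearMap - LinearMap.id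
  have h1 : (LinearMap.range T).topologicalClosure = ⊤ := by
    rw [Submodule.topologicalClosure_eq_top_iff, Submodule.eq_bot_iff]
    intro v hv
    have h2 : ∀ h, inner ℂ h (tr (-b) v - v) = 0 := by
      intro h
      rw [inner_sub_right, ← inner_tr_left, ← inner_sub_left]
      exact hv _ ⟨h, rfl⟩
    have h3 : tr (-b) v = v := sub_eq_zero.mp (inner_self_eq_zero.mp (h2 _))
    have h4 : modul (-b) (𝓕 v) = (𝓕 v : L2 d) := by rw [← fourier_tr, h3]
    have h5 : (𝓕 v : L2 d) = 0 := by
      refine Lp.ext ?_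
      filter_upwards [coeFn_modul (-b) (𝓕 v), ae_chr_single_ne_one i, Lp.coeFn_zero ℂ 2 volume]
        with ξ h6 h7 h8
      rw [h4] at h6
      rw [h8, Pi.zero_apply]
      by_contra h9
      exact h7 (mul_right_cancel₀ h9 (by rw [one_mul]; exact h6.symm))
    have h6 : ‖v‖ = 0 := by rw [← Lp.norm_fourier_eq, h5, norm_zero]
    exact norm_eq_zero.mp h6
  have h2 : Dense ((LinearMap.range T : Submodule ℂ (L2 d)) : Set (L2 d)) :=
    (Submodule.dense_iff_topologicalClosure_eq_top).mpr h1
  exact h2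

theorem diffOp_single_sub_single (k : Fin d → ℤ) (n : ℕ) (f : L2 d) :
    diffOp M (Finsupp.single k 1 - Finsupp.single 0 1) n f =
      tr (-act ((realMat M)⁻¹ ^ n) (intVec k)) f - f := by
  have h1 : diffOp M (Finsupp.single k 1 - Finsupp.single 0 1) n f =
      (Finsupp.single k (1 : ℂ) - Finsupp.single 0 1).sum fun i c =>
        starRingEnd ℂ c • tr (-act ((realMat M)⁻¹ ^ n) (intVec i)) f := diffOp_apply _ _ _
  rw [h1, Finsupp.sum_sub_index fun i c c' => by rw [map_sub, sub_smul],
    Finsupp.sum_single_index (by simp), Finsupp.sum_single_index (by simp)]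
  simp [intVec_zero, act_zero, tr_zero]

/-- For f of the form u(· + e) - u the difference can be transferred to φ, where at scale -j it has
the step M^{-j}e, and the Bessel bounds of such differences decay. These f are dense. The positivity
of d supplies the unit vector e. -/
theorem tendsto_levelSum_atBot (hd : 0 < d) (hM : IsDilation M) {h : (Fin d → ℤ) →₀ ℂ}
    {φ φ' : L2 d} (hφ : maskOp hM h φ = φ) {R : ℝ} (hR : SuppIn R φ) {B B' : ℝ} (hB : 0 ≤ B)
    (hB' : 0 ≤ B') (hb : IsBessel (fun k => tr (intVec k) φ) B)
    (hb' : IsBessel (fun k => tr (intVec k) φ') B') (f g : L2 d) :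
    Tendsto (fun j : ℕ => levelSum hM φ φ' (-(j : ℤ)) f g) atTop (𝓝 0) := by
  set e : Fin d → ℤ := Pi.single ⟨0, hd⟩ 1 with he
  set a : (Fin d → ℤ) →₀ ℂ := Finsupp.single e 1 - Finsupp.single 0 1 with ha
  have ha0 : a.sum (fun _ c => c) = 0 := by
    rw [ha, Finsupp.sum_sub_index fun _ _ _ => rfl, Finsupp.sum_single_index rfl,
      Finsupp.sum_single_index rfl, sub_self]
  obtain ⟨C, ρ, hC, hρ0, hρ1, hdiff⟩ := exists_isBessel_diffOp hM ha0 hφ hR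
  refine tendsto_zero_of_dense
    (Q := fun j : ℕ => fun f g : L2 d => levelSum hM φ φ' (-(j : ℤ)) f g)
    (fun j => levelSum_sub_left hM hB hB' hb hb' _)
    (fun j => levelSum_sub_right hM hB hB' hb hb' _)
    (fun j => norm_levelSum_le hM hB hB' hb hb' _)
    (dense_range_tr_sub ⟨0, hd⟩) dense_univ ?_ f g
  rintro _ ⟨u, rfl⟩ g -
  have h1 : ∀ j : ℕ, levelSum hM φ φ' (-(j : ℤ)) (tr (intVec e) u - u) g =
      levelSum hM (diffOp M a j φ) φ' (-(j : ℤ)) u g := by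
    intro j
    refine tsum_congr fun k => ?_
    congr 1
    rw [ha, diffOp_single_sub_single, map_sub, map_sub, inner_sub_left, inner_sub_right,
      inner_tr_left, tr_dilM, tr_comm (intVec k), act_neg]
    congr 6
    rw [Matrix.inv_pow', ← zpow_natCast,
      Matrix.zpow_neg (isUnit_iff_ne_zero.mpr hM.det_ne_zero)]
  have h2 : Tendsto (fun j : ℕ => √(C * ρ ^ j) * √B' * (‖u‖ * ‖g‖)) atTop (𝓝 0) := by
    have h3 := ((tendsto_pow_atTop_nhds_zero_of_lt_one hρ0.le hρ1).const_mul C).sqrt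
    simpa using (h3.mul_const (√B')).mul_const (‖u‖ * ‖g‖)
  refine squeeze_zero_norm (fun j => ?_) h2
  rw [h1]
  exact norm_levelSum_le hM (by positivity) hB' (hdiff j) hb' _ u g

end

section

variable {d : ℕ} {M : Matrix (Fin d) (Fin d) ℤ}

/-! ### Dual wavelet frames from biorthogonal filter banks -/

theorem eq_of_hasSum_telescoping {P : ℤ → ℂ} {S L : ℂ} (h : HasSum (fun j => P (j + 1) - P j) S)
    (hbot : Tendsto (fun n : ℕ => P (-(n : ℤ))) atTop (𝓝 0))
    (htop : Tendsto (fun n : ℕ => P n) atTop (𝓝 L)) : S = L := by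
  -- The sum is evaluated along the windows -n ≤ x < n, on which the telescoped value is P(n) -
  -- P(-n).
  have hinj : ∀ n : ℕ, Function.Injective fun i : ℕ => (i : ℤ) - n := fun n i i' h => by
    simp only at h
    omega
  have hmem : ∀ (n : ℕ) (x : ℤ), x ∈ (Finset.range (2 * n)).map ⟨_, hinj n⟩ ↔
      -(n : ℤ) ≤ x ∧ x < n := by
    intro n x
    simp only [Finset.mem_map, Finset.mem_range, Function.Embedding.coeFn_mk]
    constructor
    · rintro ⟨i, hi, rfl⟩
      omega
    · intro hx
      exact ⟨(x + n).toNat, by omega, by omega⟩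
  have h1 : Tendsto (fun n : ℕ => (Finset.range (2 * n)).map ⟨_, hinj n⟩) atTop atTop := by
    refine tendsto_atTop_finset_of_monotone (fun n n' hn x hx => ?_) fun x =>
      ⟨x.natAbs + 1, (hmem _ _).mpr (by omega)⟩
    rw [hmem] at hx ⊢
    omega
  have h2 := Tendsto.comp h h1
  have h3 : Tendsto (fun n : ℕ => P n - P (-(n : ℤ))) atTop (𝓝 S) := by
    refine h2.congr fun n => ?_
    simp only [Function.comp_apply, Finset.sum_map, Function.Embedding.coeFn_mk]
    have h4 := Finset.sum_range_sub (fun i : ℕ => P ((i : ℤ) - n)) (2 * n)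
    rw [show ((2 * n : ℕ) : ℤ) - n = n by push_cast; ring,
      show ((0 : ℕ) : ℤ) - n = -n by simp] at h4
    rw [← h4]
    refine Finset.sum_congr rfl fun i _ => ?_
    rw [show ((i + 1 : ℕ) : ℤ) - n = (i : ℤ) - n + 1 by push_cast; ring]
  have h5 := htop.sub hbot
  rw [sub_zero] at h5
  exact tendsto_nhds_unique h3 h5

/-- Unconditional summability is supplied independently, by the Bessel property in the application.
Summing level by level therefore serves only to find the value. -/
theorem hasSum_of_telescoping {W κ : Type*} [Fintype W] {F : W × ℤ × κ → ℂ} (hF : Summable F)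
    {P : ℤ → ℂ} {L : ℂ} (hP : ∀ j, ∑ w, ∑' k, F (w, j, k) = P (j + 1) - P j)
    (hbot : Tendsto (fun n : ℕ => P (-(n : ℤ))) atTop (𝓝 0))
    (htop : Tendsto (fun n : ℕ => P n) atTop (𝓝 L)) : HasSum F L := by
  let e : ℤ × W × κ ≃ W × ℤ × κ :=
    { toFun := fun x => (x.2.1, x.1, x.2.2)
      invFun := fun x => (x.2.1, x.1, x.2.2)
      left_inv := fun _ => rfl
      right_inv := fun _ => rfl }
  have h1 : Summable fun x : ℤ × W × κ => F (x.2.1, x.1, x.2.2) := e.summable_iff.mpr hF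
  have h2 : HasSum (fun x : ℤ × W × κ => F (x.2.1, x.1, x.2.2)) (∑' x, F x) :=
    e.hasSum_iff.mpr hF.hasSum
  have h3 := h2.prod_fiberwise fun j => (h1.prod_factor j).hasSum
  have h4 : ∀ j, ∑' y : W × κ, F (y.1, j, y.2) = P (j + 1) - P j := fun j => by
    rw [(h1.prod_factor j).tsum_prod, tsum_fintype, ← hP]
  simp only [h4] at h3
  rw [← eq_of_hasSum_telescoping h3 hbot htop]
  exact hF.hasSum

theorem sum_eq_trigSum_zero (a : (Fin d → ℤ) →₀ ℂ) : a.sum (fun _ c => c) = trigSum a 0 := by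
  simp [trigSum, chr_zero_right]

/-- The mixed extension principle for biorthogonal filter banks given by their polyphase
coefficients; the index `Sum.inl ()` is that of the refinable masks. -/
theorem isDualFramePair_of_filterBank (hd : 0 < d) (hM : IsDilation M) {W : Type} [Fintype W]
    [DecidableEq W] {dig : Unit ⊕ W → (Fin d → ℤ)} (hdig : IsDigitFamily M dig)
    {a b : Unit ⊕ W → Unit ⊕ W → (Fin d → ℤ) →₀ ℂ}
    (hab : ∀ q l ξ, ∑ t, trigSum (a t q) ξ * starRingEnd ℂ (trigSum (b t l) ξ) =
      if q = l then 1 else 0)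
    (ha0 : ∀ t, trigSum (assembleCoeff M dig (a t)) 0 = if t = Sum.inl () then 1 else 0)
    (hb0 : ∀ t, trigSum (assembleCoeff M dig (b t)) 0 = if t = Sum.inl () then 1 else 0)
    {φ φ' : L2 d} (hφ : IsRefinableL2 M (trigSum (assembleCoeff M dig (a (Sum.inl ())))) φ)
    (hφ' : IsRefinableL2 M (trigSum (assembleCoeff M dig (b (Sum.inl ())))) φ') :
    IsDualFramePair
      (waveletSystem hM fun w => maskOp hM (assembleCoeff M dig (a (Sum.inr w))) φ)
      (waveletSystem hM fun w => maskOp hM (assembleCoeff M dig (b (Sum.inr w))) φ') := by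
  have htrig : ∀ c : (Fin d → ℤ) →₀ ℂ, IsTrigPoly (trigSum c) := fun c => ⟨c, fun _ => rfl⟩
  have ha1 := (ha0 (Sum.inl ())).trans (if_pos rfl)
  have hb1 := (hb0 (Sum.inl ())).trans (if_pos rfl)
  have hφm := maskOp_eq_self hM (fun _ => rfl) ha1 hφ
  have hφm' := maskOp_eq_self hM (fun _ => rfl) hb1 hφ'
  obtain ⟨R, -, hR⟩ := exists_ae_eq_zero_of_norm_gt hM (htrig _) ha1 hφ
  obtain ⟨R', -, hR'⟩ := exists_ae_eq_zero_of_norm_gt hM (htrig _) hb1 hφ'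
  have hR : SuppIn R φ := hR
  have hR' : SuppIn R' φ' := hR'
  have hB : 0 ≤ ∑ u ∈ intBox d (2 * R), ‖gram φ u‖ := Finset.sum_nonneg fun _ _ => norm_nonneg _
  have hB' : 0 ≤ ∑ u ∈ intBox d (2 * R'), ‖gram φ' u‖ :=
    Finset.sum_nonneg fun _ _ => norm_nonneg _
  have hws : ∀ ψ : W → L2 d, waveletSystem hM ψ =
      fun x => dilM hM x.2.1 (tr (intVec x.2.2) (ψ x.1)) := fun ψ =>
    funext fun x => dilShiftL2_eq hM _ _ _
  rw [hws, hws]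
  obtain ⟨C, hC, hbC⟩ := isBessel_of_fintype (g := fun x : W × ℤ × (Fin d → ℤ) =>
      dilM hM x.2.1 (tr (intVec x.2.2) (maskOp hM (assembleCoeff M dig (a (Sum.inr x.1))) φ)))
    fun w => exists_isBessel_wavelet hM
      ((sum_eq_trigSum_zero _).trans ((ha0 _).trans (if_neg Sum.inr_ne_inl))) hφm hR
  obtain ⟨C', hC', hbC'⟩ := isBessel_of_fintype (g := fun x : W × ℤ × (Fin d → ℤ) =>
      dilM hM x.2.1 (tr (intVec x.2.2) (maskOp hM (assembleCoeff M dig (b (Sum.inr x.1))) φ')))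
    fun w => exists_isBessel_wavelet hM
      ((sum_eq_trigSum_zero _).trans ((hb0 _).trans (if_neg Sum.inr_ne_inl))) hφm' hR'
  refine isDualFramePair_of_isBessel hC hC' hbC hbC' fun f g => ?_
  refine hasSum_of_telescoping (summable_inner_mul hbC hbC' hC.le hC'.le f g)
    (P := fun j => levelSum hM φ φ' j f g) (fun j => ?_)
    (tendsto_levelSum_atBot hd hM hφm hR hB hB' hR.isBessel hR'.isBessel f g)
    (tendsto_levelSum_atTop hM (htrig _) ha1 (htrig _) hb1 hφ hφ' hB hB' hR.isBessel hR'.isBessel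
      f g)
  have h := sum_levelSum_assembleCoeff hM hdig hab hB hB' hR.isBessel hR'.isBessel j f g
  -- The index of the refinable masks contributes the scaling sum of level j, since φ and φ' are
  -- fixed by their mask operators. The remaining indices give the wavelet terms.
  rw [Fintype.sum_sum_type, Fintype.sum_unique (ι := Unit), PUnit.default_eq_unit, hφm, hφm'] at h
  rw [← h, add_sub_cancel_left]
  rfl

/-- The wavelets of the extended polyphase matrices form a pair of dual frames. -/
theorem exists_isDualFramePair (hd : 0 < d) (hM : IsDilation M) {W : Type} [Fintype W]
    [DecidableEq W] {dig : Unit ⊕ W → (Fin d → ℤ)} (hdig : IsDigitFamily M dig)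
    {m0 : Rn d → ℂ} {μ : Unit ⊕ W → Rn d → ℂ} (hμ : IsPolyphase M dig m0 μ)
    (hμ0 : ∀ ξ, μ (Sum.inl ()) ξ = 1 / sqrtm M) (hm0 : m0 0 = 1) (hmt : dualMask M dig μ 0 = 1)
    (hw : ∀ w, waveMask M dig μ w 0 = 0) (hwt : ∀ w, waveMaskDual M dig μ w 0 = 0)
    {φ φt : L2 d} (hφ : IsRefinableL2 M m0 φ) (hφt : IsRefinableL2 M (dualMask M dig μ) φt) :
    ∃ ψ ψt : W → L2 d, (∀ w, IsWaveletL2 M m0 (waveMask M dig μ w) (ψ w)) ∧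
      (∀ w, IsWaveletL2 M (dualMask M dig μ) (waveMaskDual M dig μ w) (ψt w)) ∧
      IsDualFramePair (waveletSystem hM ψ) (waveletSystem hM ψt) := by
  choose a ha' using fun t q => isTrigPoly_matN (M := M) hμ.1 t q
  choose b hb' using fun t q => isTrigPoly_matNt (M := M) hμ.1 t q
  have ha : ∀ t q ξ, matN M μ ξ t q = trigSum (a t q) ξ := ha'
  have hb : ∀ t q ξ, matNt M μ ξ t q = trigSum (b t q) ξ := hb'
  have hNa : ∀ t, trigSum (assembleCoeff M dig (a t)) =
      assemble M dig fun k ξ => matN M μ ξ t k := fun t => by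
    funext ξ
    rw [trigSum_assembleCoeff]
    simp only [assemble, ha]
  have hNb : ∀ t, trigSum (assembleCoeff M dig (b t)) =
      assemble M dig fun k ξ => matNt M μ ξ t k := fun t => by
    funext ξ
    rw [trigSum_assembleCoeff]
    simp only [assemble, hb]
  have hNa0 : trigSum (assembleCoeff M dig (a (Sum.inl ()))) = m0 := by
    rw [hNa]
    funext ξ
    rw [hμ.2 ξ]
    simp only [matN_inl hμ0]
  have hNb0 : trigSum (assembleCoeff M dig (b (Sum.inl ()))) = dualMask M dig μ := by
    rw [hNb, dualMask_eq_assemble]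
  have hNaw : ∀ w, trigSum (assembleCoeff M dig (a (Sum.inr w))) = waveMask M dig μ w :=
    fun w => hNa _
  have hNbw : ∀ w, trigSum (assembleCoeff M dig (b (Sum.inr w))) = waveMaskDual M dig μ w :=
    fun w => hNb _
  refine ⟨_, _, fun w => ?_, fun w => ?_, isDualFramePair_of_filterBank hd hM hdig
    (a := a) (b := b) (fun q l ξ => ?_) (fun t => ?_) (fun t => ?_) (φ := φ) (φ' := φt)
    (by rwa [hNa0]) (by rwa [hNb0])⟩
  · exact fourier_maskOp hM (fun ξ => congrFun (hNaw w).symm ξ) hφ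
  · exact fourier_maskOp hM (fun ξ => congrFun (hNbw w).symm ξ) hφt
  -- The filter bank condition is the entry (l, q) of Ñ^* N = 1, a sum over the rows, that is, over
  -- the masks.
  · have h := congrFun (congrFun (conjTranspose_matNt_mul_matN (μ := μ) hM ξ) l) q
    rw [Matrix.mul_apply, Matrix.one_apply] at h
    simp only [eq_comm (a := q)]
    rw [← h]
    refine Finset.sum_congr rfl fun t _ => ?_
    rw [Matrix.conjTranspose_apply, ha, hb, mul_comm]
    rfl
  · rcases t with ⟨⟩ | w
    · rw [hNa0, hm0, if_pos rfl]
    · rw [hNaw, hw, if_neg Sum.inr_ne_inl]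
  · rcases t with ⟨⟩ | w
    · rw [hNb0, hmt, if_pos rfl]
    · rw [hNbw, hwt, if_neg Sum.inr_ne_inl]

end

end HSymWavelet

end

/-! ### Assembly of the four assertions -/

theorem theorem13 {d : ℕ} (hd : 0 < d)
    (M : Matrix (Fin d) (Fin d) ℤ) (hM : IsDilation M)
    (H : Subgroup (Matrix.GeneralLinearGroup (Fin d) ℤ)) (hH : IsSymmetryGroup M H)
    (D : Finset (Fin d → ℤ)) (hD : IsDigitSet Mᵀ D)
    {P : ℕ} {N : Fin (P + 1) → ℕ}
    (E : ∀ p, Fin (N p + 1) → Matrix.GeneralLinearGroup (Fin d) ℤ)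
    (s : ∀ p, Fin (N p + 1) → (Fin d → ℤ)) (hs : IsSymDigits M H E s)
    (n : ℕ) (hn : 0 < n)
    (m0 : Rn d → ℂ) (hsym : IsSymmAbout (H : Set (Matrix.GeneralLinearGroup (Fin d) ℤ)) 0 m0)
    (hint : IsInterpolatory M D m0) (hsum : HasSumRule M D n m0)
    (μ : Unit ⊕ WIdx N → Rn d → ℂ) (hμ : IsPolyphase M (digits s) m0 μ) :
    (∀ w : WIdx N,
      HasVM n (waveMask M (digits s) μ w) ∧ HasVM n (waveMaskDual M (digits s) μ w)) ∧
    (∀ (p : Fin P) (i : Fin (N p.succ + 1)),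
      IsSymmAbout (cosetStab M H (s p.succ i)) (intVec (s p.succ i))
        (waveMask M (digits s) μ ⟨p, i⟩) ∧
      IsSymmAbout (cosetStab M H (s p.succ i)) (intVec (s p.succ i))
        (waveMaskDual M (digits s) μ ⟨p, i⟩)) ∧
    (∀ (p : Fin P) (i : Fin (N p.succ + 1)) (ξ : Rn d),
      waveMask M (digits s) μ ⟨p, i⟩ ξ =
        waveMask M (digits s) μ ⟨p, 0⟩
          (transAct (E p.succ i : Matrix (Fin d) (Fin d) ℤ) ξ) ∧
      waveMaskDual M (digits s) μ ⟨p, i⟩ ξ =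
        waveMaskDual M (digits s) μ ⟨p, 0⟩
          (transAct (E p.succ i : Matrix (Fin d) (Fin d) ℤ) ξ)) ∧
    (∀ φ φt : L2 d, IsRefinableL2 M m0 φ → IsRefinableL2 M (dualMask M (digits s) μ) φt →
      ∃ ψ ψt : WIdx N → L2 d,
        (∀ w, IsWaveletL2 M m0 (waveMask M (digits s) μ w) (ψ w)) ∧
        (∀ w, IsWaveletL2 M (dualMask M (digits s) μ)
          (waveMaskDual M (digits s) μ w) (ψt w)) ∧
        IsDualFramePair (waveletSystem hM ψ) (waveletSystem hM ψt)) := by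
  have hdig := hs.isDigitFamily hH
  have h0 : digits s (Sum.inl ()) = 0 := hs.zero
  have hvm := hasVM_waveMask hM hD hdig h0 hsym.1 hμ hint hsum
  have hvmd := hasVM_waveMaskDual hM hD hdig h0 hsym.1 hμ hint hsum
  have htrans := fun {K : GL (Fin d) ℤ} (hK : K ∈ H) {w w' : WIdx N} =>
    waveMask_transAct (w := w) (w' := w') hM hH hD hdig h0 hμ hint hK (hsym.transAct_eq hK)
  refine ⟨fun w => ⟨hvm w, hvmd w⟩, fun p i => ?_, fun p i ξ => ?_, fun φ φt hφ hφt => ?_⟩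
  · have hc : ∀ K : GL (Fin d) ℤ, intVec (s p.succ i) -
        act (realMat (K : Matrix (Fin d) (Fin d) ℤ)) (intVec (s p.succ i)) =
        intVec (s p.succ i - (K : Matrix (Fin d) (Fin d) ℤ) *ᵥ s p.succ i) := fun K => by
      rw [act_realMat_intVec, intVec_sub]
    refine ⟨⟨isTrigPoly_waveMask hμ.1 _, fun K hK => ⟨⟨_, hc K⟩, fun ξ => ?_⟩⟩,
      ⟨isTrigPoly_waveMaskDual hμ.1 _, fun K hK => ⟨⟨_, hc K⟩, fun ξ => ?_⟩⟩⟩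
    -- A matrix of the stabilizer fixes the coset, so the transformation rule compares the mask with
    -- itself.
    · rw [hc K]
      exact (htrans hK.1 (w := ⟨p, i⟩) (w' := ⟨p, i⟩) hK.2 ξ).1
    · rw [hc K]
      exact (htrans hK.1 (w := ⟨p, i⟩) (w' := ⟨p, i⟩) hK.2 ξ).2
  -- The digits were chosen with E_p^{(i)} s_{p,0} equal to s_{p,i}, not merely congruent to it, so
  -- the character in the transformation rule is trivial.
  · have hd0 : (E p.succ i : Matrix (Fin d) (Fin d) ℤ) *ᵥ digits s (Sum.inr ⟨p, 0⟩) =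
        digits s (Sum.inr ⟨p, i⟩) := (hs.digit p.succ i).symm
    have h := htrans (hs.mem p.succ i) (w := ⟨p, 0⟩) (w' := ⟨p, i⟩)
      (by rw [hd0]; exact CongrMod.refl _) ξ
    simpa only [hd0, sub_self, intVec_zero, chr_zero_left, one_mul] using h
  · have hm0 : m0 0 = 1 := by
      have h := (flatAt_one_sub hM hD hsym.1 hint hsum).apply_eq_zero hn
      exact (sub_eq_zero.mp h).symm
    exact exists_isDualFramePair hd hM hdig hμ (hint.mu_zero hM hD hdig h0 hμ) hm0
      (dualMask_zero hM hD hdig hsym.1 hμ hint hn hsum) (fun w => (hvm w).apply_zero hn)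
      (fun w => (hvmd w).apply_zero hn) hφ hφt
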